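/- Consider the noncoherent two-relay diamond network with coherence time $T\ge 1$: a source S, two full-duplex relays $R_1,R_2$ and a destination D, with no direct link from S to D. In each fading block of $T$ symbols, $$Y_{R_i}=g_{\mathrm{sr}i}X_S+W_{R_i}\quad(i=1,2),\qquad Y_D=g_{\mathrm{rd}1}X_{R_1}+g_{\mathrm{rd}2}X_{R_2}+W_D,$$ where all signals are in $\mathbb{C}^T$, the noise entries are i.i.d. $\mathcal{CN}(0,1)$, and $g_{\mathrm{sr}i}\sim\mathcal{CN}(0,\rho_{\mathrm{sr}i}^2)$, $g_{\mathrm{rd}i}\sim\mathcal{CN}(0,\rho_{\mathrm{rd}i}^2)$ are constant within a block; all fading coefficients and noises are independent, also across blocks. The fading coefficients are known to no node, each symbol sent by a relay is a function of the symbols this relay received earlier, and the source and each relay obey a unit average power constraint per symbol. Let $C$ be the capacity, in bits per symbol: the supremum of the rates $R$ such that for every $\varepsilon>0$ and all large $n$ there is a code over $n$ blocks with at least $2^{nTR}$ messages and average error probability at most $\varepsilon$. For real exponents $\gamma_{\mathrm{sr}1},\gamma_{\mathrm{sr}2},\gamma_{\mathrm{rd}1},\gamma_{\mathrm{rd}2}$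 put $\rho_{\mathrm{sr}i}^2=\mathsf{SNR}^{\gamma_{\mathrm{sr}i}}$, $\rho_{\mathrm{rd}i}^2=\mathsf{SNR}^{\gamma_{\mathrm{rd}i}}$; the generalized degrees of freedom are $\mathrm{gDoF}=\lim_{\mathsf{SNR}\to\infty}C/\log_2\mathsf{SNR}$. Decode-and-forward over $R_1$ means that $R_2$ is silent, the source sends a sequence of sub-messages in successive groups of fading blocks, and $R_1$ decodes each sub-message from the group in which it was sent (with average error probability at most $\varepsilon$) and sends its estimate, re-encoded, in the next group, from which the destination decodes it. The gDoF that it attains is defined as above, with the supremum restricted to the rates achievable by such codes. Then: 1. If $\gamma_{\mathrm{rd}1}\ge\gamma_{\mathrm{sr}1}\ge\gamma_{\mathrm{sr}2}$ and $\gamma_{\mathrm{sr}1}\ge 0$, the limit exists and $\mathrm{gDoF}=\left(1-\tfrac1T\right)\gamma_{\mathrm{sr}1}$. 2. If $\gamma_{\mathrm{sr}1}\ge\gamma_{\mathrm{rd}1}\ge\gamma_{\mathrm{rd}2}$ and $\gamma_{\mathrm{rd}1}\ge 0$, the limit exists and $\mathrm{gDoF}=\left(1-\tfrac1T\right)\gamma_{\mathrm{rd}1}$.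 In both cases decode-and-forward over $R_1$ is gDoF-optimal: it attains exactly the same gDoF. -/

import Mathlib

open MeasureTheory ProbabilityTheory Filter Topology
open scoped NNReal ENNReal

namespace Diamond

/-- The law `CN(0, v)` of a circularly symmetric complex Gaussian with `E|z|² = v`. -/
noncomputable def complexGaussian (v : ℝ≥0) : Measure ℂ :=
  ((gaussianReal 0 (v / 2)).prod (gaussianReal 0 (v / 2))).map fun p => (⟨p.1, p.2⟩ : ℂ)

/-- A signal over `n` fading blocks of `T` symbols each; `x k t` is symbol `t` of block `k`. -/
abbrev Signal (n T : ℕ) : Type := Fin n → Fin T → ℂ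

/-- A realization of all the channel randomness over `n` fading blocks, as the tuple
`(g_sr, g_rd, W_R, W_D)`.  Relay `R₁` has index `0` and relay `R₂` has index `1`; each fading
coefficient is constant within a block. -/
abbrev Channel (n T : ℕ) : Type :=
  (Fin 2 → Fin n → ℂ) × (Fin 2 → Fin n → ℂ) × (Fin 2 → Signal n T) × Signal n T

/-- The law of the channel randomness: all coordinates are independent, with
`g_sr i k ∼ CN(0, ρsr i)`, `g_rd i k ∼ CN(0, ρrd i)`, and all noise symbols `∼ CN(0, 1)`.
Here `ρsr i` and `ρrd i` are the average strengths (the squares `ρ²`) of the links. -/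
noncomputable def channelLaw (n T : ℕ) (ρsr ρrd : Fin 2 → ℝ≥0) : Measure (Channel n T) :=
  (Measure.pi fun i => Measure.pi fun _ => complexGaussian (ρsr i)).prod
    ((Measure.pi fun i => Measure.pi fun _ => complexGaussian (ρrd i)).prod
      ((Measure.pi fun _ => Measure.pi fun _ => Measure.pi fun _ => complexGaussian 1).prod
        (Measure.pi fun _ => Measure.pi fun _ => complexGaussian 1)))

/-- `Y_{R_i} = g_{sr i} X_S + W_{R_i}`, blockwise. -/
noncomputable def relayReceives {n T : ℕ} (ω : Channel n T) (xS : Signal n T) (i : Fin 2) :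
    Signal n T :=
  fun k t => ω.1 i k * xS k t + ω.2.2.1 i k t

/-- `Y_D = g_{rd 1} X_{R_1} + g_{rd 2} X_{R_2} + W_D`, blockwise. -/
noncomputable def destReceives {n T : ℕ} (ω : Channel n T) (xR : Fin 2 → Signal n T) :
    Signal n T :=
  fun k t => (∑ i, ω.2.1 i k * xR i k t) + ω.2.2.2 k t

/-- A full-duplex relaying code over `n` fading blocks of length `T` with message set `𝓜`.
No node is given the fading coefficients (noncoherent model).  The relays are strictly causal at
the level of symbols: the symbol sent at time `(k, t)` depends on the symbols received before
`(k, t)` only, those of the current fading block included. -/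
structure Code (n T : ℕ) (𝓜 : Type) where
  encode : 𝓜 → Signal n T
  relay : Fin 2 → Signal n T → Signal n T
  decode : Signal n T → 𝓜
  measurable_relay : ∀ i, Measurable (relay i)
  causal : ∀ (i : Fin 2) (y y' : Signal n T) (k : Fin n) (t : Fin T),
    (∀ k' t', k' < k ∨ (k' = k ∧ t' < t) → y k' t' = y' k' t') →
      relay i y k t = relay i y' k t
  measurable_decode : ∀ m, MeasurableSet {y | decode y = m}

namespace Code

variable {n T : ℕ} {𝓜 : Type}

/-- The signal sent by relay `i` when the message is `m`. -/
noncomputable def relaySignal (c : Code n T 𝓜) (ω : Channel n T) (m : 𝓜) (i : Fin 2) :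
    Signal n T :=
  c.relay i (relayReceives ω (c.encode m) i)

/-- The signal received by the destination when the message is `m`. -/
noncomputable def destSignal (c : Code n T 𝓜) (ω : Channel n T) (m : 𝓜) : Signal n T :=
  destReceives ω (c.relaySignal ω m)

/-- The average probability of decoding error, for a uniformly distributed message. -/
noncomputable def errorProb [Fintype 𝓜] (c : Code n T 𝓜) (ρsr ρrd : Fin 2 → ℝ≥0) : ℝ≥0∞ :=
  (∑ m, channelLaw n T ρsr ρrd {ω | c.decode (c.destSignal ω m) ≠ m}) / Fintype.card 𝓜

/-- Unit average transmit power per symbol at the source and at both relays; the average is over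
the uniformly distributed message, the channel randomness and the `n * T` symbols. -/
def PowerConstraint [Fintype 𝓜] (c : Code n T 𝓜) (ρsr ρrd : Fin 2 → ℝ≥0) : Prop :=
  (∑ m, ∑ k, ∑ t, ‖c.encode m k t‖ₑ ^ 2) / Fintype.card 𝓜 ≤ (n * T : ℝ≥0∞) ∧
  ∀ i, (∑ m, ∫⁻ ω, ∑ k, ∑ t, ‖c.relaySignal ω m i k t‖ₑ ^ 2 ∂channelLaw n T ρsr ρrd)
    / Fintype.card 𝓜 ≤ (n * T : ℝ≥0∞)

end Code

/-- The rate `R` (bits per symbol) is achievable: for every `ε > 0` and every large enough number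
`n` of fading blocks there is a code with at least `2 ^ (n T R)` messages that meets the power
constraint and has error probability at most `ε`. -/
def Achievable (T : ℕ) (ρsr ρrd : Fin 2 → ℝ≥0) (R : ℝ) : Prop :=
  ∀ ε : ℝ≥0, 0 < ε → ∀ᶠ n : ℕ in atTop, ∃ (M : ℕ) (c : Code n T (Fin M)),
    (2 : ℝ) ^ ((n : ℝ) * T * R) ≤ M ∧ c.PowerConstraint ρsr ρrd ∧ c.errorProb ρsr ρrd ≤ ε

/-- The `b`-th group of `L` consecutive fading blocks of a signal. -/
def group {n T : ℕ} (L : ℕ) (y : Signal n T) (b : ℕ) : Signal L T :=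
  fun j t => if h : b * L + j < n then y ⟨b * L + j, h⟩ t else 0

/-- The ingredients of decode-and-forward over a single relay: one codebook for the link from the
source to the relay and one for the link from the relay to the destination, both for the message
set `Fin M` and over `L` fading blocks, each with a decoder for its receiver. -/
structure DecodeForward (L T M : ℕ) where
  sourceEnc : Fin M → Signal L T
  relayDec : Signal L T → Fin M
  relayEnc : Fin M → Signal L T
  destDec : Signal L T → Fin M
  measurable_relayDec : Measurable relayDec
  measurable_destDec : Measurable destDec

namespace DecodeForward

variable {L T M : ℕ}

lemma measurable_group {n : ℕ} (b : ℕ) :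
    Measurable fun y : Signal n T => group L y b := by
  refine measurable_pi_iff.2 fun j => measurable_pi_iff.2 fun t => ?_
  unfold group
  by_cases h : b * L + j < n
  · simp only [h, dite_true]; fun_prop
  · simp only [h, dite_false]; fun_prop

/-- The code that selects relay `R₁` and applies decode-and-forward to a sequence of `B`
sub-messages, over `n` fading blocks that are cut into groups of `L`.  The source sends the
codeword of sub-message `b` in group `b`.  At the end of group `b`, relay `R₁` decodes
sub-message `b` from what it received in that group, and it sends the codeword of its estimate in
group `b + 1`, from which the destination decodes sub-message `b`.  Relay `R₂` is silent.
Nothing is sent in the fading blocks after group `B`. -/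
noncomputable def toCode (d : DecodeForward L T M) (n B : ℕ) (hL : 0 < L) :
    Code n T (Fin B → Fin M) where
  encode m k t :=
    if h : k.val / L < B then
      d.sourceEnc (m ⟨k.val / L, h⟩) ⟨k.val % L, Nat.mod_lt _ hL⟩ t
    else 0
  relay i y k t :=
    if i = 0 ∧ 1 ≤ k.val / L ∧ k.val / L ≤ B then
      d.relayEnc (d.relayDec (group L y (k.val / L - 1))) ⟨k.val % L, Nat.mod_lt _ hL⟩ t
    else 0
  decode y b := d.destDec (group L y (b.val + 1))
  measurable_relay i := by
    refine measurable_pi_iff.2 fun k => measurable_pi_iff.2 fun t => ?_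
    by_cases h : i = 0 ∧ 1 ≤ k.val / L ∧ k.val / L ≤ B
    · simp only [h, and_self, if_true]
      exact (measurable_of_finite fun m => d.relayEnc m ⟨k.val % L, Nat.mod_lt _ hL⟩ t).comp
        (d.measurable_relayDec.comp (measurable_group _))
    · simp only [if_neg h]; exact measurable_const
  causal i y y' k t hy := by
    by_cases h : i = 0 ∧ 1 ≤ k.val / L ∧ k.val / L ≤ B
    · have hg : group L y (k.val / L - 1) = group L y' (k.val / L - 1) := by
        funext j s
        unfold group
        split_ifs with hj
        · apply hy
          left
          rw [Fin.lt_def]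
          obtain ⟨q, hq⟩ : ∃ q, k.val / L = q + 1 := ⟨k.val / L - 1, by omega⟩
          have h1 : (q + 1) * L ≤ k.val := hq ▸ Nat.div_mul_le_self _ _
          have h2 := j.isLt
          simp only [hq, Nat.add_sub_cancel]
          rw [Nat.succ_mul] at h1
          omega
        · rfl
      simp only [hg]
    · simp only [if_neg h]
  measurable_decode m := by
    have : Measurable fun (y : Signal n T) (b : Fin B) => d.destDec (group L y (b.val + 1)) :=
      measurable_pi_iff.2 fun b => d.measurable_destDec.comp (measurable_group _)
    exact this (measurableSet_singleton m)

/-- The average probability that relay `R₁` decodes some sub-message wrongly. -/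
noncomputable def relayErrorProb (d : DecodeForward L T M) (n B : ℕ) (hL : 0 < L)
    (ρsr ρrd : Fin 2 → ℝ≥0) : ℝ≥0∞ :=
  (∑ m : Fin B → Fin M, channelLaw n T ρsr ρrd
    {ω | ∃ b : Fin B,
      d.relayDec (group L (relayReceives ω ((d.toCode n B hL).encode m) 0) b) ≠ m b})
    / Fintype.card (Fin B → Fin M)

end DecodeForward

/-- The rate `R` (bits per symbol) is achievable by selecting relay `R₁` and using
decode-and-forward: as `Achievable`, but the codes are decode-and-forward codes over `R₁` alone,
and the relay also decodes with error probability at most `ε`. -/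
def AchievableByDecodeForwardR1 (T : ℕ) (ρsr ρrd : Fin 2 → ℝ≥0) (R : ℝ) : Prop :=
  ∀ ε : ℝ≥0, 0 < ε → ∀ᶠ n : ℕ in atTop,
    ∃ (L B M : ℕ) (hL : 0 < L) (d : DecodeForward L T M),
      (B + 1) * L ≤ n ∧
      (2 : ℝ) ^ ((n : ℝ) * T * R) ≤ (M : ℝ) ^ B ∧
      (d.toCode n B hL).PowerConstraint ρsr ρrd ∧
      d.relayErrorProb n B hL ρsr ρrd ≤ ε ∧
      (d.toCode n B hL).errorProb ρsr ρrd ≤ ε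

/-- `rates ρsr ρrd` being the set of rates available at link strengths `ρsr`, `ρrd`, the supremum
of these rates exists and scales as `g log SNR` when the links have strengths `SNR ^ γ`. -/
def HasPrelog (rates : (Fin 2 → ℝ≥0) → (Fin 2 → ℝ≥0) → Set ℝ) (γsr γrd : Fin 2 → ℝ) (g : ℝ) :
    Prop :=
  ∃ C : ℝ≥0 → ℝ,
    (∀ snr : ℝ≥0, 1 < snr →
      IsLUB (rates (fun i => snr ^ γsr i) (fun i => snr ^ γrd i)) (C snr)) ∧
    Tendsto (fun snr : ℝ≥0 => C snr / Real.logb 2 snr) atTop (𝓝 g)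

/-- The noncoherent two-relay diamond network with coherence time `T` and SNR-exponents
`γsr`, `γrd` has gDoF equal to `g`. -/
def HasGDoF (T : ℕ) (γsr γrd : Fin 2 → ℝ) (g : ℝ) : Prop :=
  HasPrelog (fun ρsr ρrd => {R | Achievable T ρsr ρrd R}) γsr γrd g

/-- Selecting relay `R₁` and using decode-and-forward attains gDoF equal to `g`. -/
def DecodeForwardR1HasGDoF (T : ℕ) (γsr γrd : Fin 2 → ℝ) (g : ℝ) : Prop :=
  HasPrelog (fun ρsr ρrd => {R | AchievableByDecodeForwardR1 T ρsr ρrd R}) γsr γrd g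

end Diamond

/-! The prelog is pinned between a cut-set converse and decode-and-forward; the cut used is the one
at the weaker hop of relay `R₁`.

Converse. For an unknown fading coefficient the output of a block has a bounded density: a
transmitted block `x` over a link of strength `ρ` spreads it so that the density is at most `2 / S`
with `S = 1 + ρ‖x‖²`. It is compared with a fixed heavy-tailed density, a product of factors `(1 +
‖y‖) ^ (-β)` with `β > 2` close to `2`. An output symbol has size about `√S`, so each costs `(β / 2)
log S`. At the destination cut the information density of a block is therefore about `(β T / 2 - 1)
log S`, which tends to `(T - 1) log S` as `β → 2`. At the source cut the two observations are `u =
g₀ x + w₀` and `v = g₁ x + w₁`. They are almost parallel: after the shear `v t - (u t / u t₀) * v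
t₀` only the coordinate `t₀` of `v` remains large. The second relay thus contributes `(β / 2 - 1)
log S₁`, which costs nothing in the limit, and the sum is at most `(β (T + 1) / 2 - 2) log S₀`.
Everything else has bounded mean, so a weak converse turns these estimates into rate bounds whose
additive constant does not depend on the link strengths. This is `rate_le_of_information_bound`,
applied in `rate_le_of_destination_cut` and `rate_le_of_source_cut`.

Achievability. Each block carries a pilot and grid points with about `SNR ^ γ` points per data
symbol, up to a small loss in the exponent; the received pilot stands in for the fading coefficient.
A block fails when the noise is not small compared with the fading, which becomes as rare as
desired. A Gilbert–Varshamov code over the blocks corrects a small fraction of failures. The same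
code serves both hops (`exists_link_code`, `exists_badProb_le`,
`achievableByDecodeForwardR1_of_badProb_le`). The pilot is the one symbol lost out of `T`. As
decode-and-forward rates are achievable rates, both prelogs are settled at once in
`hasGDoF_of_rate_bound`. -/

namespace Diamond

/-! ### Products of measures and of integrands -/

lemma lintegral_pi_prod {n : ℕ} {E : Type*} [MeasurableSpace E] (μ : Fin n → Measure E)
    [∀ i, SigmaFinite (μ i)] (f : Fin n → E → ℝ≥0∞) (hf : ∀ i, Measurable (f i)) :
    ∫⁻ x, ∏ i, f i (x i) ∂Measure.pi μ = ∏ i, ∫⁻ x, f i x ∂μ i := by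
  induction n with
  | zero => simp
  | succ n ih =>
    have h := (measurePreserving_piFinSuccAbove μ 0).symm
    rw [h.lintegral_map_equiv]
    simp only [MeasurableEquiv.piFinSuccAbove_symm_apply, Fin.insertNthEquiv,
      Fin.prod_univ_succ, Fin.insertNth_zero, Equiv.coe_fn_mk, Fin.cons_succ,
      Fin.zero_succAbove, Fin.cons_zero, cast_eq]
    rw [lintegral_prod_mul (f := f 0) (g := fun y : Fin n → E => ∏ i : Fin n, f i.succ (y i))
      (hf 0).aemeasurable
      (Finset.measurable_prod _ fun i _ => (hf _).comp (measurable_pi_apply i)).aemeasurable,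
      ih _ _ fun i => hf _]

lemma lintegral_lintegral_pi_prod {n : ℕ} {E F : Type*} [MeasurableSpace E] [MeasurableSpace F]
    (μ : Fin n → Measure E) (ν : Fin n → Measure F) [∀ i, SigmaFinite (μ i)]
    [∀ i, SigmaFinite (ν i)] (f : Fin n → E → F → ℝ≥0∞)
    (hf : ∀ i, Measurable (Function.uncurry (f i))) :
    ∫⁻ x, ∫⁻ y, ∏ i, f i (x i) (y i) ∂Measure.pi ν ∂Measure.pi μ
      = ∏ i, ∫⁻ x, ∫⁻ y, f i x y ∂ν i ∂μ i := by
  have h : ∀ x : Fin n → E, ∫⁻ y, ∏ i, f i (x i) (y i) ∂Measure.pi ν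
      = ∏ i, ∫⁻ y, f i (x i) y ∂ν i := fun x =>
    lintegral_pi_prod ν (fun i => f i (x i)) fun i => (hf i).of_uncurry_left
  simp_rw [h]
  exact lintegral_pi_prod μ (fun i a => ∫⁻ y, f i a y ∂ν i) fun i => (hf i).lintegral_prod_right'

lemma pi_withDensity {n : ℕ} {E : Type*} [MeasurableSpace E] (μ : Fin n → Measure E)
    [∀ i, SigmaFinite (μ i)] (f : Fin n → E → ℝ≥0∞) (hf : ∀ i, Measurable (f i))
    [∀ i, SigmaFinite ((μ i).withDensity (f i))] :
    Measure.pi (fun i => (μ i).withDensity (f i))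
      = (Measure.pi μ).withDensity fun x => ∏ i, f i (x i) := by
  refine Measure.pi_eq fun s hs => ?_
  rw [withDensity_apply _ (MeasurableSet.univ_pi hs),
    ← lintegral_indicator (MeasurableSet.univ_pi hs)]
  have h : (Set.univ.pi s).indicator (fun x => ∏ i, f i (x i))
      = fun x => ∏ i, (s i).indicator (f i) (x i) := by
    funext x
    by_cases hx : x ∈ Set.univ.pi s
    · rw [Set.indicator_of_mem hx]
      exact Finset.prod_congr rfl fun i _ => (Set.indicator_of_mem (hx i trivial) _).symm
    · rw [Set.indicator_of_notMem hx]
      simp only [Set.mem_pi, Set.mem_univ, true_imp_iff, not_forall] at hx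
      obtain ⟨i, hi⟩ := hx
      exact (Finset.prod_eq_zero (Finset.mem_univ i) (Set.indicator_of_notMem hi _)).symm
  rw [h, lintegral_pi_prod μ _ fun i => (hf i).indicator (hs i)]
  refine Finset.prod_congr rfl fun i _ => ?_
  rw [withDensity_apply _ (hs i), lintegral_indicator (hs i)]

/-! ### Complex Gaussian laws -/

lemma measurable_complexMk : Measurable fun p : ℝ × ℝ => (⟨p.1, p.2⟩ : ℂ) :=
  Complex.measurableEquivRealProd.symm.measurable

instance (v : ℝ≥0) : IsProbabilityMeasure (complexGaussian v) :=
  Measure.isProbabilityMeasure_map measurable_complexMk.aemeasurable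

lemma complexGaussian_eq_map (v : ℝ≥0) :
    complexGaussian v = (complexGaussian 1).map fun z => ((√v : ℝ) : ℂ) * z := by
  have h : gaussianReal 0 (v / 2) = (gaussianReal 0 (1 / 2)).map fun x => (√v : ℝ) * x := by
    rw [gaussianReal_map_const_mul]
    congr 1
    · simp
    · ext
      simp [Real.sq_sqrt, div_eq_mul_inv]
  unfold complexGaussian
  rw [h, Measure.map_prod_map _ _ (by fun_prop) (by fun_prop),
    Measure.map_map measurable_complexMk (by fun_prop),
    Measure.map_map (by fun_prop) measurable_complexMk]
  congr 1
  funext p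
  apply Complex.ext <;> simp

lemma lintegral_complexGaussian (v : ℝ≥0) (f : ℂ → ℝ≥0∞) (hf : Measurable f) :
    ∫⁻ z, f z ∂complexGaussian v = ∫⁻ z, f (((√v : ℝ) : ℂ) * z) ∂complexGaussian 1 := by
  rw [complexGaussian_eq_map, lintegral_map hf (by fun_prop)]

/-- The density of `CN(0, 1)`. -/
noncomputable def gaussDensity (z : ℂ) : ℝ≥0∞ :=
  ENNReal.ofReal (Real.pi⁻¹ * Real.exp (-‖z‖ ^ 2))

@[fun_prop]
lemma measurable_gaussDensity : Measurable gaussDensity := by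
  unfold gaussDensity; fun_prop

lemma gaussDensity_le_one (z : ℂ) : gaussDensity z ≤ 1 := by
  rw [gaussDensity, ENNReal.ofReal_le_one]
  have h1 : Real.pi⁻¹ ≤ 1 := inv_le_one_of_one_le₀ (by linarith [Real.pi_gt_three])
  have h2 : Real.exp (-‖z‖ ^ 2) ≤ 1 := Real.exp_le_one_iff.2 (by nlinarith [sq_nonneg ‖z‖])
  exact mul_le_one₀ h1 (Real.exp_nonneg _) h2

lemma complexGaussian_one_eq_withDensity :
    complexGaussian 1 = volume.withDensity gaussDensity := by
  have hv : (1 / 2 : ℝ≥0) ≠ 0 := by norm_num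
  unfold complexGaussian
  rw [gaussianReal_of_var_ne_zero _ hv,
    prod_withDensity (measurable_gaussianPDF _ _) (measurable_gaussianPDF _ _)]
  have hp := Complex.volume_preserving_equiv_real_prod.symm
  ext s hs
  rw [Measure.map_apply measurable_complexMk hs, withDensity_apply _ (measurable_complexMk hs),
    withDensity_apply _ hs, ← lintegral_indicator (measurable_complexMk hs),
    ← lintegral_indicator hs, hp.lintegral_map_equiv]
  refine lintegral_congr fun p => ?_
  by_cases hps : (⟨p.1, p.2⟩ : ℂ) ∈ s
  · rw [Set.indicator_of_mem (show p ∈ (fun p : ℝ × ℝ => (⟨p.1, p.2⟩ : ℂ)) ⁻¹' s from hps), Set.indicator_of_mem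
      (show Complex.measurableEquivRealProd.symm p ∈ s from hps)]
    simp only [gaussianPDF, gaussDensity]
    rw [← ENNReal.ofReal_mul (gaussianPDFReal_nonneg _ _ _)]
    congr 1
    simp only [gaussianPDFReal, sub_zero]
    have hn : ‖Complex.measurableEquivRealProd.symm p‖ ^ 2 = p.1 ^ 2 + p.2 ^ 2 := by
      rw [Complex.measurableEquivRealProd_symm_apply, ← Complex.normSq_eq_norm_sq,
        Complex.normSq_apply]
      ring
    rw [hn]
    have h2 : (2 * Real.pi * ((1 / 2 : ℝ≥0) : ℝ)) = Real.pi := by push_cast; ring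
    have h3 : (2 * ((1 / 2 : ℝ≥0) : ℝ)) = 1 := by push_cast; ring
    rw [h2, h3, mul_mul_mul_comm, ← Real.exp_add, ← mul_inv,
      Real.mul_self_sqrt Real.pi_pos.le]
    congr 2
    ring
  · rw [Set.indicator_of_notMem (show p ∉ (fun p : ℝ × ℝ => (⟨p.1, p.2⟩ : ℂ)) ⁻¹' s from hps), Set.indicator_of_notMem
      (show Complex.measurableEquivRealProd.symm p ∉ s from hps)]

lemma lintegral_complexGaussian_one (f : ℂ → ℝ≥0∞) (hf : Measurable f) :
    ∫⁻ z, f z ∂complexGaussian 1 = ∫⁻ z, gaussDensity z * f z := by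
  rw [complexGaussian_one_eq_withDensity,
    lintegral_withDensity_eq_lintegral_mul _ measurable_gaussDensity hf]
  rfl

lemma complexGaussian_one_le_volume : complexGaussian 1 ≤ volume := by
  rw [complexGaussian_one_eq_withDensity]
  calc volume.withDensity gaussDensity ≤ volume.withDensity 1 :=
        withDensity_mono (ae_of_all _ gaussDensity_le_one)
    _ = volume := withDensity_one

lemma lintegral_gaussDensity : ∫⁻ z, gaussDensity z = 1 := by
  have h := measure_univ (μ := complexGaussian 1)
  rwa [complexGaussian_one_eq_withDensity, withDensity_apply _ MeasurableSet.univ,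
    setLIntegral_univ] at h

lemma lintegral_comp_real_smul (r : ℝ) (hr : 0 < r) (f : ℂ → ℝ≥0∞) (hf : Measurable f) :
    ∫⁻ z, f (r • z) = ENNReal.ofReal (r ^ 2)⁻¹ * ∫⁻ z, f z := by
  rw [← lintegral_map hf (measurable_const_smul r), Measure.map_addHaar_smul _ hr.ne',
    lintegral_smul_measure, Complex.finrank_real_complex, abs_of_pos (by positivity), smul_eq_mul]

/-- The density of `g a + w` with `g, w` independent `CN(0, 1)` is `O(1 / (1 + ‖a‖²))`. -/
lemma lintegral_gaussDensity_sub_mul_le (a y : ℂ) :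
    ∫⁻ g, gaussDensity (y - g * a) ∂complexGaussian 1 ≤ ENNReal.ofReal (2 / (1 + ‖a‖ ^ 2)) := by
  rcases le_or_gt (‖a‖) 1 with ha | ha
  · calc ∫⁻ g, gaussDensity (y - g * a) ∂complexGaussian 1 ≤ ∫⁻ _, 1 ∂complexGaussian 1 :=
          lintegral_mono fun _ => gaussDensity_le_one _
      _ = 1 := by simp
      _ ≤ _ := by
        rw [← ENNReal.ofReal_one]
        apply ENNReal.ofReal_le_ofReal
        rw [le_div_iff₀ (by positivity)]
        nlinarith [norm_nonneg a]
  · have ha0 : a ≠ 0 := by rintro rfl; simp at ha; linarith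
    have h1 : ∀ g, gaussDensity (y - g * a) = gaussDensity (‖a‖ • (g - y / a)) := fun g => by
      have : y - g * a = -(a * (g - y / a)) := by field_simp; ring
      simp only [gaussDensity, this, norm_neg, norm_mul, norm_smul, norm_norm]
    -- The law of `g` has density at most `1`, so it may be replaced by Lebesgue measure; scaling
    -- the plane by `‖a‖` then gives the factor `‖a‖⁻²`.
    calc ∫⁻ g, gaussDensity (y - g * a) ∂complexGaussian 1
        ≤ ∫⁻ g, gaussDensity (y - g * a) := lintegral_mono' complexGaussian_one_le_volume le_rfl
      _ = ∫⁻ g, gaussDensity (‖a‖ • g) := by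
        simp_rw [h1]
        exact lintegral_sub_right_eq_self (fun g => gaussDensity (‖a‖ • g)) (y / a)
      _ = ENNReal.ofReal (‖a‖ ^ 2)⁻¹ := by
        rw [lintegral_comp_real_smul _ (by linarith) _ measurable_gaussDensity,
          lintegral_gaussDensity, mul_one]
      _ ≤ _ := by
        apply ENNReal.ofReal_le_ofReal
        rw [inv_eq_one_div, div_le_div_iff₀ (by positivity) (by positivity)]
        nlinarith

lemma lintegral_gaussDensity_sub_mul_le' (v : ℝ≥0) (x y : ℂ) :
    ∫⁻ g, gaussDensity (y - g * x) ∂complexGaussian v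
      ≤ ENNReal.ofReal (2 / (1 + v * ‖x‖ ^ 2)) := by
  rw [lintegral_complexGaussian _ _ (by fun_prop)]
  have h : ∀ g : ℂ, ((√v : ℝ) : ℂ) * g * x = g * (((√v : ℝ) : ℂ) * x) := fun g => by ring
  simp_rw [h]
  refine (lintegral_gaussDensity_sub_mul_le _ y).trans_eq ?_
  rw [norm_mul, mul_pow, Complex.norm_real, Real.norm_eq_abs, sq_abs, Real.sq_sqrt (NNReal.coe_nonneg v)]

/-- The first absolute moment of `CN(0, 1)`. -/
noncomputable def absMoment : ℝ≥0∞ := ∫⁻ z, ‖z‖ₑ ∂complexGaussian 1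

lemma absMoment_lt_top : absMoment < ∞ := by
  unfold absMoment complexGaussian
  rw [lintegral_map (by fun_prop) measurable_complexMk]
  have hm : ∫⁻ x, ‖x‖ₑ ∂gaussianReal 0 (1 / 2) < ∞ := by
    have := (memLp_id_gaussianReal (μ := 0) (v := 1 / 2) 1).integrable (by norm_num)
    exact this.2
  calc _ ≤ ∫⁻ p : ℝ × ℝ, (‖p.1‖ₑ + ‖p.2‖ₑ)
          ∂(gaussianReal 0 (1 / 2)).prod (gaussianReal 0 (1 / 2)) := by
        refine lintegral_mono fun p => ?_
        have : (⟨p.1, p.2⟩ : ℂ) = (p.1 : ℂ) + (p.2 : ℂ) * Complex.I := by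
          apply Complex.ext <;> simp
        rw [this]
        refine (enorm_add_le _ _).trans (le_of_eq ?_)
        rw [enorm_mul]
        simp [enorm_eq_nnnorm]
    _ = ∫⁻ x, ‖x‖ₑ ∂gaussianReal 0 (1 / 2) + ∫⁻ x, ‖x‖ₑ ∂gaussianReal 0 (1 / 2) := by
        rw [lintegral_add_left (by fun_prop)]
        rw [lintegral_prod _ (by fun_prop), lintegral_prod _ (by fun_prop)]
        simp
    _ < ∞ := ENNReal.add_lt_top.2 ⟨hm, hm⟩

lemma lintegral_norm_complexGaussian (v : ℝ≥0) (hv : 0 < v) :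
    ∫⁻ z, ENNReal.ofReal (‖z‖ / √v) ∂complexGaussian v = absMoment := by
  rw [lintegral_complexGaussian _ _ (by fun_prop), absMoment]
  refine lintegral_congr fun z => ?_
  have : (0 : ℝ) < √v := Real.sqrt_pos.2 hv
  rw [norm_mul, Complex.norm_real, Real.norm_of_nonneg this.le, mul_div_assoc,
    mul_div_cancel₀ _ this.ne', ofReal_norm]

/-- In polar coordinates the Jacobian `r` cancels the singularity `1 / r`. -/
lemma lintegral_inv_norm_ball_lt_top :
    ∫⁻ z in Metric.ball (0 : ℂ) 1, ENNReal.ofReal (1 / ‖z‖) < ∞ := by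
  rw [← lintegral_indicator Metric.isOpen_ball.measurableSet,
    ← Complex.lintegral_comp_polarCoord_symm]
  calc _ ≤ ∫⁻ p in polarCoord.target,
        (Set.Ioo (0 : ℝ) 1 ×ˢ Set.Ioo (-Real.pi) Real.pi).indicator 1 p := by
        refine setLIntegral_mono_ae' polarCoord.open_target.measurableSet (ae_of_all _ ?_)
        rintro ⟨r, t⟩ hp
        simp only [polarCoord_target, Set.mem_prod, Set.mem_Ioi] at hp
        have hn : ‖Complex.polarCoord.symm (r, t)‖ = r := by
          rw [Complex.norm_polarCoord_symm, abs_of_pos hp.1]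
        by_cases hr : r < 1
        · rw [Set.indicator_of_mem (by simpa [abs_of_pos hp.1] using hr),
            Set.indicator_of_mem (by exact ⟨⟨hp.1, hr⟩, hp.2⟩), hn, smul_eq_mul,
            ← ENNReal.ofReal_mul hp.1.le, mul_one_div_cancel hp.1.ne']
          simp
        · rw [Set.indicator_of_notMem (by simpa [abs_of_pos hp.1] using hr)]
          simp
    _ ≤ ∫⁻ p, (Set.Ioo (0 : ℝ) 1 ×ˢ Set.Ioo (-Real.pi) Real.pi).indicator 1 p :=
        setLIntegral_le_lintegral _ _
    _ = volume (Set.Ioo (0 : ℝ) 1 ×ˢ Set.Ioo (-Real.pi) Real.pi) :=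
        lintegral_indicator_one (measurableSet_Ioo.prod measurableSet_Ioo)
    _ < ∞ := by
        rw [Measure.volume_eq_prod, Measure.prod_prod, Real.volume_Ioo, Real.volume_Ioo]
        exact ENNReal.mul_lt_top ENNReal.ofReal_lt_top ENNReal.ofReal_lt_top

/-- A bound for `E[√(1 + v ‖x‖²) / ‖g x + w‖]`, uniform in `v` and `x`. -/
noncomputable def invMoment : ℝ≥0∞ :=
  1 + 2 * ∫⁻ z in Metric.ball (0 : ℂ) 1, ENNReal.ofReal (1 / ‖z‖)

lemma invMoment_lt_top : invMoment < ∞ :=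
  ENNReal.add_lt_top.2 ⟨ENNReal.one_lt_top,
    ENNReal.mul_lt_top (by simp) lintegral_inv_norm_ball_lt_top⟩

/-- Testing against `f` expresses a bound on the density of `g * x + w` without constructing that
density. -/
lemma lintegral_add_complexGaussian_le (v : ℝ≥0) (x : ℂ) (f : ℂ → ℝ≥0∞) (hf : Measurable f) :
    ∫⁻ g, ∫⁻ w, f (g * x + w) ∂complexGaussian 1 ∂complexGaussian v
      ≤ ENNReal.ofReal (2 / (1 + v * ‖x‖ ^ 2)) * ∫⁻ y, f y := by
  have h : ∀ g : ℂ, ∫⁻ w, f (g * x + w) ∂complexGaussian 1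
      = ∫⁻ y, gaussDensity (y - g * x) * f y := fun g => by
    rw [lintegral_complexGaussian_one _ (by fun_prop),
      ← lintegral_add_left_eq_self (fun y => gaussDensity (y - g * x) * f y) (g * x)]
    simp
  simp_rw [h]
  rw [lintegral_lintegral_swap (by fun_prop), ← lintegral_const_mul _ hf]
  refine lintegral_mono fun y => ?_
  rw [lintegral_mul_const _ (by fun_prop)]
  gcongr
  exact lintegral_gaussDensity_sub_mul_le' v x y

lemma lintegral_div_norm_le (v : ℝ≥0) (x : ℂ) :
    ∫⁻ g, ∫⁻ w, ENNReal.ofReal (√(1 + v * ‖x‖ ^ 2) / ‖g * x + w‖)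
      ∂complexGaussian 1 ∂complexGaussian v ≤ invMoment := by
  set R : ℝ := √(1 + v * ‖x‖ ^ 2) with hR
  have hpos : 0 < 1 + v * ‖x‖ ^ 2 := by positivity
  have hR0 : 0 < R := Real.sqrt_pos.2 hpos
  have hR2 : R ^ 2 = 1 + v * ‖x‖ ^ 2 := Real.sq_sqrt hpos.le
  let B : Set ℂ := Metric.ball 0 1
  have hB : MeasurableSet B := Metric.isOpen_ball.measurableSet
  let h : ℂ → ℝ≥0∞ := B.indicator fun z => ENNReal.ofReal (1 / ‖z‖)
  have hh : Measurable h := Measurable.indicator (by fun_prop) hB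
  -- The ratio exceeds `1` only for `‖u‖ < R`. Rescaling that disc to the unit disc produces `R ^
  -- 2`, which cancels the density bound `2 / R ^ 2`; hence the uniformity in `v` and `x`.
  have hle : ∀ u : ℂ, ENNReal.ofReal (R / ‖u‖) ≤ 1 + h (R⁻¹ • u) := fun u => by
    by_cases hu : R⁻¹ • u ∈ B
    · simp only [h, Set.indicator_of_mem hu]
      rw [norm_smul, Real.norm_of_nonneg (by positivity), one_div, mul_inv, inv_inv,
        ← div_eq_mul_inv]
      exact le_add_self
    · refine le_trans ?_ le_self_add
      rw [ENNReal.ofReal_le_one]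
      simp only [B, Metric.mem_ball, dist_zero_right, norm_smul, not_lt, norm_inv,
        Real.norm_of_nonneg hR0.le] at hu
      have hu0 : 0 < ‖u‖ := by
        by_contra hc
        have : ‖u‖ = 0 := le_antisymm (not_lt.1 hc) (norm_nonneg _)
        rw [this] at hu; norm_num at hu
      rw [div_le_one hu0]
      rwa [inv_mul_eq_div, le_div_iff₀ hR0, one_mul] at hu
  calc _ ≤ ∫⁻ g, ∫⁻ w, (1 + h (R⁻¹ • (g * x + w))) ∂complexGaussian 1 ∂complexGaussian v :=
        lintegral_mono fun g => lintegral_mono fun w => hle _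
    _ = 1 + ∫⁻ g, ∫⁻ w, h (R⁻¹ • (g * x + w)) ∂complexGaussian 1 ∂complexGaussian v := by
        have : ∀ g : ℂ, ∫⁻ w, (1 + h (R⁻¹ • (g * x + w))) ∂complexGaussian 1
            = 1 + ∫⁻ w, h (R⁻¹ • (g * x + w)) ∂complexGaussian 1 := fun g => by
          rw [lintegral_add_left measurable_const]; simp
        simp_rw [this]
        rw [lintegral_add_left measurable_const]; simp
    _ ≤ 1 + ENNReal.ofReal (2 / (1 + v * ‖x‖ ^ 2)) * ∫⁻ y, h (R⁻¹ • y) := by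
        gcongr
        exact lintegral_add_complexGaussian_le v x (fun u => h (R⁻¹ • u)) (by fun_prop)
    _ = invMoment := by
        rw [lintegral_comp_real_smul _ (by positivity) _ hh, lintegral_indicator hB, invMoment,
          ← mul_assoc, ← ENNReal.ofReal_mul (by positivity), ← hR2, inv_pow, inv_inv,
          div_mul_cancel₀ _ (by positivity)]
        simp [B]

/-! ### The laws of the two hops -/

/-- The law of the fading coefficients and the noise of the hop from the source to the relays. -/
noncomputable def srLaw (n T : ℕ) (ρ : Fin 2 → ℝ≥0) :
    Measure ((Fin 2 → Fin n → ℂ) × (Fin 2 → Signal n T)) :=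
  (Measure.pi fun i => Measure.pi fun _ => complexGaussian (ρ i)).prod
    (Measure.pi fun _ => Measure.pi fun _ => Measure.pi fun _ => complexGaussian 1)

/-- The law of the fading coefficients and the noise of the hop from the relays to the
destination. -/
noncomputable def rdLaw (n T : ℕ) (ρ : Fin 2 → ℝ≥0) :
    Measure ((Fin 2 → Fin n → ℂ) × Signal n T) :=
  (Measure.pi fun i => Measure.pi fun _ => complexGaussian (ρ i)).prod
    (Measure.pi fun _ => Measure.pi fun _ => complexGaussian 1)

instance (n T : ℕ) (ρ : Fin 2 → ℝ≥0) : IsProbabilityMeasure (srLaw n T ρ) := by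
  unfold srLaw; infer_instance

instance (n T : ℕ) (ρ : Fin 2 → ℝ≥0) : IsProbabilityMeasure (rdLaw n T ρ) := by
  unfold rdLaw; infer_instance

instance (n T : ℕ) (ρsr ρrd : Fin 2 → ℝ≥0) : IsProbabilityMeasure (channelLaw n T ρsr ρrd) := by
  unfold channelLaw; infer_instance

/-- The randomness is split by hop because the relay inputs depend on the first hop only: either hop
can be frozen while the other is integrated. -/
lemma lintegral_channelLaw {n T : ℕ} (ρsr ρrd : Fin 2 → ℝ≥0) (f : Channel n T → ℝ≥0∞)
    (hf : Measurable f) :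
    ∫⁻ ω, f ω ∂channelLaw n T ρsr ρrd
      = ∫⁻ p, ∫⁻ r, f (p.1, r.1, p.2, r.2) ∂rdLaw n T ρrd ∂srLaw n T ρsr := by
  unfold channelLaw srLaw rdLaw
  rw [lintegral_prod _ hf.aemeasurable, lintegral_prod _ (by fun_prop)]
  refine lintegral_congr fun a => ?_
  rw [lintegral_prod _ (by fun_prop)]
  have h1 : ∀ b : Fin 2 → Fin n → ℂ,
      ∫⁻ y : (Fin 2 → Signal n T) × Signal n T, f (a, b, y)
        ∂((Measure.pi fun _ => Measure.pi fun _ => Measure.pi fun _ => complexGaussian 1).prod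
        (Measure.pi fun _ => Measure.pi fun _ => complexGaussian 1))
      = ∫⁻ c, ∫⁻ d, f (a, b, c, d) ∂(Measure.pi fun _ => Measure.pi fun _ => complexGaussian 1)
        ∂(Measure.pi fun _ => Measure.pi fun _ => Measure.pi fun _ => complexGaussian 1) :=
    fun b => lintegral_prod _ (by fun_prop)
  have h2 : ∀ c : Fin 2 → Signal n T,
      ∫⁻ r : (Fin 2 → Fin n → ℂ) × Signal n T, f (a, r.1, c, r.2)
        ∂((Measure.pi fun i => Measure.pi fun _ => complexGaussian (ρrd i)).prod
        (Measure.pi fun _ => Measure.pi fun _ => complexGaussian 1))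
      = ∫⁻ b, ∫⁻ d, f (a, b, c, d) ∂(Measure.pi fun _ => Measure.pi fun _ => complexGaussian 1)
        ∂(Measure.pi fun i => Measure.pi fun _ => complexGaussian (ρrd i)) :=
    fun c => lintegral_prod _ (by fun_prop)
  simp_rw [h1, h2]
  exact lintegral_lintegral_swap (by fun_prop)

lemma measurePreserving_pi_pi_eval {n : ℕ} {E : Type*} [MeasurableSpace E] (μ : Fin 2 → Measure E)
    [∀ i, IsProbabilityMeasure (μ i)] (i : Fin 2) :
    MeasurePreserving (fun x : Fin 2 → Fin n → E => x i)
      (Measure.pi fun i => Measure.pi fun _ => μ i) (Measure.pi fun _ => μ i) :=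
  measurePreserving_eval (fun i => Measure.pi fun _ : Fin n => μ i) i

/-- The law of the fading coefficients and the noise of a point-to-point link. -/
noncomputable def linkLaw (n T : ℕ) (ρ : ℝ≥0) : Measure ((Fin n → ℂ) × Signal n T) :=
  (Measure.pi fun _ => complexGaussian ρ).prod
    (Measure.pi fun _ => Measure.pi fun _ => complexGaussian 1)

instance (n T : ℕ) (ρ : ℝ≥0) : IsProbabilityMeasure (linkLaw n T ρ) := by
  unfold linkLaw; infer_instance

lemma measurePreserving_srLink {n T : ℕ} (ρsr ρrd : Fin 2 → ℝ≥0) (i : Fin 2) :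
    MeasurePreserving (fun ω : Channel n T => (ω.1 i, ω.2.2.1 i))
      (channelLaw n T ρsr ρrd) (linkLaw n T (ρsr i)) := by
  have hg := measurePreserving_pi_pi_eval (n := n) (fun i => complexGaussian (ρsr i)) i
  have hw : MeasurePreserving (fun x : Fin 2 → Signal n T => x i)
      (Measure.pi fun _ => Measure.pi fun _ => Measure.pi fun _ => complexGaussian 1)
      (Measure.pi fun _ => Measure.pi fun _ => complexGaussian 1) :=
    measurePreserving_eval _ i
  exact hg.prod (hw.comp (measurePreserving_fst.comp measurePreserving_snd))

lemma measurePreserving_rdLink {n T : ℕ} (ρsr ρrd : Fin 2 → ℝ≥0) (i : Fin 2) :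
    MeasurePreserving (fun ω : Channel n T => (ω.2.1 i, ω.2.2.2))
      (channelLaw n T ρsr ρrd) (linkLaw n T (ρrd i)) := by
  have hg := measurePreserving_pi_pi_eval (n := n) (fun i => complexGaussian (ρrd i)) i
  exact (hg.prod measurePreserving_snd).comp measurePreserving_snd

lemma measurePreserving_linkLaw_symbol {n T : ℕ} (ρ : ℝ≥0) (k : Fin n) (t : Fin T) :
    MeasurePreserving (fun p : (Fin n → ℂ) × Signal n T => (p.1 k, p.2 k t))
      (linkLaw n T ρ) ((complexGaussian ρ).prod (complexGaussian 1)) := by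
  have hg := measurePreserving_eval (fun _ : Fin n => complexGaussian ρ) k
  have hw : MeasurePreserving (fun x : Signal n T => x k t)
      (Measure.pi fun _ => Measure.pi fun _ => complexGaussian 1) (complexGaussian 1) :=
    (measurePreserving_eval (fun _ : Fin T => complexGaussian 1) t).comp
      (measurePreserving_eval (fun _ : Fin n => Measure.pi fun _ : Fin T => complexGaussian 1) k)
  exact hg.prod hw

lemma lintegral_linkLaw_symbol {n T : ℕ} (ρ : ℝ≥0) (k : Fin n) (t : Fin T) (f : ℂ → ℂ → ℝ≥0∞)
    (hf : Measurable (Function.uncurry f)) :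
    ∫⁻ p, f (p.1 k) (p.2 k t) ∂linkLaw n T ρ
      = ∫⁻ g, ∫⁻ w, f g w ∂complexGaussian 1 ∂complexGaussian ρ :=
  ((measurePreserving_linkLaw_symbol ρ k t).lintegral_comp hf).trans
    (lintegral_prod _ hf.aemeasurable)

lemma lintegral_linkLaw_fading {n T : ℕ} (ρ : ℝ≥0) (k : Fin n) (f : ℂ → ℝ≥0∞)
    (hf : Measurable f) :
    ∫⁻ p, f (p.1 k) ∂linkLaw n T ρ = ∫⁻ g, f g ∂complexGaussian ρ :=
  ((measurePreserving_eval (fun _ : Fin n => complexGaussian ρ) k).comp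
    measurePreserving_fst).lintegral_comp hf

lemma lintegral_linkLaw_noise {n T : ℕ} (ρ : ℝ≥0) (k : Fin n) (t : Fin T) (f : ℂ → ℝ≥0∞)
    (hf : Measurable f) :
    ∫⁻ p, f (p.2 k t) ∂linkLaw n T ρ = ∫⁻ w, f w ∂complexGaussian 1 := by
  rw [lintegral_linkLaw_symbol ρ k t (fun _ w => f w) (by fun_prop)]
  simp

/-! ### Densities of the noise and of the received signals -/

lemma noise_eq_withDensity (T : ℕ) :
    (Measure.pi fun _ : Fin T => complexGaussian 1)
      = volume.withDensity fun w => ∏ t, gaussDensity (w t) := by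
  have hp : IsProbabilityMeasure (volume.withDensity gaussDensity) := by
    rw [← complexGaussian_one_eq_withDensity]; infer_instance
  simp_rw [complexGaussian_one_eq_withDensity]
  exact pi_withDensity (fun _ : Fin T => (volume : Measure ℂ)) _ fun _ => measurable_gaussDensity

lemma signalNoise_eq_withDensity (n T : ℕ) :
    (Measure.pi fun _ : Fin n => Measure.pi fun _ : Fin T => complexGaussian 1)
      = volume.withDensity fun w => ∏ k, ∏ t, gaussDensity (w k t) := by
  have hp : IsProbabilityMeasure
      (volume.withDensity fun w : Fin T → ℂ => ∏ t, gaussDensity (w t)) := by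
    rw [← noise_eq_withDensity]; infer_instance
  simp_rw [noise_eq_withDensity]
  exact pi_withDensity (fun _ : Fin n => (volume : Measure (Fin T → ℂ))) _ fun _ => by fun_prop

lemma relayNoise_eq_withDensity (n T : ℕ) :
    (Measure.pi fun _ : Fin 2 => Measure.pi fun _ : Fin n => Measure.pi fun _ : Fin T =>
      complexGaussian 1)
      = volume.withDensity fun w => ∏ i, ∏ k, ∏ t, gaussDensity (w i k t) := by
  have hp : IsProbabilityMeasure
      (volume.withDensity fun w : Signal n T => ∏ k, ∏ t, gaussDensity (w k t)) := by
    rw [← signalNoise_eq_withDensity]; infer_instance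
  simp_rw [signalNoise_eq_withDensity]
  exact pi_withDensity (fun _ : Fin 2 => (volume : Measure (Signal n T))) _ fun _ => by fun_prop

lemma lintegral_add_withDensity {G : Type*} [AddCommGroup G] [MeasureSpace G] [MeasurableAdd₂ G]
    [MeasurableSub₂ G] [(volume : Measure G).IsAddLeftInvariant] (ψ f : G → ℝ≥0∞)
    (hψ : Measurable ψ) (hf : Measurable f) (s : G) :
    ∫⁻ w, f (s + w) ∂volume.withDensity ψ = ∫⁻ y, ψ (y - s) * f y := by
  rw [lintegral_withDensity_eq_lintegral_mul _ hψ (by fun_prop),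
    ← lintegral_add_left_eq_self (fun y => ψ (y - s) * f y) s]
  simp

lemma exists_norm_eq_pi_norm {T : ℕ} (hT : 1 ≤ T) (x : Fin T → ℂ) : ∃ t, ‖x t‖ = ‖x‖ := by
  have : Nonempty (Fin T) := ⟨⟨0, hT⟩⟩
  obtain ⟨t, -, ht⟩ := Finset.exists_max_image Finset.univ (fun t => ‖x t‖) Finset.univ_nonempty
  exact ⟨t, le_antisymm (norm_le_pi_norm x t)
    ((pi_norm_le_iff_of_nonneg (norm_nonneg _)).2 fun s => ht s (Finset.mem_univ s))⟩

lemma prod_gaussDensity_le {T : ℕ} (w : Fin T → ℂ) (t : Fin T) :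
    ∏ s, gaussDensity (w s) ≤ gaussDensity (w t) := by
  rw [← Finset.mul_prod_erase _ _ (Finset.mem_univ t)]
  exact mul_le_of_le_one_right' (Finset.prod_le_one' fun s _ => gaussDensity_le_one (w s))

/-! ### The weak converse -/

/-- Each message is decoded wrongly, or has `Z m ≥ l`, or falls in the event bounded by `K * q m`.
On average the first case has mass at most `ε`, and the second at most `η` by Markov. The condition
on `ε` and `η` leaves exactly `ε` for the third. -/
lemma card_mul_le_of_meas_inter_le {Ω : Type*} [MeasurableSpace Ω] (P : Measure Ω)
    [IsProbabilityMeasure P] {M : ℕ} (E : Fin M → Set Ω) (Z : Fin M → Ω → ℝ≥0∞)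
    (hZ : ∀ m, Measurable (Z m)) (q : Fin M → ℝ≥0∞) {ε η l K : ℝ≥0∞} (hl : l ≠ 0) (hl' : l ≠ ∞)
    (hεη : ε + (ε + η) = 1) (hE : ∀ m, P (E m ∩ {ω | Z m ω < l}) ≤ K * q m)
    (herr : ∑ m, P (E m)ᶜ ≤ M * ε) (hmean : ∑ m, ∫⁻ ω, Z m ω ∂P ≤ M * η * l) :
    M * ε ≤ K * ∑ m, q m := by
  have hmarkov : ∑ m, P {ω | l ≤ Z m ω} ≤ M * η := by
    have h : l * ∑ m, P {ω | l ≤ Z m ω} ≤ l * (M * η) := by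
      rw [Finset.mul_sum, mul_comm l (M * η)]
      exact (Finset.sum_le_sum fun m _ => mul_meas_ge_le_lintegral (hZ m) l).trans hmean
    exact (ENNReal.mul_le_mul_iff_right hl hl').1 h
  have hone : ∀ m, 1 ≤ P (E m)ᶜ + (K * q m + P {ω | l ≤ Z m ω}) := fun m => by
    calc (1 : ℝ≥0∞) = P Set.univ := measure_univ.symm
      _ ≤ P ((E m)ᶜ ∪ (E m ∩ {ω | Z m ω < l} ∪ {ω | l ≤ Z m ω})) := by
        refine measure_mono fun ω _ => ?_
        by_cases h1 : ω ∈ E m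
        · rcases lt_or_ge (Z m ω) l with h2 | h2
          · exact Or.inr (Or.inl ⟨h1, h2⟩)
          · exact Or.inr (Or.inr h2)
        · exact Or.inl h1
      _ ≤ P (E m)ᶜ + (P (E m ∩ {ω | Z m ω < l}) + P {ω | l ≤ Z m ω}) :=
        (measure_union_le _ _).trans (by gcongr; exact measure_union_le _ _)
      _ ≤ _ := by gcongr; exact hE m
  have hsum : (M : ℝ≥0∞) ≤ M * ε + (K * ∑ m, q m + M * η) := by
    calc (M : ℝ≥0∞) = ∑ _m : Fin M, 1 := by simp
      _ ≤ ∑ m, (P (E m)ᶜ + (K * q m + P {ω | l ≤ Z m ω})) := Finset.sum_le_sum fun m _ => hone m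
      _ ≤ _ := by
        rw [Finset.sum_add_distrib, Finset.sum_add_distrib, ← Finset.mul_sum]
        gcongr
  have hfin : ∀ x : ℝ≥0∞, x ≤ 1 → (M : ℝ≥0∞) * x ≠ ∞ := fun x hx =>
    ENNReal.mul_ne_top (by simp) (ne_top_of_le_ne_top ENNReal.one_ne_top hx)
  have hε1 : ε ≤ 1 := hεη ▸ le_self_add
  have hη1 : η ≤ 1 := hεη ▸ (le_add_self.trans le_add_self)
  have hM : (M : ℝ≥0∞) * ε + (M * ε + M * η) = M := by
    rw [← mul_add, ← mul_add, hεη, mul_one]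
  have hsum' := hM.trans_le hsum
  rwa [ENNReal.add_le_add_iff_left (hfin ε hε1), ENNReal.add_le_add_iff_right (hfin η hη1)]
    at hsum'

/-- An upper bound for the rates in terms of a likelihood-ratio bound for the codes:
`Z m` dominates the information density of message `m` with respect to an auxiliary output measure
that gives mass `q m` to the decoding region of `m`. -/
lemma rate_le_of_information_bound {T : ℕ} {ρsr ρrd : Fin 2 → ℝ≥0} {R A κ : ℝ} (hA : 0 < A)
    (h : ∀ (n M : ℕ) (c : Code n T (Fin M)), c.PowerConstraint ρsr ρrd → 0 < M →
      ∃ (Z : Fin M → Channel n T → ℝ≥0∞) (q : Fin M → ℝ≥0∞), (∀ m, Measurable (Z m)) ∧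
        (∀ m, ∀ l : ℝ, channelLaw n T ρsr ρrd ({ω | c.decode (c.destSignal ω m) = m} ∩
          {ω | Z m ω < ENNReal.ofReal l}) ≤ ENNReal.ofReal (Real.exp l) * q m) ∧
        ∑ m, q m ≤ ENNReal.ofReal (Real.exp (n * κ)) ∧
        ∑ m, ∫⁻ ω, Z m ω ∂channelLaw n T ρsr ρrd ≤ M * ENNReal.ofReal (n * A))
    (hR : Achievable T ρsr ρrd R) : T * R * Real.log 2 ≤ A + κ := by
  have key : ∀ ε : ℝ, 0 < ε → ε < 1 / 2 → T * R * Real.log 2 ≤ A / (1 - 2 * ε) + κ := by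
    intro ε hε hε2
    have hev : ∀ᶠ n : ℕ in atTop,
        T * R * Real.log 2 + Real.log ε / n ≤ A / (1 - 2 * ε) + κ := by
      filter_upwards [hR ⟨ε, hε.le⟩ hε, eventually_gt_atTop 0] with n ⟨M, c, hM, hpow, herr⟩ hn
      have hn' : (0 : ℝ) < n := by exact_mod_cast hn
      have hM0 : 0 < M := by
        have : (0 : ℝ) < M := lt_of_lt_of_le (by positivity) hM
        exact_mod_cast this
      obtain ⟨Z, q, hZ, hq, hqs, hmean⟩ := h n M c hpow hM0
      have hη : 0 < 1 - 2 * ε := by linarith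
      -- With this threshold the Markov bound for a mean of `n * A` is exactly `1 - 2 * ε`.
      set l : ℝ := n * A / (1 - 2 * ε) with hl
      have hl0 : 0 < l := by positivity
      have hmain := card_mul_le_of_meas_inter_le (channelLaw n T ρsr ρrd)
        (fun m => {ω | c.decode (c.destSignal ω m) = m}) Z hZ q
        (ε := ENNReal.ofReal ε) (η := ENNReal.ofReal (1 - 2 * ε)) (l := ENNReal.ofReal l)
        (K := ENNReal.ofReal (Real.exp l)) (by simpa using hl0) ENNReal.ofReal_ne_top
        (by
          rw [← ENNReal.ofReal_add hε.le hη.le, ← ENNReal.ofReal_add hε.le (by linarith),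
            ← ENNReal.ofReal_one]
          congr 1; ring)
        (fun m => hq m l)
        (by
          have := herr
          unfold Code.errorProb at this
          rw [ENNReal.div_le_iff (by simpa using hM0.ne') (by simp), Fintype.card_fin,
            mul_comm] at this
          refine this.trans_eq ?_
          congr 1
          exact (ENNReal.ofReal_eq_coe_nnreal hε.le).symm)
        (by
          refine hmean.trans_eq ?_
          rw [mul_assoc, ← ENNReal.ofReal_mul hη.le, hl, mul_div_cancel₀ _ hη.ne'])
      have h1 : (M : ℝ) * ε ≤ Real.exp l * Real.exp (n * κ) := by
        have h2 : ENNReal.ofReal (M * ε) ≤ ENNReal.ofReal (Real.exp l * Real.exp (n * κ)) := by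
          rw [ENNReal.ofReal_mul (by positivity), ENNReal.ofReal_mul (by positivity),
            ENNReal.ofReal_natCast]
          exact hmain.trans (by gcongr)
        exact (ENNReal.ofReal_le_ofReal_iff (by positivity)).1 h2
      have h3 : (2 : ℝ) ^ ((n : ℝ) * T * R) * ε ≤ Real.exp (l + n * κ) := by
        rw [Real.exp_add]
        exact (mul_le_mul_of_nonneg_right hM hε.le).trans h1
      have h4 := Real.log_le_log (by positivity) h3
      rw [Real.log_mul (by positivity) hε.ne', Real.log_rpow (by norm_num), Real.log_exp] at h4
      have h5 : (n : ℝ) * (T * R * Real.log 2 + Real.log ε / n)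
          ≤ n * (A / (1 - 2 * ε) + κ) := by
        have e1 : (n : ℝ) * (Real.log ε / n) = Real.log ε := mul_div_cancel₀ _ hn'.ne'
        have e2 : (n : ℝ) * (A / (1 - 2 * ε)) = l := by rw [hl, mul_div_assoc]
        rw [mul_add, mul_add, e1, e2]
        linarith
      exact le_of_mul_le_mul_left h5 hn'
    have hlim : Tendsto (fun n : ℕ => T * R * Real.log 2 + Real.log ε / n) atTop
        (𝓝 (T * R * Real.log 2 + 0)) :=
      tendsto_const_nhds.add (tendsto_const_div_atTop_nhds_zero_nat _)
    simpa using le_of_tendsto hlim hev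
  by_contra hcon
  push Not at hcon
  set X : ℝ := T * R * Real.log 2 - κ with hX
  have hXA : A < X := by linarith
  have hX0 : 0 < X := hA.trans hXA
  -- This `ε` makes `X * (1 - 2 * ε)` the midpoint of `A` and `X`, so `X ≤ A / (1 - 2 * ε)` fails.
  -- It stands in for letting `ε` tend to `0`.
  have hε : 0 < (X - A) / (4 * X) := div_pos (by linarith) (by linarith)
  have hε2 : (X - A) / (4 * X) < 1 / 2 := by
    rw [div_lt_div_iff₀ (by linarith) (by norm_num)]; linarith
  have hk := key _ hε hε2
  have hη : 0 < 1 - 2 * ((X - A) / (4 * X)) := by linarith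
  have hk' : X ≤ A / (1 - 2 * ((X - A) / (4 * X))) := by linarith
  rw [le_div_iff₀ hη] at hk'
  have : X * (1 - 2 * ((X - A) / (4 * X))) = X - (X - A) / 2 := by
    field_simp; ring
  linarith

/-! ### Heavy-tailed auxiliary densities -/

/-- The unnormalized density `(1 + ‖z‖) ^ (-β)` on `ℂ`. -/
noncomputable def tail (β : ℝ) (z : ℂ) : ℝ≥0∞ := ENNReal.ofReal ((1 + ‖z‖) ^ (-β))

@[fun_prop]
lemma measurable_tail (β : ℝ) : Measurable (tail β) := by
  unfold tail; fun_prop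

/-- The total mass of `tail β`. -/
noncomputable def tailMass (β : ℝ) : ℝ≥0∞ := ∫⁻ z, tail β z

/-- The threshold `2` is the real dimension of `ℂ`. -/
lemma tailMass_lt_top {β : ℝ} (hβ : 2 < β) : tailMass β < ∞ :=
  finite_integral_one_add_norm (by simpa [Complex.finrank_real_complex] using hβ)

lemma tail_eq_exp (β : ℝ) (z : ℂ) :
    tail β z = ENNReal.ofReal (Real.exp (-(β * Real.log (1 + ‖z‖)))) := by
  have : 0 < 1 + ‖z‖ := by positivity
  rw [tail, Real.rpow_def_of_pos this]
  congr 2; ring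

/-- Separates the leading term `log S / 2` of an output symbol from a remainder that is linear in
the normalized fading and noise, hence of bounded mean. -/
lemma log_one_add_le_of_le_sqrt_mul {r S a : ℝ} (hr : 0 ≤ r) (hS : 1 ≤ S) (ha : 0 ≤ a)
    (h : r ≤ √S * a) : Real.log (1 + r) ≤ Real.log S / 2 + a := by
  have hs : 1 ≤ √S := Real.one_le_sqrt.2 hS
  calc Real.log (1 + r) ≤ Real.log (√S * (1 + a)) :=
        Real.log_le_log (by linarith) (by nlinarith)
    _ = Real.log S / 2 + Real.log (1 + a) := by
        rw [Real.log_mul (by linarith) (by linarith), Real.log_sqrt (by linarith)]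
    _ ≤ _ := by
        have := Real.log_le_sub_one_of_pos (show 0 < 1 + a by linarith)
        linarith

/-- Plays the role of Jensen's inequality: the signal energy `s` comes out linearly, so that an
average power constraint suffices. -/
lemma log_one_add_mul_le {ρ s : ℝ} (hρ : 0 ≤ ρ) (hs : 0 ≤ s) :
    Real.log (1 + ρ * s) ≤ Real.log (1 + ρ) + s := by
  calc Real.log (1 + ρ * s) ≤ Real.log ((1 + ρ) * (1 + s)) :=
        Real.log_le_log (by positivity) (by nlinarith)
    _ = Real.log (1 + ρ) + Real.log (1 + s) := Real.log_mul (by positivity) (by positivity)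
    _ ≤ _ := by
        have := Real.log_le_sub_one_of_pos (show 0 < 1 + s by linarith)
        linarith

lemma mul_norm_le_sqrt_mul {ρ : ℝ} (hρ : 0 < ρ) {S : ℝ} {g x : ℂ} (hS : ρ * ‖x‖ ^ 2 ≤ S) :
    ‖g * x‖ ≤ √S * (‖g‖ / √ρ) := by
  have h1 : 0 < √ρ := Real.sqrt_pos.2 hρ
  have h2 : √ρ * ‖x‖ ≤ √S := by
    apply Real.le_sqrt_of_sq_le
    rwa [mul_pow, Real.sq_sqrt hρ.le]
  rw [norm_mul, mul_div_assoc', le_div_iff₀ h1]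
  nlinarith [norm_nonneg g, norm_nonneg x]

/-! ### The cut at the destination -/

section DestinationCut

variable {n T : ℕ}

/-- Only the Gaussian factor at the strongest symbol of the dominant relay is kept. That relay's
fading is integrated first, with the contribution of the other relay acting as a mere translation.
-/
lemma lintegral_miso_block_le (hT : 1 ≤ T) (ρ : Fin 2 → ℝ≥0) (x : Fin 2 → Fin T → ℂ)
    (y : Fin T → ℂ) :
    ∫⁻ g₀, ∫⁻ g₁, ∏ t, gaussDensity (y t - (g₀ * x 0 t + g₁ * x 1 t)) ∂complexGaussian (ρ 1)
      ∂complexGaussian (ρ 0)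
      ≤ ENNReal.ofReal (2 / (1 + max (ρ 0 * ‖x 0‖ ^ 2) (ρ 1 * ‖x 1‖ ^ 2))) := by
  rcases max_choice ((ρ 0 : ℝ) * ‖x 0‖ ^ 2) (ρ 1 * ‖x 1‖ ^ 2) with h | h <;> rw [h]
  · obtain ⟨t, ht⟩ := exists_norm_eq_pi_norm hT (x 0)
    rw [lintegral_lintegral_swap (by fun_prop)]
    calc _ ≤ ∫⁻ _, ENNReal.ofReal (2 / (1 + ρ 0 * ‖x 0‖ ^ 2)) ∂complexGaussian (ρ 1) := by
          refine lintegral_mono fun g₁ => ?_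
          rw [← ht]
          refine le_trans (lintegral_mono fun g₀ => (prod_gaussDensity_le _ t).trans_eq ?_)
            (lintegral_gaussDensity_sub_mul_le' (ρ 0) (x 0 t) (y t - g₁ * x 1 t))
          congr 1; ring
      _ = _ := by simp
  · obtain ⟨t, ht⟩ := exists_norm_eq_pi_norm hT (x 1)
    calc _ ≤ ∫⁻ _, ENNReal.ofReal (2 / (1 + ρ 1 * ‖x 1‖ ^ 2)) ∂complexGaussian (ρ 0) := by
          refine lintegral_mono fun g₀ => ?_
          rw [← ht]
          refine le_trans (lintegral_mono fun g₁ => (prod_gaussDensity_le _ t).trans_eq ?_)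
            (lintegral_gaussDensity_sub_mul_le' (ρ 1) (x 1 t) (y t - g₀ * x 0 t))
          congr 1; ring
      _ = _ := by simp

/-- A bound for the density of the signal at the destination in one block. -/
noncomputable def misoBound (ρ : Fin 2 → ℝ≥0) (X : Fin 2 → Signal n T) (k : Fin n) : ℝ≥0∞ :=
  ENNReal.ofReal (2 / (1 + max (ρ 0 * ‖X 0 k‖ ^ 2) (ρ 1 * ‖X 1 k‖ ^ 2)))

/-- The signal at the destination for given signals of the relays. -/
noncomputable def misoOutput (X : Fin 2 → Signal n T)
    (r : (Fin 2 → Fin n → ℂ) × Signal n T) : Signal n T :=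
  fun k t => (∑ i, r.1 i k * X i k t) + r.2 k t

lemma measurable_misoOutput (X : Fin 2 → Signal n T) : Measurable (misoOutput X) := by
  unfold misoOutput; fun_prop

/-- For fixed relay signals the blocks are independent, so the output density is at most the product
of the one-block bounds, whatever the signals are. -/
lemma lintegral_misoOutput_le (hT : 1 ≤ T) (ρ : Fin 2 → ℝ≥0) (X : Fin 2 → Signal n T)
    (f : Signal n T → ℝ≥0∞) (hf : Measurable f) :
    ∫⁻ r, f (misoOutput X r) ∂rdLaw n T ρ ≤ (∏ k, misoBound ρ X k) * ∫⁻ y, f y := by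
  let s : (Fin 2 → Fin n → ℂ) → Signal n T := fun g k t => ∑ i, g i k * X i k t
  have hs : Measurable s := by fun_prop
  let ψ : Signal n T → ℝ≥0∞ := fun w => ∏ k, ∏ t, gaussDensity (w k t)
  have hψ : Measurable ψ := by fun_prop
  have hfo : Measurable fun r => f (misoOutput X r) := hf.comp (measurable_misoOutput X)
  have h1 : ∀ g : Fin 2 → Fin n → ℂ,
      ∫⁻ w, f (misoOutput X (g, w)) ∂(Measure.pi fun _ => Measure.pi fun _ => complexGaussian 1)
        = ∫⁻ y, ψ (y - s g) * f y := fun g => by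
    rw [signalNoise_eq_withDensity]
    exact lintegral_add_withDensity ψ f hψ hf (s g)
  rw [rdLaw, lintegral_prod _ hfo.aemeasurable]
  simp_rw [h1]
  rw [lintegral_lintegral_swap (by fun_prop), ← lintegral_const_mul _ hf]
  refine lintegral_mono fun y => ?_
  rw [lintegral_mul_const _ (by fun_prop)]
  gcongr
  rw [(measurePreserving_piFinTwo
    fun i => Measure.pi fun _ : Fin n => complexGaussian (ρ i)).symm.lintegral_map_equiv,
    lintegral_prod _ (by fun_prop)]
  have h2 := lintegral_lintegral_pi_prod (fun _ : Fin n => complexGaussian (ρ 0))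
    (fun _ : Fin n => complexGaussian (ρ 1))
    (fun k a b => ∏ t, gaussDensity (y k t - (a * X 0 k t + b * X 1 k t)))
    (fun k => by unfold Function.uncurry; fun_prop)
  refine le_trans (le_of_eq ?_)
    (Finset.prod_le_prod' fun k _ => lintegral_miso_block_le hT ρ (fun i => X i k) (y k))
  rw [← h2]
  simp [ψ, s, Fin.sum_univ_two]

/-- A bound for the information density in one block. -/
lemma misoBound_le (hT : 1 ≤ T) {β : ℝ} (hβ : 2 < β) {ρ : Fin 2 → ℝ≥0} (hρ : ∀ i, 0 < ρ i)
    (hρ10 : ρ 1 ≤ ρ 0) (X : Fin 2 → Signal n T) (r : (Fin 2 → Fin n → ℂ) × Signal n T)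
    (k : Fin n) :
    misoBound ρ X k ≤ ENNReal.ofReal (Real.exp (Real.log 2
        + (β / 2 * T - 1) * (Real.log (1 + ρ 0) + ∑ i, ∑ t, ‖X i k t‖ ^ 2)
        + β * ∑ t, (‖r.1 0 k‖ / √(ρ 0) + ‖r.1 1 k‖ / √(ρ 1) + ‖r.2 k t‖)))
      * ∏ t, tail β (misoOutput X r k t) := by
  have hT' : (1 : ℝ) ≤ T := by exact_mod_cast hT
  set m : ℝ := max (ρ 0 * ‖X 0 k‖ ^ 2) (ρ 1 * ‖X 1 k‖ ^ 2) with hm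
  have hm0 : 0 ≤ m := le_max_of_le_left (by positivity)
  set S : ℝ := 1 + m with hS
  have hS1 : 1 ≤ S := by linarith
  have hα : 0 ≤ β / 2 * T - 1 := by nlinarith
  have hxi : ∀ i t, (ρ i : ℝ) * ‖X i k t‖ ^ 2 ≤ S := fun i t => by
    have h1 : (ρ i : ℝ) * ‖X i k t‖ ^ 2 ≤ ρ i * ‖X i k‖ ^ 2 := by
      gcongr; exact norm_le_pi_norm _ t
    have h2 : (ρ i : ℝ) * ‖X i k‖ ^ 2 ≤ m := by
      fin_cases i
      · exact le_max_left _ _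
      · exact le_max_right _ _
    linarith
  have hlogS : Real.log S ≤ Real.log (1 + ρ 0) + ∑ i, ∑ t, ‖X i k t‖ ^ 2 := by
    have hnorm : ∀ i, ‖X i k‖ ^ 2 ≤ ∑ t, ‖X i k t‖ ^ 2 := fun i => by
      obtain ⟨t, ht⟩ := exists_norm_eq_pi_norm hT (X i k)
      rw [← ht]
      exact Finset.single_le_sum (f := fun t => ‖X i k t‖ ^ 2) (fun _ _ => by positivity)
        (Finset.mem_univ t)
    have hsum0 : 0 ≤ ∑ i, ‖X i k‖ ^ 2 := Finset.sum_nonneg fun _ _ => by positivity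
    have h1 : m ≤ ρ 0 * ∑ i, ‖X i k‖ ^ 2 := by
      rw [Fin.sum_univ_two]
      have h01 : (ρ 1 : ℝ) ≤ ρ 0 := by exact_mod_cast hρ10
      have h0 : (0 : ℝ) ≤ ρ 0 := (ρ 0).2
      apply max_le <;> nlinarith [sq_nonneg ‖X 0 k‖, sq_nonneg ‖X 1 k‖]
    calc Real.log S ≤ Real.log (1 + ρ 0 * ∑ i, ‖X i k‖ ^ 2) :=
          Real.log_le_log (by linarith) (by linarith)
      _ ≤ Real.log (1 + ρ 0) + ∑ i, ‖X i k‖ ^ 2 := log_one_add_mul_le (by positivity) hsum0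
      _ ≤ _ := by gcongr with i; exact hnorm i
  have hlogy : ∀ t, Real.log (1 + ‖misoOutput X r k t‖) ≤ Real.log S / 2
      + (‖r.1 0 k‖ / √(ρ 0) + ‖r.1 1 k‖ / √(ρ 1) + ‖r.2 k t‖) := fun t => by
    refine log_one_add_le_of_le_sqrt_mul (norm_nonneg _) hS1 (by positivity) ?_
    have h0 := mul_norm_le_sqrt_mul (NNReal.coe_pos.2 (hρ 0)) (g := r.1 0 k) (hxi 0 t)
    have h1 := mul_norm_le_sqrt_mul (NNReal.coe_pos.2 (hρ 1)) (g := r.1 1 k) (hxi 1 t)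
    have h2 : ‖r.2 k t‖ ≤ √S * ‖r.2 k t‖ :=
      le_mul_of_one_le_left (norm_nonneg _) (Real.one_le_sqrt.2 hS1)
    simp only [misoOutput, Fin.sum_univ_two]
    calc _ ≤ ‖r.1 0 k * X 0 k t‖ + ‖r.1 1 k * X 1 k t‖ + ‖r.2 k t‖ := norm_add₃_le
      _ ≤ _ := by rw [mul_add, mul_add]; gcongr
  unfold misoBound
  simp_rw [tail_eq_exp]
  rw [← ENNReal.ofReal_prod_of_nonneg (fun _ _ => Real.exp_nonneg _), ← Real.exp_sum,
    ← ENNReal.ofReal_mul (Real.exp_nonneg _), ← Real.exp_add]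
  apply ENNReal.ofReal_le_ofReal
  rw [← Real.log_le_iff_le_exp (by positivity), Real.log_div (by norm_num) (by linarith)]
  rw [Finset.sum_neg_distrib, ← Finset.mul_sum]
  have hsumy : ∑ t, Real.log (1 + ‖misoOutput X r k t‖) ≤ T * (Real.log S / 2)
      + ∑ t, (‖r.1 0 k‖ / √(ρ 0) + ‖r.1 1 k‖ / √(ρ 1) + ‖r.2 k t‖) := by
    refine (Finset.sum_le_sum fun t _ => hlogy t).trans_eq ?_
    rw [Finset.sum_add_distrib]; simp
  -- The coefficient of `log S` is `-1` from the output density plus `β / 2` for each of the `T`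
  -- symbols. It is nonnegative, so `h4` may bound `log S` from above.
  have h3 := mul_le_mul_of_nonneg_left hsumy (by linarith : (0 : ℝ) ≤ β)
  have h4 := mul_le_mul_of_nonneg_left hlogS hα
  rw [← hm, ← hS]
  nlinarith

end DestinationCut

/-! ### Measurability of the signals of a code -/

section Measurability

variable {n T : ℕ} {𝓜 : Type}

lemma measurable_relaySignal (c : Code n T 𝓜) (m : 𝓜) (i : Fin 2) :
    Measurable fun ω : Channel n T => c.relaySignal ω m i := by
  unfold Code.relaySignal relayReceives
  exact (c.measurable_relay i).comp (by fun_prop)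

lemma measurable_relaySignal_apply (c : Code n T 𝓜) (m : 𝓜) (i : Fin 2) (k : Fin n) (t : Fin T) :
    Measurable fun ω : Channel n T => c.relaySignal ω m i k t :=
  (measurable_pi_apply t).comp ((measurable_pi_apply k).comp (measurable_relaySignal c m i))

lemma measurable_destSignal (c : Code n T 𝓜) (m : 𝓜) :
    Measurable fun ω : Channel n T => c.destSignal ω m := by
  have := measurable_relaySignal_apply c m
  unfold Code.destSignal destReceives
  fun_prop

lemma measurableSet_decode_destSignal (c : Code n T 𝓜) (m : 𝓜) :
    MeasurableSet {ω : Channel n T | c.decode (c.destSignal ω m) = m} :=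
  measurable_destSignal c m (c.measurable_decode m)

end Measurability

/-! ### From one block to a whole code, and the rate bound at the destination -/

lemma sum_setLIntegral_fiber_le {α : Type*} [MeasurableSpace α] (μ : Measure α) {M : ℕ}
    (dec : α → Fin M) (hdec : ∀ m, MeasurableSet {y | dec y = m}) (f : α → ℝ≥0∞)
    (hf : Measurable f) : ∑ m, ∫⁻ y in {y | dec y = m}, f y ∂μ ≤ ∫⁻ y, f y ∂μ := by
  simp_rw [← lintegral_indicator (hdec _)]
  rw [← lintegral_finsetSum _ fun m _ => hf.indicator (hdec m)]
  refine lintegral_mono fun y => le_of_eq ?_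
  rw [Finset.sum_eq_single (dec y)]
  · simp
  · intro m _ hm
    exact Set.indicator_of_notMem (fun h => hm h.symm) _
  · simp

lemma lintegral_prod_tail (n T : ℕ) (β : ℝ) :
    ∫⁻ y : Signal n T, ∏ k, ∏ t, tail β (y k t) = (tailMass β ^ T) ^ n := by
  have h1 : ∫⁻ y : Fin T → ℂ, ∏ t, tail β (y t) = tailMass β ^ T := by
    rw [volume_pi, lintegral_pi_prod _ _ fun _ => measurable_tail β]
    simp [tailMass]
  rw [volume_pi, lintegral_pi_prod (fun _ : Fin n => (volume : Measure (Fin T → ℂ)))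
    (fun _ y => ∏ t, tail β (y t)) fun _ => by fun_prop]
  simp [h1]

lemma le_ofReal_exp_toReal {a : ℝ≥0∞} (ha : a ≠ ∞) : a ≤ ENNReal.ofReal (Real.exp a.toReal) := by
  rw [← ENNReal.ofReal_toReal ha, ENNReal.toReal_ofReal ENNReal.toReal_nonneg]
  exact ENNReal.ofReal_le_ofReal (by linarith [Real.add_one_le_exp a.toReal])

lemma prod_le_ofReal_exp_mul_prod {n : ℕ} {z : Fin n → ℝ} {p q : Fin n → ℝ≥0∞} {l : ℝ}
    (hz : ∑ k, z k ≤ l) (h : ∀ k, p k ≤ ENNReal.ofReal (Real.exp (z k)) * q k) :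
    ∏ k, p k ≤ ENNReal.ofReal (Real.exp l) * ∏ k, q k := by
  calc ∏ k, p k ≤ ∏ k, (ENNReal.ofReal (Real.exp (z k)) * q k) := Finset.prod_le_prod' fun k _ => h k
    _ = ENNReal.ofReal (Real.exp (∑ k, z k)) * ∏ k, q k := by
      rw [Finset.prod_mul_distrib, ← ENNReal.ofReal_prod_of_nonneg fun _ _ => Real.exp_nonneg _,
        ← Real.exp_sum]
    _ ≤ _ := by gcongr

/-- If the density of `Y` is at most `p` and the likelihood ratio `p / q` is at most `e` on an
event, then that event has probability at most `e * ∫ q`. -/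
lemma lintegral_indicator_le_of_density {Ω α : Type*} [MeasurableSpace Ω] [MeasurableSpace α]
    {P : Measure Ω} {ν : Measure α} {Y : Ω → α} {p e : ℝ≥0∞} (hp0 : p ≠ 0) (hp : p ≠ ∞)
    (hY : ∀ f : α → ℝ≥0∞, Measurable f → ∫⁻ ω, f (Y ω) ∂P ≤ p * ∫⁻ y, f y ∂ν)
    {q : α → ℝ≥0∞} (hq : Measurable q) {D : Set α} (hD : MeasurableSet D) {B : Set Ω}
    (hB : ∀ᵐ ω ∂P, ω ∈ B → Y ω ∈ D ∧ p ≤ e * q (Y ω)) :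
    ∫⁻ ω, B.indicator 1 ω ∂P ≤ e * ∫⁻ y in D, q y ∂ν := by
  calc ∫⁻ ω, B.indicator 1 ω ∂P ≤ ∫⁻ ω, (p⁻¹ * e * D.indicator q (Y ω)) ∂P := by
        refine lintegral_mono_ae (hB.mono fun ω h => ?_)
        by_cases hω : ω ∈ B
        · obtain ⟨h1, h2⟩ := h hω
          rw [Set.indicator_of_mem hω, Set.indicator_of_mem h1, Pi.one_apply, mul_assoc,
            ← ENNReal.mul_inv_cancel hp0 hp, mul_comm p]
          gcongr
        · rw [Set.indicator_of_notMem hω]; exact zero_le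
    _ ≤ p * ∫⁻ y, p⁻¹ * e * D.indicator q y ∂ν :=
        hY _ ((hq.indicator hD).const_mul _)
    _ = e * ∫⁻ y in D, q y ∂ν := by
        rw [lintegral_const_mul _ (hq.indicator hD), lintegral_indicator hD, ← mul_assoc,
          ← mul_assoc, ENNReal.mul_inv_cancel hp0 hp, one_mul]

/-- The bound for the information density at the destination, as a random variable. -/
noncomputable def misoInfo {n T M : ℕ} (β : ℝ) (ρ : Fin 2 → ℝ≥0) (c : Code n T (Fin M)) (m : Fin M)
    (ω : Channel n T) : ℝ≥0∞ :=
  n * ENNReal.ofReal (Real.log 2 + (β / 2 * T - 1) * Real.log (1 + ρ 0))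
    + ENNReal.ofReal (β / 2 * T - 1) * ∑ i, ∑ k, ∑ t, ‖c.relaySignal ω m i k t‖ₑ ^ 2
    + ENNReal.ofReal β * ∑ k, ∑ t : Fin T, (ENNReal.ofReal (‖ω.2.1 0 k‖ / √(ρ 0))
      + ENNReal.ofReal (‖ω.2.1 1 k‖ / √(ρ 1)) + ENNReal.ofReal ‖ω.2.2.2 k t‖)

lemma measurable_misoInfo {n T M : ℕ} (β : ℝ) (ρ : Fin 2 → ℝ≥0) (c : Code n T (Fin M))
    (m : Fin M) : Measurable (misoInfo β ρ c m) := by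
  have := measurable_relaySignal_apply c m
  unfold misoInfo
  fun_prop

/-- Moves the summed block exponents to `ℝ≥0∞`, where the power constraint is stated and where means
can be split without integrability conditions. -/
lemma sum_exponent_le_misoInfo {n T M : ℕ} (hT : 1 ≤ T) {β : ℝ} (hβ : 2 < β) (ρ : Fin 2 → ℝ≥0)
    (c : Code n T (Fin M)) (m : Fin M) (ω : Channel n T) :
    ENNReal.ofReal (∑ k, (Real.log 2 + (β / 2 * T - 1) * (Real.log (1 + ρ 0)
        + ∑ i, ∑ t, ‖c.relaySignal ω m i k t‖ ^ 2)
        + β * ∑ t : Fin T, (‖ω.2.1 0 k‖ / √(ρ 0) + ‖ω.2.1 1 k‖ / √(ρ 1) + ‖ω.2.2.2 k t‖)))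
      ≤ misoInfo β ρ c m ω := by
  have hT' : (1 : ℝ) ≤ T := by exact_mod_cast hT
  have hα : 0 ≤ β / 2 * T - 1 := by nlinarith
  have hβ0 : 0 ≤ β := by linarith
  have hlog : 0 ≤ Real.log (1 + ρ 0) := Real.log_nonneg (by linarith [(ρ 0).2])
  have hlog2 : 0 ≤ Real.log 2 := Real.log_nonneg (by norm_num)
  have e1 : ∑ k : Fin n, (Real.log 2 + (β / 2 * T - 1) * (Real.log (1 + ρ 0)
        + ∑ i, ∑ t, ‖c.relaySignal ω m i k t‖ ^ 2)
        + β * ∑ t : Fin T, (‖ω.2.1 0 k‖ / √(ρ 0) + ‖ω.2.1 1 k‖ / √(ρ 1) + ‖ω.2.2.2 k t‖))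
      = n * (Real.log 2 + (β / 2 * T - 1) * Real.log (1 + ρ 0))
        + (β / 2 * T - 1) * ∑ i, ∑ k, ∑ t, ‖c.relaySignal ω m i k t‖ ^ 2
        + β * ∑ k, ∑ t : Fin T,
          (‖ω.2.1 0 k‖ / √(ρ 0) + ‖ω.2.1 1 k‖ / √(ρ 1) + ‖ω.2.2.2 k t‖) := by
    rw [Finset.sum_comm (f := fun i k => ∑ t, ‖c.relaySignal ω m i k t‖ ^ 2)]
    simp only [mul_add, Finset.sum_add_distrib, ← Finset.mul_sum, Finset.sum_const,
      Finset.card_univ, Fintype.card_fin, nsmul_eq_mul]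
    ring
  have hsq : ∀ z : ℂ, ‖z‖ₑ ^ 2 = ENNReal.ofReal (‖z‖ ^ 2) := fun z => by
    rw [ENNReal.ofReal_pow (norm_nonneg _), ofReal_norm]
  rw [e1, misoInfo]
  refine ENNReal.ofReal_add_le.trans (add_le_add (ENNReal.ofReal_add_le.trans
    (add_le_add ?_ ?_)) ?_)
  · rw [ENNReal.ofReal_mul (by positivity), ENNReal.ofReal_natCast]
  · rw [ENNReal.ofReal_mul hα]
    simp_rw [hsq]
    gcongr
    rw [ENNReal.ofReal_sum_of_nonneg fun _ _ => by positivity]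
    gcongr
    rw [ENNReal.ofReal_sum_of_nonneg fun _ _ => by positivity]
    gcongr
    rw [ENNReal.ofReal_sum_of_nonneg fun _ _ => by positivity]
  · rw [ENNReal.ofReal_mul hβ0]
    gcongr
    rw [ENNReal.ofReal_sum_of_nonneg fun _ _ => by positivity]
    gcongr
    rw [ENNReal.ofReal_sum_of_nonneg fun _ _ => by positivity]
    gcongr
    exact ENNReal.ofReal_add_le.trans (by gcongr; exact ENNReal.ofReal_add_le)

/-- The term `2 * T` is the power of the two relays in a block. The term `3 * T` counts, for each
symbol, two normalized fading coefficients and one noise sample, all with mean modulus `absMoment`.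
-/
lemma sum_lintegral_misoInfo_le {n T M : ℕ} (hT : 1 ≤ T) {β : ℝ} (hβ : 2 < β)
    {ρsr ρrd : Fin 2 → ℝ≥0} (hρ : ∀ i, 0 < ρrd i) (hM : 0 < M) (c : Code n T (Fin M))
    (hc : c.PowerConstraint ρsr ρrd) :
    ∑ m, ∫⁻ ω, misoInfo β ρrd c m ω ∂channelLaw n T ρsr ρrd
      ≤ M * ENNReal.ofReal (n * (Real.log 2 + (β / 2 * T - 1) * Real.log (1 + ρrd 0)
        + (β / 2 * T - 1) * (2 * T) + β * (3 * T * absMoment.toReal))) := by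
  have hT' : (1 : ℝ) ≤ T := by exact_mod_cast hT
  have hα : 0 ≤ β / 2 * T - 1 := by nlinarith
  have hβ0 : 0 ≤ β := by linarith
  have hlog : 0 ≤ Real.log (1 + ρrd 0) := Real.log_nonneg (by linarith [(ρrd 0).2])
  have hlog2 : 0 ≤ Real.log 2 := Real.log_nonneg (by norm_num)
  set P := channelLaw n T ρsr ρrd
  have hg : ∀ i k, ∫⁻ ω : Channel n T, ENNReal.ofReal (‖ω.2.1 i k‖ / √(ρrd i)) ∂P = absMoment :=
    fun i k => by
      rw [(measurePreserving_rdLink ρsr ρrd i).lintegral_comp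
        (f := fun p => ENNReal.ofReal (‖p.1 k‖ / √(ρrd i))) (by fun_prop),
        lintegral_linkLaw_fading _ k (fun g => ENNReal.ofReal (‖g‖ / √(ρrd i))) (by fun_prop),
        lintegral_norm_complexGaussian _ (hρ i)]
  have hw : ∀ k t, ∫⁻ ω : Channel n T, ENNReal.ofReal ‖ω.2.2.2 k t‖ ∂P = absMoment :=
    fun k t => by
      rw [(measurePreserving_rdLink ρsr ρrd 0).lintegral_comp
        (f := fun p => ENNReal.ofReal ‖p.2 k t‖) (by fun_prop),
        lintegral_linkLaw_noise _ k t (fun g => ENNReal.ofReal ‖g‖) (by fun_prop), absMoment]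
      simp
  have hpow : ∀ i, ∑ m, ∫⁻ ω, ∑ k, ∑ t, ‖c.relaySignal ω m i k t‖ₑ ^ 2 ∂P ≤ M * (n * T) :=
    fun i => by
      have := hc.2 i
      rw [ENNReal.div_le_iff (by simpa using hM.ne') (by simp), Fintype.card_fin, mul_comm] at this
      exact this
  have hms := measurable_relaySignal_apply c
  have hmean : ∀ m, ∫⁻ ω, misoInfo β ρrd c m ω ∂P
      = n * ENNReal.ofReal (Real.log 2 + (β / 2 * T - 1) * Real.log (1 + ρrd 0))
        + ENNReal.ofReal (β / 2 * T - 1)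
          * ∑ i, ∫⁻ ω, ∑ k, ∑ t, ‖c.relaySignal ω m i k t‖ₑ ^ 2 ∂P
        + ENNReal.ofReal β * (n * (T * (3 * absMoment))) := fun m => by
    unfold misoInfo
    rw [lintegral_add_right _ (by fun_prop), lintegral_add_right _ (by fun_prop)]
    congr 1
    · rw [lintegral_const_mul _ (by fun_prop : Measurable fun ω : Channel n T =>
        ∑ i, ∑ k, ∑ t, ‖c.relaySignal ω m i k t‖ₑ ^ 2),
        lintegral_finsetSum _ (fun _ _ => by fun_prop)]
      simp
    · rw [lintegral_const_mul _ (by fun_prop), lintegral_finsetSum _ (fun _ _ => by fun_prop)]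
      congr 1
      rw [Finset.sum_congr rfl fun k _ => lintegral_finsetSum _ (fun _ _ => by fun_prop)]
      have h3 : ∀ (k : Fin n) (t : Fin T), ∫⁻ ω : Channel n T,
          (ENNReal.ofReal (‖ω.2.1 0 k‖ / √(ρrd 0)) + ENNReal.ofReal (‖ω.2.1 1 k‖ / √(ρrd 1))
            + ENNReal.ofReal ‖ω.2.2.2 k t‖) ∂P = 3 * absMoment := fun k t => by
        rw [lintegral_add_left (by fun_prop), lintegral_add_left (by fun_prop), hg, hg, hw]
        ring
      simp_rw [h3]
      simp
  simp_rw [hmean]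
  rw [Finset.sum_add_distrib, Finset.sum_add_distrib, ← Finset.mul_sum (f := fun m =>
    ∑ i, ∫⁻ ω, ∑ k, ∑ t, ‖c.relaySignal ω m i k t‖ₑ ^ 2 ∂P), Finset.sum_comm]
  have hfin := absMoment_lt_top.ne
  have hR : ENNReal.ofReal (n * (Real.log 2 + (β / 2 * T - 1) * Real.log (1 + ρrd 0)
        + (β / 2 * T - 1) * (2 * T) + β * (3 * T * absMoment.toReal)))
      = n * ENNReal.ofReal (Real.log 2 + (β / 2 * T - 1) * Real.log (1 + ρrd 0))
        + ENNReal.ofReal (β / 2 * T - 1) * (2 * (n * T))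
        + ENNReal.ofReal β * (n * (T * (3 * absMoment))) := by
    have e : ∀ a b d : ℝ, n * (a + b * (2 * T) + d * (3 * T * absMoment.toReal))
        = n * a + b * (2 * (n * T)) + d * (n * (T * (3 * absMoment.toReal))) := by
      intros; ring
    rw [e, ENNReal.ofReal_add (by positivity) (by positivity),
      ENNReal.ofReal_add (by positivity) (by positivity), ENNReal.ofReal_mul (by positivity),
      ENNReal.ofReal_mul hα, ENNReal.ofReal_mul hβ0, ENNReal.ofReal_mul (by positivity),
      ENNReal.ofReal_mul (by positivity), ENNReal.ofReal_mul (by positivity),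
      ENNReal.ofReal_mul (by positivity), ENNReal.ofReal_mul (by positivity),
      ENNReal.ofReal_toReal hfin]
    simp
  rw [hR, mul_add, mul_add]
  refine add_le_add (add_le_add ?_ ?_) ?_
  · simp
  · rw [mul_left_comm]
    gcongr
    calc _ ≤ ∑ _i : Fin 2, (M : ℝ≥0∞) * (n * T) := Finset.sum_le_sum fun i _ => hpow i
      _ = _ := by simp; ring
  · simp

/-- The cut-set bound at the destination: two transmitters, one receiver. -/
theorem rate_le_of_destination_cut {T : ℕ} (hT : 1 ≤ T) {β : ℝ} (hβ : 2 < β) :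
    ∃ K : ℝ, ∀ (ρsr ρrd : Fin 2 → ℝ≥0) (R : ℝ), (∀ i, 0 < ρrd i) → ρrd 1 ≤ ρrd 0 →
      Achievable T ρsr ρrd R →
      T * R * Real.log 2 ≤ (β / 2 * T - 1) * Real.log (1 + ρrd 0) + K := by
  refine ⟨Real.log 2 + (β / 2 * T - 1) * (2 * T) + β * (3 * T * absMoment.toReal)
    + T * (tailMass β).toReal, fun ρsr ρrd R hρ hρ10 hR => ?_⟩
  have hT' : (1 : ℝ) ≤ T := by exact_mod_cast hT
  have hα : 0 ≤ β / 2 * T - 1 := by nlinarith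
  have hlog : 0 ≤ Real.log (1 + ρrd 0) := Real.log_nonneg (by linarith [(ρrd 0).2])
  have hlog2 : 0 < Real.log 2 := Real.log_pos (by norm_num)
  have hβ0 : 0 ≤ β := by linarith
  have main := rate_le_of_information_bound (A := Real.log 2
    + (β / 2 * T - 1) * Real.log (1 + ρrd 0)
    + (β / 2 * T - 1) * (2 * T) + β * (3 * T * absMoment.toReal))
    (κ := T * (tailMass β).toReal) (by positivity) (fun n M c hc hM => ?_) hR
  · linarith
  let Q : Signal n T → ℝ≥0∞ := fun y => ∏ k, ∏ t, tail β (y k t)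
  have hQ : Measurable Q := by fun_prop
  refine ⟨misoInfo β ρrd c, fun m => ∫⁻ y in {y | c.decode y = m}, Q y,
    measurable_misoInfo β ρrd c, fun m l => ?_, ?_, sum_lintegral_misoInfo_le hT hβ hρ hM c hc⟩
  · have hB : MeasurableSet ({ω | c.decode (c.destSignal ω m) = m} ∩
        {ω | misoInfo β ρrd c m ω < ENNReal.ofReal l}) :=
      (measurableSet_decode_destSignal c m).inter
        (measurableSet_lt (measurable_misoInfo β ρrd c m) measurable_const)
    rw [← lintegral_indicator_one hB,
      lintegral_channelLaw _ _ _ (measurable_one.indicator hB)]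
    refine (lintegral_mono fun p => ?_).trans_eq (by simp : ∫⁻ _, (ENNReal.ofReal (Real.exp l)
      * ∫⁻ y in {y | c.decode y = m}, Q y) ∂srLaw n T ρsr = _)
    -- Once the first hop `p` is frozen the relay signals are deterministic, and the second hop is a
    -- channel with two transmitters. The bound obtained does not depend on `p`.
    let X : Fin 2 → Signal n T := fun i =>
      c.relay i (fun k t => p.1 i k * c.encode m k t + p.2 i k t)
    refine lintegral_indicator_le_of_density (Y := misoOutput X) (p := ∏ k, misoBound ρrd X k)
      (B := {r | (p.1, r.1, p.2, r.2) ∈ {ω | c.decode (c.destSignal ω m) = m} ∩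
        {ω | misoInfo β ρrd c m ω < ENNReal.ofReal l}})
      ?_ ?_ (lintegral_misoOutput_le hT ρrd X) hQ (c.measurable_decode m)
      (ae_of_all _ fun r hr => ⟨hr.1, ?_⟩)
    · refine Finset.prod_ne_zero_iff.2 fun k _ => ?_
      simp only [misoBound, ne_eq, ENNReal.ofReal_eq_zero, not_le]
      have : 0 ≤ max ((ρrd 0 : ℝ) * ‖X 0 k‖ ^ 2) (ρrd 1 * ‖X 1 k‖ ^ 2) :=
        le_max_of_le_left (by positivity)
      positivity
    · exact ENNReal.prod_ne_top fun k _ => ENNReal.ofReal_ne_top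
    · refine prod_le_ofReal_exp_mul_prod ?_ fun k => misoBound_le hT hβ hρ hρ10 X r k
      have h1 := (sum_exponent_le_misoInfo hT hβ ρrd c m (p.1, r.1, p.2, r.2)).trans_lt hr.2
      exact ((ENNReal.ofReal_lt_ofReal_iff').1 h1).1.le
  · refine (sum_setLIntegral_fiber_le volume c.decode c.measurable_decode Q hQ).trans ?_
    rw [lintegral_prod_tail]
    calc (tailMass β ^ T) ^ n ≤ (ENNReal.ofReal (Real.exp (tailMass β).toReal) ^ T) ^ n := by
          gcongr; exact le_ofReal_exp_toReal (tailMass_lt_top hβ).ne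
      _ = _ := by
          rw [← ENNReal.ofReal_pow (by positivity), ← ENNReal.ofReal_pow (by positivity),
            ← Real.exp_nat_mul, ← Real.exp_nat_mul]

/-! ### The cut at the source -/

section SourceCut

variable {n T : ℕ}

instance : SigmaFinite (volume : Measure (Fin 2 → Signal n T)) :=
  Measure.pi.sigmaFinite fun _ => volume

instance : (volume : Measure (Fin 2 → Signal n T)).IsAddLeftInvariant :=
  Measure.pi.isAddLeftInvariant fun _ => volume

/-- The signals at the relays for a given signal of the source. -/
noncomputable def simoOutput (x : Signal n T)
    (p : (Fin 2 → Fin n → ℂ) × (Fin 2 → Signal n T)) : Fin 2 → Signal n T :=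
  fun i k t => p.1 i k * x k t + p.2 i k t

lemma measurable_simoOutput (x : Signal n T) : Measurable (simoOutput x) := by
  unfold simoOutput; fun_prop

/-- A bound for the density of the signals at the relays in one block. -/
noncomputable def simoBound (ρ : Fin 2 → ℝ≥0) (x : Signal n T) (k : Fin n) : ℝ≥0∞ :=
  ∏ i, ENNReal.ofReal (2 / (1 + ρ i * ‖x k‖ ^ 2))

/-- The two relays have independent fading and noise, so their density bounds multiply; for each,
only the factor at the strongest symbol is kept. -/
lemma lintegral_simoOutput_le (hT : 1 ≤ T) (ρ : Fin 2 → ℝ≥0) (x : Signal n T)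
    (f : (Fin 2 → Signal n T) → ℝ≥0∞) (hf : Measurable f) :
    ∫⁻ p, f (simoOutput x p) ∂srLaw n T ρ ≤ (∏ k, simoBound ρ x k) * ∫⁻ y, f y := by
  let s : (Fin 2 → Fin n → ℂ) → (Fin 2 → Signal n T) := fun g i k t => g i k * x k t
  have hs : Measurable s := by fun_prop
  let ψ : (Fin 2 → Signal n T) → ℝ≥0∞ := fun w => ∏ i, ∏ k, ∏ t, gaussDensity (w i k t)
  have hψ : Measurable ψ := by fun_prop
  have hfo : Measurable fun p => f (simoOutput x p) := hf.comp (measurable_simoOutput x)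
  have h1 : ∀ g : Fin 2 → Fin n → ℂ,
      ∫⁻ w, f (simoOutput x (g, w))
        ∂(Measure.pi fun _ => Measure.pi fun _ => Measure.pi fun _ => complexGaussian 1)
        = ∫⁻ y, ψ (y - s g) * f y := fun g => by
    rw [relayNoise_eq_withDensity]
    exact lintegral_add_withDensity ψ f hψ hf (s g)
  rw [srLaw, lintegral_prod _ hfo.aemeasurable]
  simp_rw [h1]
  rw [lintegral_lintegral_swap (by fun_prop), ← lintegral_const_mul _ hf]
  refine lintegral_mono fun y => ?_
  rw [lintegral_mul_const _ (by fun_prop)]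
  gcongr
  have h2 : ∫⁻ g, ψ (y - s g) ∂(Measure.pi fun i => Measure.pi fun _ => complexGaussian (ρ i))
      = ∏ i, ∏ k, ∫⁻ g, ∏ t, gaussDensity (y i k t - g * x k t) ∂complexGaussian (ρ i) := by
    have h3 := lintegral_pi_prod (fun i => Measure.pi fun _ : Fin n => complexGaussian (ρ i))
      (fun i g => ∏ k, ∏ t, gaussDensity (y i k t - g k * x k t)) (fun i => by fun_prop)
    refine h3.trans (Finset.prod_congr rfl fun i _ => ?_)
    exact lintegral_pi_prod (fun _ : Fin n => complexGaussian (ρ i))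
      (fun k g => ∏ t, gaussDensity (y i k t - g * x k t)) (fun k => by fun_prop)
  rw [h2]
  unfold simoBound
  rw [Finset.prod_comm]
  refine Finset.prod_le_prod' fun k _ => Finset.prod_le_prod' fun i _ => ?_
  obtain ⟨t, ht⟩ := exists_norm_eq_pi_norm hT (x k)
  rw [← ht]
  exact (lintegral_mono fun g => prod_gaussDensity_le _ t).trans
    (lintegral_gaussDensity_sub_mul_le' (ρ i) (x k t) (y i k t))

/-- The coordinates of `v` after the component along `u` has been eliminated from all symbols
but symbol `t₀`. -/
noncomputable def shear (t₀ : Fin T) (u v : Fin T → ℂ) (t : Fin T) : ℂ :=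
  if t = t₀ then v t₀ else v t - u t / u t₀ * v t₀

/-- For fixed `u` the shear translates every other coordinate by a multiple of the coordinate `t₀`,
which preserves volume. This remains true when `u t₀ = 0`, since the quotient is then `0`. -/
lemma lintegral_prod_tail_shear (β : ℝ) (t₀ : Fin T) (u : Fin T → ℂ) :
    ∫⁻ v, ∏ t, tail β (shear t₀ u v t) = tailMass β ^ T := by
  obtain ⟨T, rfl⟩ : ∃ T', T = T' + 1 := ⟨T - 1, by have := t₀.pos; omega⟩
  rw [(volume_preserving_piFinSuccAbove (fun _ => ℂ) t₀).symm.lintegral_map_equiv]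
  have h1 : ∀ a : ℂ × (Fin T → ℂ),
      ∏ t, tail β (shear t₀ u ((MeasurableEquiv.piFinSuccAbove (fun _ => ℂ) t₀).symm a) t)
      = tail β a.1 * ∏ j, tail β (a.2 j - u (t₀.succAbove j) / u t₀ * a.1) := fun a => by
    rw [Fin.prod_univ_succAbove _ t₀]
    simp [shear, MeasurableEquiv.piFinSuccAbove_symm_apply, Fin.insertNthEquiv,
      Fin.succAbove_ne]
  simp_rw [h1]
  rw [Measure.volume_eq_prod, lintegral_prod _ (by fun_prop)]
  have h2 : ∀ a : ℂ, ∫⁻ v : Fin T → ℂ, tail β a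
      * ∏ j, tail β (v j - u (t₀.succAbove j) / u t₀ * a) = tail β a * tailMass β ^ T :=
    fun a => by
      rw [lintegral_const_mul _ (by fun_prop), volume_pi, lintegral_pi_prod
        (fun _ : Fin T => (volume : Measure ℂ))
        (fun j z => tail β (z - u (t₀.succAbove j) / u t₀ * a)) (fun j => by fun_prop)]
      congr 1
      rw [Finset.prod_congr rfl fun j _ => lintegral_sub_right_eq_self (tail β) _]
      simp [tailMass]
  simp_rw [h2]
  rw [lintegral_mul_const _ (by fun_prop), pow_succ', tailMass]

@[fun_prop]
lemma measurable_shear {α : Type*} [MeasurableSpace α] (t₀ t : Fin T) {u v : α → Fin T → ℂ}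
    (hu : Measurable u) (hv : Measurable v) : Measurable fun a => shear t₀ (u a) (v a) t := by
  unfold shear
  split_ifs <;> fun_prop

/-- The auxiliary density for the signals `u, v` at the two relays in one block. -/
noncomputable def simoTail (β : ℝ) (u v : Fin T → ℂ) : ℝ≥0∞ :=
  (∏ t, tail β (u t)) * ∑ t₀, ∏ t, tail β (shear t₀ u v t)

lemma lintegral_simoTail (β : ℝ) :
    ∫⁻ y : Fin 2 → Signal n T, ∏ k, simoTail β (y 0 k) (y 1 k)
      = (tailMass β ^ T * (T * tailMass β ^ T)) ^ n := by
  rw [(volume_preserving_piFinTwo (fun _ => Signal n T)).symm.lintegral_map_equiv,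
    Measure.volume_eq_prod]
  unfold simoTail
  rw [lintegral_prod _ (by fun_prop)]
  have h1 := lintegral_lintegral_pi_prod (fun _ : Fin n => (volume : Measure (Fin T → ℂ)))
    (fun _ : Fin n => (volume : Measure (Fin T → ℂ)))
    (fun _ u v => (∏ t, tail β (u t)) * ∑ t₀, ∏ t, tail β (shear t₀ u v t))
    (fun _ => by unfold Function.uncurry; fun_prop)
  refine h1.trans ?_
  have h2 : ∀ u : Fin T → ℂ,
      ∫⁻ v : Fin T → ℂ, (∏ t, tail β (u t)) * ∑ t₀, ∏ t, tail β (shear t₀ u v t)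
        = (∏ t, tail β (u t)) * (T * tailMass β ^ T) := fun u => by
    rw [lintegral_const_mul _ (by fun_prop), lintegral_finsetSum _ (fun _ _ => by fun_prop)]
    simp [lintegral_prod_tail_shear]
  simp_rw [h2]
  rw [lintegral_mul_const _ (by fun_prop), volume_pi, lintegral_pi_prod _ _
    fun _ => measurable_tail β]
  simp [tailMass]

/-- A bound for `log (1 + ‖·‖)` of the sheared coordinates, up to the leading term. -/
noncomputable def simoExcess (ρ : Fin 2 → ℝ≥0) (x : Signal n T)
    (p : (Fin 2 → Fin n → ℂ) × (Fin 2 → Signal n T)) (k : Fin n) (t₀ t : Fin T) : ℝ :=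
  (‖p.2 1 k t‖ + ‖p.2 1 k t₀‖) + (‖p.2 0 k t‖ + ‖p.2 0 k t₀‖)
    + (‖p.1 1 k‖ / √(ρ 1) + ‖p.2 1 k t₀‖)
    + √(1 + ρ 0 * ‖x k t₀‖ ^ 2) / ‖p.1 0 k * x k t₀ + p.2 0 k t₀‖

/-- Since `x k t = ξ * x k t₀` with `‖ξ‖ ≤ 1`, both observations at `t` are `ξ` times those at `t₀`
up to noise. The shear cancels the signal and leaves noise terms, one of them multiplied by `v₀ /
u₀`. No term of order `log ρ` survives. -/
lemma log_one_add_norm_shear_le {ρ : Fin 2 → ℝ≥0} (hρ : ∀ i, 0 < ρ i) (hρ10 : ρ 1 ≤ ρ 0)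
    (x : Signal n T) (p : (Fin 2 → Fin n → ℂ) × (Fin 2 → Signal n T)) (k : Fin n) (t₀ t : Fin T)
    (ht₀ : ‖x k t₀‖ = ‖x k‖) (hne : simoOutput x p 0 k t₀ ≠ 0) (htt : t ≠ t₀) :
    Real.log (1 + ‖shear t₀ (simoOutput x p 0 k) (simoOutput x p 1 k) t‖)
      ≤ simoExcess ρ x p k t₀ t := by
  obtain ⟨ξ, hξ, hξ1⟩ : ∃ ξ : ℂ, x k t = ξ * x k t₀ ∧ ‖ξ‖ ≤ 1 := by
    have hle : ‖x k t‖ ≤ ‖x k t₀‖ := ht₀ ▸ norm_le_pi_norm (x k) t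
    by_cases h0 : x k t₀ = 0
    -- If the strongest symbol vanishes, so does the whole block.
    · exact ⟨0, by simpa [h0] using hle, by simp⟩
    · refine ⟨x k t / x k t₀, (div_mul_cancel₀ _ h0).symm, ?_⟩
      rw [norm_div]
      exact div_le_one_of_le₀ hle (norm_nonneg _)
  set u₀ := simoOutput x p 0 k t₀ with hu₀
  set v₀ := simoOutput x p 1 k t₀ with hv₀
  have hu0 : 0 < ‖u₀‖ := norm_pos_iff.2 hne
  have hsh : shear t₀ (simoOutput x p 0 k) (simoOutput x p 1 k) t
      = (p.2 1 k t - ξ * p.2 1 k t₀) - (p.2 0 k t - ξ * p.2 0 k t₀) * (v₀ / u₀) := by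
    have h1 : simoOutput x p 0 k t = ξ * u₀ + (p.2 0 k t - ξ * p.2 0 k t₀) := by
      simp only [hu₀, simoOutput, hξ]; ring
    have h2 : simoOutput x p 1 k t = ξ * v₀ + (p.2 1 k t - ξ * p.2 1 k t₀) := by
      simp only [hv₀, simoOutput, hξ]; ring
    rw [shear, if_neg htt, h1, h2, ← hu₀, ← hv₀]
    field_simp
    ring
  -- The factor `√S` is inserted to compare `v₀` and `u₀` separately: `‖v₀‖ ≤ √S * d` uses `ρ 1 ≤ ρ
  -- 0`, and `I = √S / ‖u₀‖` has the uniformly bounded mean `invMoment`.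
  set S : ℝ := 1 + ρ 0 * ‖x k t₀‖ ^ 2 with hS
  have hS1 : 1 ≤ S := le_add_of_nonneg_right (by positivity)
  set a := ‖p.2 1 k t‖ + ‖p.2 1 k t₀‖ with ha
  set b := ‖p.2 0 k t‖ + ‖p.2 0 k t₀‖ with hb
  set d := ‖p.1 1 k‖ / √(ρ 1) + ‖p.2 1 k t₀‖ with hd
  have ha0 : 0 ≤ a := by positivity
  have hb0 : 0 ≤ b := by positivity
  have hd0 : 0 ≤ d := by positivity
  have hv : ‖v₀‖ ≤ √S * d := by
    have h1 : (ρ 1 : ℝ) * ‖x k t₀‖ ^ 2 ≤ S := by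
      have : (ρ 1 : ℝ) ≤ ρ 0 := by exact_mod_cast hρ10
      nlinarith [sq_nonneg ‖x k t₀‖]
    have h2 := mul_norm_le_sqrt_mul (NNReal.coe_pos.2 (hρ 1)) (g := p.1 1 k) h1
    have h3 : ‖p.2 1 k t₀‖ ≤ √S * ‖p.2 1 k t₀‖ :=
      le_mul_of_one_le_left (norm_nonneg _) (Real.one_le_sqrt.2 hS1)
    rw [hd, mul_add]
    exact (norm_add_le _ _).trans (add_le_add h2 h3)
  have hw : ∀ i, ‖p.2 i k t - ξ * p.2 i k t₀‖ ≤ ‖p.2 i k t‖ + ‖p.2 i k t₀‖ := fun i => by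
    refine (norm_sub_le _ _).trans ?_
    rw [norm_mul]
    gcongr
    exact mul_le_of_le_one_left (norm_nonneg _) hξ1
  set I := √S / ‖u₀‖ with hI
  have hI0 : 0 ≤ I := by positivity
  have hnorm : ‖shear t₀ (simoOutput x p 0 k) (simoOutput x p 1 k) t‖ ≤ a + b * (d * I) := by
    rw [hsh]
    refine (norm_sub_le _ _).trans (add_le_add (hw 1) ?_)
    rw [norm_mul, norm_div]
    refine mul_le_mul (hw 0) ?_ (by positivity) hb0
    rw [hI, mul_div_assoc', mul_comm d]
    gcongr
  have hprod : 1 + ‖shear t₀ (simoOutput x p 0 k) (simoOutput x p 1 k) t‖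
      ≤ Real.exp (a + b + d + I) := by
    calc _ ≤ 1 + (a + b * (d * I)) := by gcongr
      -- Passing to a product turns the logarithm into a sum, so only the means of `a`, `b`, `d` and
      -- `I` are needed, not those of their products.
      _ ≤ (1 + a) * ((1 + b) * ((1 + d) * (1 + I))) := by
        have h1 : 0 ≤ d * I := by positivity
        have h2 : 1 + d * I ≤ (1 + d) * (1 + I) := by nlinarith
        have h3 : 1 + b * (d * I) ≤ (1 + b) * ((1 + d) * (1 + I)) := by nlinarith
        nlinarith [mul_nonneg hb0 h1]
      _ ≤ Real.exp a * (Real.exp b * (Real.exp d * Real.exp I)) := by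
        gcongr <;> rw [add_comm] <;> exact Real.add_one_le_exp _
      _ = _ := by rw [← Real.exp_add, ← Real.exp_add, ← Real.exp_add]; ring_nf
  have := (Real.log_le_iff_le_exp (by positivity)).2 hprod
  exact this

/-- A bound for the information density in one block. -/
lemma simoBound_le (hT : 1 ≤ T) {β : ℝ} (hβ : 2 < β) {ρ : Fin 2 → ℝ≥0} (hρ : ∀ i, 0 < ρ i)
    (hρ10 : ρ 1 ≤ ρ 0) (x : Signal n T) (p : (Fin 2 → Fin n → ℂ) × (Fin 2 → Signal n T))
    (k : Fin n) (t₀ : Fin T) (ht₀ : ‖x k t₀‖ = ‖x k‖) (hne : simoOutput x p 0 k t₀ ≠ 0) :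
    simoBound ρ x k ≤ ENNReal.ofReal (Real.exp (2 * Real.log 2
        + (β / 2 * (T + 1) - 2) * (Real.log (1 + ρ 0) + ∑ t, ‖x k t‖ ^ 2)
        + β * ∑ t, ((‖p.1 0 k‖ / √(ρ 0) + ‖p.2 0 k t‖) + simoExcess ρ x p k t₀ t)))
      * simoTail β (simoOutput x p 0 k) (simoOutput x p 1 k) := by
  have hT' : (1 : ℝ) ≤ T := by exact_mod_cast hT
  have hS : ∀ i, (1 : ℝ) ≤ 1 + ρ i * ‖x k‖ ^ 2 := fun i => le_add_of_nonneg_right (by positivity)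
  have h01 : (ρ 1 : ℝ) ≤ ρ 0 := by exact_mod_cast hρ10
  have hxt : ∀ i t, (ρ i : ℝ) * ‖x k t‖ ^ 2 ≤ 1 + ρ i * ‖x k‖ ^ 2 := fun i t => by
    have h1 : (ρ i : ℝ) * ‖x k t‖ ^ 2 ≤ ρ i * ‖x k‖ ^ 2 := by
      gcongr; exact norm_le_pi_norm _ t
    linarith
  have hlogS0 : Real.log (1 + ρ 0 * ‖x k‖ ^ 2) ≤ Real.log (1 + ρ 0) + ∑ t, ‖x k t‖ ^ 2 := by
    refine (log_one_add_mul_le (NNReal.coe_nonneg _) (by positivity)).trans ?_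
    gcongr
    rw [← ht₀]
    exact Finset.single_le_sum (f := fun t => ‖x k t‖ ^ 2) (fun _ _ => by positivity)
      (Finset.mem_univ t₀)
  have hlogS1 : Real.log (1 + ρ 1 * ‖x k‖ ^ 2) ≤ Real.log (1 + ρ 0 * ‖x k‖ ^ 2) :=
    Real.log_le_log (by positivity) (by gcongr)
  have hlogy : ∀ i t, Real.log (1 + ‖simoOutput x p i k t‖)
      ≤ Real.log (1 + ρ i * ‖x k‖ ^ 2) / 2 + (‖p.1 i k‖ / √(ρ i) + ‖p.2 i k t‖) := fun i t => by
    refine log_one_add_le_of_le_sqrt_mul (norm_nonneg _) (hS i) (by positivity) ?_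
    have h0 := mul_norm_le_sqrt_mul (NNReal.coe_pos.2 (hρ i)) (g := p.1 i k) (hxt i t)
    have h2 : ‖p.2 i k t‖ ≤ √(1 + ρ i * ‖x k‖ ^ 2) * ‖p.2 i k t‖ :=
      le_mul_of_one_le_left (norm_nonneg _) (Real.one_le_sqrt.2 (hS i))
    rw [mul_add]
    exact (norm_add_le _ _).trans (add_le_add h0 h2)
  have hsumu : ∑ t, Real.log (1 + ‖simoOutput x p 0 k t‖)
      ≤ T * (Real.log (1 + ρ 0 * ‖x k‖ ^ 2) / 2) + ∑ t, (‖p.1 0 k‖ / √(ρ 0) + ‖p.2 0 k t‖) := by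
    refine (Finset.sum_le_sum fun t _ => hlogy 0 t).trans_eq ?_
    rw [Finset.sum_add_distrib]; simp
  have hsumv : ∑ t, Real.log (1 + ‖shear t₀ (simoOutput x p 0 k) (simoOutput x p 1 k) t‖)
      ≤ Real.log (1 + ρ 1 * ‖x k‖ ^ 2) / 2 + ∑ t, simoExcess ρ x p k t₀ t := by
    rw [← Finset.add_sum_erase _ _ (Finset.mem_univ t₀),
      ← Finset.add_sum_erase _ (simoExcess ρ x p k t₀) (Finset.mem_univ t₀), ← add_assoc]
    refine add_le_add ?_ (Finset.sum_le_sum fun t ht =>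
      log_one_add_norm_shear_le hρ hρ10 x p k t₀ t ht₀ hne (Finset.ne_of_mem_erase ht))
    have h1 := hlogy 1 t₀
    have h2 : ‖p.1 1 k‖ / √(ρ 1) + ‖p.2 1 k t₀‖ ≤ simoExcess ρ x p k t₀ t₀ := by
      unfold simoExcess
      have h3 : 0 ≤ √(1 + ρ 0 * ‖x k t₀‖ ^ 2) / ‖p.1 0 k * x k t₀ + p.2 0 k t₀‖ := by positivity
      linarith [norm_nonneg (p.2 1 k t₀), norm_nonneg (p.2 0 k t₀)]
    rw [shear, if_pos rfl]
    linarith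
  -- The auxiliary density must not depend on the message, whereas `t₀` does. For this reason
  -- `simoTail` sums over all positions, at the price of a factor `T` in its mass, and one summand
  -- is selected here.
  have htail : (∏ t, tail β (simoOutput x p 0 k t))
      * ∏ t, tail β (shear t₀ (simoOutput x p 0 k) (simoOutput x p 1 k) t)
      ≤ simoTail β (simoOutput x p 0 k) (simoOutput x p 1 k) := by
    unfold simoTail
    gcongr
    exact Finset.single_le_sum (f := fun t₀ => ∏ t, tail β
      (shear t₀ (simoOutput x p 0 k) (simoOutput x p 1 k) t)) (fun _ _ => zero_le)
      (Finset.mem_univ t₀)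
  refine le_trans ?_ (mul_le_mul_right htail _)
  unfold simoBound
  simp_rw [tail_eq_exp]
  rw [← ENNReal.ofReal_prod_of_nonneg (fun _ _ => Real.exp_nonneg _), ← Real.exp_sum,
    ← ENNReal.ofReal_prod_of_nonneg (fun _ _ => Real.exp_nonneg _), ← Real.exp_sum,
    ← ENNReal.ofReal_mul (Real.exp_nonneg _), ← Real.exp_add,
    ← ENNReal.ofReal_mul (Real.exp_nonneg _), ← Real.exp_add, Fin.prod_univ_two,
    ← ENNReal.ofReal_mul (by positivity)]
  apply ENNReal.ofReal_le_ofReal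
  have hS0 := hS 0
  have hS1 := hS 1
  rw [← Real.log_le_iff_le_exp (by positivity), Real.log_mul (by positivity) (by positivity),
    Real.log_div (by norm_num) (by linarith), Real.log_div (by norm_num) (by linarith),
    Finset.sum_neg_distrib, Finset.sum_neg_distrib, ← Finset.mul_sum, ← Finset.mul_sum,
    Finset.sum_add_distrib (f := fun t => ‖p.1 0 k‖ / √(ρ 0) + ‖p.2 0 k t‖)]
  have h3 := mul_le_mul_of_nonneg_left hsumu (by linarith : (0 : ℝ) ≤ β)
  have h4 := mul_le_mul_of_nonneg_left hsumv (by linarith : (0 : ℝ) ≤ β)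
  have hα : 0 ≤ β / 2 * (T + 1) - 2 := by nlinarith
  have h5 := mul_le_mul_of_nonneg_left hlogS0 hα
  -- The weaker relay enters with the nonnegative coefficient `β / 2 - 1`, so its strength may be
  -- replaced by the stronger one. Added to `β / 2 * T - 1` this gives `β / 2 * (T + 1) - 2`.
  have h6 := mul_le_mul_of_nonneg_left hlogS1 (by linarith : (0 : ℝ) ≤ β / 2 - 1)
  linarith

end SourceCut

/-! ### The rate bound at the source -/

section SourceCutRate

variable {n T : ℕ}

/-- The bound for the information density at the relays, as a random variable; `τ k` is the
position of the strongest symbol of `x` in block `k`. -/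
noncomputable def simoInfo (β : ℝ) (ρ : Fin 2 → ℝ≥0) (x : Signal n T) (τ : Fin n → Fin T)
    (p : (Fin 2 → Fin n → ℂ) × (Fin 2 → Signal n T)) : ℝ≥0∞ :=
  n * ENNReal.ofReal (2 * Real.log 2 + (β / 2 * (T + 1) - 2) * Real.log (1 + ρ 0))
    + ENNReal.ofReal (β / 2 * (T + 1) - 2) * ∑ k, ∑ t, ‖x k t‖ₑ ^ 2
    + ENNReal.ofReal β * ∑ k, ∑ t, ENNReal.ofReal
      ((‖p.1 0 k‖ / √(ρ 0) + ‖p.2 0 k t‖) + simoExcess ρ x p k (τ k) t)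

lemma simoExcess_nonneg (ρ : Fin 2 → ℝ≥0) (x : Signal n T)
    (p : (Fin 2 → Fin n → ℂ) × (Fin 2 → Signal n T)) (k : Fin n) (t₀ t : Fin T) :
    0 ≤ simoExcess ρ x p k t₀ t := by
  unfold simoExcess; positivity

@[fun_prop]
lemma measurable_simoExcess (ρ : Fin 2 → ℝ≥0) (x : Signal n T) (k : Fin n) (t₀ t : Fin T) :
    Measurable fun p => simoExcess ρ x p k t₀ t := by
  unfold simoExcess; fun_prop

lemma measurable_simoInfo (β : ℝ) (ρ : Fin 2 → ℝ≥0) (x : Signal n T) (τ : Fin n → Fin T) :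
    Measurable (simoInfo β ρ x τ) := by
  unfold simoInfo
  fun_prop

lemma sum_exponent_le_simoInfo (hT : 1 ≤ T) {β : ℝ} (hβ : 2 < β) (ρ : Fin 2 → ℝ≥0)
    (x : Signal n T) (τ : Fin n → Fin T) (p : (Fin 2 → Fin n → ℂ) × (Fin 2 → Signal n T)) :
    ENNReal.ofReal (∑ k, (2 * Real.log 2
        + (β / 2 * (T + 1) - 2) * (Real.log (1 + ρ 0) + ∑ t, ‖x k t‖ ^ 2)
        + β * ∑ t, ((‖p.1 0 k‖ / √(ρ 0) + ‖p.2 0 k t‖) + simoExcess ρ x p k (τ k) t)))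
      ≤ simoInfo β ρ x τ p := by
  have hT' : (1 : ℝ) ≤ T := by exact_mod_cast hT
  have hα : 0 ≤ β / 2 * (T + 1) - 2 := by nlinarith
  have hβ0 : 0 ≤ β := by linarith
  have hex := simoExcess_nonneg ρ x p
  have e1 : ∑ k, (2 * Real.log 2
        + (β / 2 * (T + 1) - 2) * (Real.log (1 + ρ 0) + ∑ t, ‖x k t‖ ^ 2)
        + β * ∑ t, ((‖p.1 0 k‖ / √(ρ 0) + ‖p.2 0 k t‖) + simoExcess ρ x p k (τ k) t))
      = n * (2 * Real.log 2 + (β / 2 * (T + 1) - 2) * Real.log (1 + ρ 0))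
        + (β / 2 * (T + 1) - 2) * ∑ k, ∑ t, ‖x k t‖ ^ 2
        + β * ∑ k, ∑ t,
          ((‖p.1 0 k‖ / √(ρ 0) + ‖p.2 0 k t‖) + simoExcess ρ x p k (τ k) t) := by
    simp only [mul_add, Finset.sum_add_distrib, ← Finset.mul_sum, Finset.sum_const,
      Finset.card_univ, Fintype.card_fin, nsmul_eq_mul]
    ring
  have hsq : ∀ z : ℂ, ‖z‖ₑ ^ 2 = ENNReal.ofReal (‖z‖ ^ 2) := fun z => by
    rw [ENNReal.ofReal_pow (norm_nonneg _), ofReal_norm]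
  have hnn : ∀ k t, 0 ≤ (‖p.1 0 k‖ / √(ρ 0) + ‖p.2 0 k t‖) + simoExcess ρ x p k (τ k) t :=
    fun k t => add_nonneg (by positivity) (hex k (τ k) t)
  rw [e1, simoInfo]
  refine ENNReal.ofReal_add_le.trans (add_le_add (ENNReal.ofReal_add_le.trans
    (add_le_add ?_ ?_)) ?_)
  · rw [ENNReal.ofReal_mul (by positivity), ENNReal.ofReal_natCast]
  · rw [ENNReal.ofReal_mul hα]
    simp_rw [hsq]
    gcongr
    rw [ENNReal.ofReal_sum_of_nonneg fun _ _ => by positivity]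
    gcongr
    rw [ENNReal.ofReal_sum_of_nonneg fun _ _ => by positivity]
  · rw [ENNReal.ofReal_mul hβ0]
    gcongr
    rw [ENNReal.ofReal_sum_of_nonneg fun k _ => Finset.sum_nonneg fun t _ => hnn k t]
    gcongr with k
    rw [ENNReal.ofReal_sum_of_nonneg fun t _ => hnn k t]

/-- A bound for the mean of the random part of `simoInfo` per symbol. -/
noncomputable def simoMean : ℝ≥0∞ := 8 * absMoment + invMoment

lemma simoMean_lt_top : simoMean < ∞ :=
  ENNReal.add_lt_top.2 ⟨ENNReal.mul_lt_top (by simp) absMoment_lt_top, invMoment_lt_top⟩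

lemma lintegral_simoExcess_le {ρsr ρrd : Fin 2 → ℝ≥0} (hρ : ∀ i, 0 < ρsr i) (x : Signal n T)
    (k : Fin n) (t₀ t : Fin T) :
    ∫⁻ ω : Channel n T, ENNReal.ofReal ((‖ω.1 0 k‖ / √(ρsr 0) + ‖ω.2.2.1 0 k t‖)
      + simoExcess ρsr x (ω.1, ω.2.2.1) k t₀ t) ∂channelLaw n T ρsr ρrd ≤ simoMean := by
  set P := channelLaw n T ρsr ρrd
  have hg : ∀ i, ∫⁻ ω : Channel n T, ENNReal.ofReal (‖ω.1 i k‖ / √(ρsr i)) ∂P = absMoment :=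
    fun i => by
      rw [(measurePreserving_srLink ρsr ρrd i).lintegral_comp
        (f := fun p => ENNReal.ofReal (‖p.1 k‖ / √(ρsr i))) (by fun_prop),
        lintegral_linkLaw_fading _ k (fun g => ENNReal.ofReal (‖g‖ / √(ρsr i))) (by fun_prop),
        lintegral_norm_complexGaussian _ (hρ i)]
  have hw : ∀ i t, ∫⁻ ω : Channel n T, ENNReal.ofReal ‖ω.2.2.1 i k t‖ ∂P = absMoment :=
    fun i t => by
      rw [(measurePreserving_srLink ρsr ρrd i).lintegral_comp
        (f := fun p => ENNReal.ofReal ‖p.2 k t‖) (by fun_prop),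
        lintegral_linkLaw_noise _ k t (fun g => ENNReal.ofReal ‖g‖) (by fun_prop), absMoment]
      simp
  have hI : ∫⁻ ω : Channel n T, ENNReal.ofReal
      (√(1 + ρsr 0 * ‖x k t₀‖ ^ 2) / ‖ω.1 0 k * x k t₀ + ω.2.2.1 0 k t₀‖) ∂P ≤ invMoment := by
    rw [(measurePreserving_srLink ρsr ρrd 0).lintegral_comp (f := fun p => ENNReal.ofReal
      (√(1 + ρsr 0 * ‖x k t₀‖ ^ 2) / ‖p.1 k * x k t₀ + p.2 k t₀‖)) (by fun_prop),
      lintegral_linkLaw_symbol _ k t₀ (fun g w => ENNReal.ofReal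
        (√(1 + ρsr 0 * ‖x k t₀‖ ^ 2) / ‖g * x k t₀ + w‖)) (by unfold Function.uncurry; fun_prop)]
    exact lintegral_div_norm_le _ _
  calc _ ≤ ∫⁻ ω : Channel n T, ((ENNReal.ofReal (‖ω.1 0 k‖ / √(ρsr 0))
          + ENNReal.ofReal ‖ω.2.2.1 0 k t‖)
          + ((ENNReal.ofReal ‖ω.2.2.1 1 k t‖ + ENNReal.ofReal ‖ω.2.2.1 1 k t₀‖)
          + (ENNReal.ofReal ‖ω.2.2.1 0 k t‖ + ENNReal.ofReal ‖ω.2.2.1 0 k t₀‖)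
          + (ENNReal.ofReal (‖ω.1 1 k‖ / √(ρsr 1)) + ENNReal.ofReal ‖ω.2.2.1 1 k t₀‖)
          + ENNReal.ofReal (√(1 + ρsr 0 * ‖x k t₀‖ ^ 2)
            / ‖ω.1 0 k * x k t₀ + ω.2.2.1 0 k t₀‖))) ∂P := by
        refine lintegral_mono fun ω => ?_
        unfold simoExcess
        refine ENNReal.ofReal_add_le.trans (add_le_add ENNReal.ofReal_add_le ?_)
        refine ENNReal.ofReal_add_le.trans (add_le_add ?_ le_rfl)
        refine ENNReal.ofReal_add_le.trans (add_le_add ?_ ENNReal.ofReal_add_le)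
        exact ENNReal.ofReal_add_le.trans (add_le_add ENNReal.ofReal_add_le ENNReal.ofReal_add_le)
    -- Two terms stand outside `simoExcess` and six inside it, apart from the inverse moment.
    _ = 8 * absMoment + ∫⁻ ω : Channel n T, ENNReal.ofReal (√(1 + ρsr 0 * ‖x k t₀‖ ^ 2)
            / ‖ω.1 0 k * x k t₀ + ω.2.2.1 0 k t₀‖) ∂P := by
        rw [lintegral_add_left (by fun_prop), lintegral_add_left (by fun_prop),
          lintegral_add_left (by fun_prop), lintegral_add_left (by fun_prop),
          lintegral_add_left (by fun_prop), lintegral_add_left (by fun_prop),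
          lintegral_add_left (by fun_prop), lintegral_add_left (by fun_prop)]
        simp_rw [hg, hw]
        ring
    _ ≤ simoMean := by unfold simoMean; gcongr

lemma sum_lintegral_simoInfo_le {M : ℕ} (hT : 1 ≤ T) {β : ℝ} (hβ : 2 < β)
    {ρsr ρrd : Fin 2 → ℝ≥0} (hρ : ∀ i, 0 < ρsr i) (hM : 0 < M) (c : Code n T (Fin M))
    (hc : c.PowerConstraint ρsr ρrd) (τ : Fin M → Fin n → Fin T) :
    ∑ m, ∫⁻ ω, simoInfo β ρsr (c.encode m) (τ m) (ω.1, ω.2.2.1) ∂channelLaw n T ρsr ρrd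
      ≤ M * ENNReal.ofReal (n * (2 * Real.log 2 + (β / 2 * (T + 1) - 2) * Real.log (1 + ρsr 0)
        + (β / 2 * (T + 1) - 2) * T + β * (T * simoMean.toReal))) := by
  have hT' : (1 : ℝ) ≤ T := by exact_mod_cast hT
  have hα : 0 ≤ β / 2 * (T + 1) - 2 := by nlinarith
  have hβ0 : 0 ≤ β := by linarith
  have hlog : 0 ≤ Real.log (1 + ρsr 0) :=
    Real.log_nonneg (by linarith [NNReal.coe_nonneg (ρsr 0)])
  have hlog2 : 0 ≤ Real.log 2 := Real.log_nonneg (by norm_num)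
  set P := channelLaw n T ρsr ρrd
  have hpow : ∑ m, ∑ k, ∑ t, ‖c.encode m k t‖ₑ ^ 2 ≤ M * (n * T) := by
    have := hc.1
    rw [ENNReal.div_le_iff (by simpa using hM.ne') (by simp), Fintype.card_fin, mul_comm] at this
    exact this
  have hmean : ∀ m, ∫⁻ ω, simoInfo β ρsr (c.encode m) (τ m) (ω.1, ω.2.2.1) ∂P
      ≤ n * ENNReal.ofReal (2 * Real.log 2 + (β / 2 * (T + 1) - 2) * Real.log (1 + ρsr 0))
        + ENNReal.ofReal (β / 2 * (T + 1) - 2) * ∑ k, ∑ t, ‖c.encode m k t‖ₑ ^ 2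
        + ENNReal.ofReal β * (n * (T * simoMean)) := fun m => by
    have hme := fun k t₀ t => (measurable_simoExcess ρsr (c.encode m) k t₀ t).comp
      (by fun_prop : Measurable fun ω : Channel n T => (ω.1, ω.2.2.1))
    simp only [Function.comp_def] at hme
    unfold simoInfo
    rw [lintegral_add_left (by fun_prop), lintegral_const_mul _ (by fun_prop),
      lintegral_finsetSum _ (fun _ _ => by fun_prop)]
    refine add_le_add (by simp) ?_
    gcongr
    calc _ ≤ ∑ _k : Fin n, ∑ _t : Fin T, simoMean := by
          refine Finset.sum_le_sum fun k _ => ?_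
          rw [lintegral_finsetSum _ (fun _ _ => by fun_prop)]
          exact Finset.sum_le_sum fun t _ => lintegral_simoExcess_le hρ _ k _ t
      _ = _ := by simp
  refine (Finset.sum_le_sum fun m _ => hmean m).trans ?_
  rw [Finset.sum_add_distrib, Finset.sum_add_distrib, ← Finset.mul_sum (f := fun m =>
    ∑ k, ∑ t, ‖c.encode m k t‖ₑ ^ 2)]
  have hR : ENNReal.ofReal (n * (2 * Real.log 2 + (β / 2 * (T + 1) - 2) * Real.log (1 + ρsr 0)
        + (β / 2 * (T + 1) - 2) * T + β * (T * simoMean.toReal)))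
      = n * ENNReal.ofReal (2 * Real.log 2 + (β / 2 * (T + 1) - 2) * Real.log (1 + ρsr 0))
        + ENNReal.ofReal (β / 2 * (T + 1) - 2) * (n * T)
        + ENNReal.ofReal β * (n * (T * simoMean)) := by
    have e : ∀ a b d : ℝ, n * (a + b * T + d * (T * simoMean.toReal))
        = n * a + b * (n * T) + d * (n * (T * simoMean.toReal)) := by
      intros; ring
    rw [e, ENNReal.ofReal_add (by positivity) (by positivity),
      ENNReal.ofReal_add (by positivity) (by positivity), ENNReal.ofReal_mul (by positivity),
      ENNReal.ofReal_mul hα, ENNReal.ofReal_mul hβ0, ENNReal.ofReal_mul (by positivity),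
      ENNReal.ofReal_mul (by positivity), ENNReal.ofReal_mul (by positivity),
      ENNReal.ofReal_toReal simoMean_lt_top.ne]
    simp
  rw [hR, mul_add (M : ℝ≥0∞), mul_add (M : ℝ≥0∞)]
  refine add_le_add (add_le_add ?_ ?_) ?_
  · simp
  · rw [mul_left_comm]
    gcongr
  · simp

/-- An output symbol has bounded density, so the value `0` is null; the shear estimate divides by
this symbol. -/
lemma ae_simoOutput_ne_zero (ρ : Fin 2 → ℝ≥0) (x : Signal n T) (τ : Fin n → Fin T) :
    ∀ᵐ p ∂srLaw n T ρ, ∀ k, simoOutput x p 0 k (τ k) ≠ 0 := by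
  refine ae_all_iff.2 fun k => ?_
  have hmp : MeasurePreserving (fun p : (Fin 2 → Fin n → ℂ) × (Fin 2 → Signal n T) =>
      (p.1 0, p.2 0)) (srLaw n T ρ) (linkLaw n T (ρ 0)) :=
    (measurePreserving_pi_pi_eval (n := n) (fun i => complexGaussian (ρ i)) 0).prod
      (measurePreserving_eval (fun _ : Fin 2 =>
        Measure.pi fun _ : Fin n => Measure.pi fun _ : Fin T => complexGaussian 1) 0)
  let f : ℂ → ℝ≥0∞ := Set.indicator {0} 1
  have hf : Measurable f := measurable_one.indicator (measurableSet_singleton 0)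
  have h1 : ∫⁻ p, f (simoOutput x p 0 k (τ k)) ∂srLaw n T ρ = 0 := by
    have h2 := hmp.lintegral_comp (f := fun q => f (q.1 k * x k (τ k) + q.2 k (τ k)))
      (by fun_prop)
    have h3 := lintegral_linkLaw_symbol (n := n) (T := T) (ρ 0) k (τ k)
      (fun g w => f (g * x k (τ k) + w)) (by unfold Function.uncurry; fun_prop)
    refine (h2.trans h3).trans (le_antisymm ?_ zero_le)
    refine (lintegral_add_complexGaussian_le (ρ 0) (x k (τ k)) f hf).trans_eq ?_
    rw [lintegral_indicator_one (measurableSet_singleton 0)]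
    simp
  have hmeas : Measurable fun p => f (simoOutput x p 0 k (τ k)) := by
    have := measurable_simoOutput x
    fun_prop
  filter_upwards [(lintegral_eq_zero_iff hmeas).1 h1] with p hp h0
  simp [f, h0] at hp

/-- The cut-set bound at the source: one transmitter, two receivers. -/
theorem rate_le_of_source_cut (hT : 1 ≤ T) {β : ℝ} (hβ : 2 < β) :
    ∃ K : ℝ, ∀ (ρsr ρrd : Fin 2 → ℝ≥0) (R : ℝ), (∀ i, 0 < ρsr i) → ρsr 1 ≤ ρsr 0 →
      Achievable T ρsr ρrd R →
      T * R * Real.log 2 ≤ (β / 2 * (T + 1) - 2) * Real.log (1 + ρsr 0) + K := by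
  set mass : ℝ≥0∞ := tailMass β ^ T * (T * tailMass β ^ T) with hmass
  have hmassfin : mass ≠ ∞ := by
    have := (ENNReal.pow_lt_top (tailMass_lt_top hβ) (n := T)).ne
    exact ENNReal.mul_ne_top this (ENNReal.mul_ne_top (by simp) this)
  refine ⟨2 * Real.log 2 + (β / 2 * (T + 1) - 2) * T + β * (T * simoMean.toReal)
    + mass.toReal, fun ρsr ρrd R hρ hρ10 hR => ?_⟩
  have hT' : (1 : ℝ) ≤ T := by exact_mod_cast hT
  have hα : 0 ≤ β / 2 * (T + 1) - 2 := by nlinarith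
  have hlog : 0 ≤ Real.log (1 + ρsr 0) :=
    Real.log_nonneg (by linarith [NNReal.coe_nonneg (ρsr 0)])
  have hlog2 : 0 < Real.log 2 := Real.log_pos (by norm_num)
  have hβ0 : 0 ≤ β := by linarith
  have main := rate_le_of_information_bound (A := 2 * Real.log 2
    + (β / 2 * (T + 1) - 2) * Real.log (1 + ρsr 0)
    + (β / 2 * (T + 1) - 2) * T + β * (T * simoMean.toReal))
    (κ := mass.toReal) (by positivity) (fun n M c hc hM => ?_) hR
  · linarith
  let Q : (Fin 2 → Signal n T) → ℝ≥0∞ := fun y => ∏ k, simoTail β (y 0 k) (y 1 k)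
  have hQ : Measurable Q := by unfold Q simoTail; fun_prop
  choose τ hτ using fun m k => exists_norm_eq_pi_norm hT (c.encode m k)
  -- For a frozen second hop `r`, relays and destination together form one decision rule applied to
  -- the pair of relay observations. The auxiliary measure of a decoding region is then averaged
  -- over `r`.
  let out : (Fin 2 → Fin n → ℂ) × Signal n T → (Fin 2 → Signal n T) → Signal n T :=
    fun r y k t => (∑ i, r.1 i k * c.relay i (y i) k t) + r.2 k t
  have hout : Measurable (Function.uncurry out) := by
    have h1 : ∀ i k t, Measurable fun a : ((Fin 2 → Fin n → ℂ) × Signal n T) ×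
        (Fin 2 → Signal n T) => c.relay i (a.2 i) k t := fun i k t =>
      (measurable_pi_apply t).comp ((measurable_pi_apply k).comp
        ((c.measurable_relay i).comp (by fun_prop)))
    unfold out Function.uncurry
    fun_prop
  have hD : ∀ m, MeasurableSet {a : ((Fin 2 → Fin n → ℂ) × Signal n T) ×
      (Fin 2 → Signal n T) | c.decode (out a.1 a.2) = m} := fun m =>
    hout (c.measurable_decode m)
  have hDr : ∀ r m, MeasurableSet {y | c.decode (out r y) = m} := fun r m =>
    measurable_prodMk_left (hD m)
  refine ⟨fun m ω => simoInfo β ρsr (c.encode m) (τ m) (ω.1, ω.2.2.1),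
    fun m => ∫⁻ r, ∫⁻ y in {y | c.decode (out r y) = m}, Q y ∂volume ∂rdLaw n T ρrd,
    fun m => (measurable_simoInfo _ _ _ _).comp (by fun_prop), fun m l => ?_, ?_,
    sum_lintegral_simoInfo_le hT hβ hρ hM c hc τ⟩
  · have hB : MeasurableSet ({ω | c.decode (c.destSignal ω m) = m} ∩
        {ω : Channel n T | simoInfo β ρsr (c.encode m) (τ m) (ω.1, ω.2.2.1) < ENNReal.ofReal l}) :=
      (measurableSet_decode_destSignal c m).inter
        (measurableSet_lt ((measurable_simoInfo _ _ _ _).comp (by fun_prop)) measurable_const)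
    have hBi : Measurable (Set.indicator ({ω | c.decode (c.destSignal ω m) = m} ∩
        {ω : Channel n T | simoInfo β ρsr (c.encode m) (τ m) (ω.1, ω.2.2.1) < ENNReal.ofReal l})
        (1 : Channel n T → ℝ≥0∞)) := measurable_one.indicator hB
    rw [← lintegral_indicator_one hB, lintegral_channelLaw _ _ _ hBi,
      lintegral_lintegral_swap (by fun_prop), ← lintegral_const_mul']
    swap
    · exact ENNReal.ofReal_ne_top
    refine lintegral_mono fun r => ?_
    refine lintegral_indicator_le_of_density (Y := simoOutput (c.encode m))
      (p := ∏ k, simoBound ρsr (c.encode m) k)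
      (B := {p | (p.1, r.1, p.2, r.2) ∈ {ω | c.decode (c.destSignal ω m) = m} ∩
        {ω : Channel n T | simoInfo β ρsr (c.encode m) (τ m) (ω.1, ω.2.2.1) < ENNReal.ofReal l}})
      ?_ ?_ (lintegral_simoOutput_le hT ρsr (c.encode m)) hQ (hDr r m)
      ((ae_simoOutput_ne_zero ρsr (c.encode m) (τ m)).mono fun p hne hp => ⟨hp.1, ?_⟩)
    · refine Finset.prod_ne_zero_iff.2 fun k _ => Finset.prod_ne_zero_iff.2 fun i _ => ?_
      simp only [ne_eq, ENNReal.ofReal_eq_zero, not_le]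
      positivity
    · exact ENNReal.prod_ne_top fun k _ => ENNReal.prod_ne_top fun i _ => ENNReal.ofReal_ne_top
    · refine prod_le_ofReal_exp_mul_prod ?_ fun k =>
        simoBound_le hT hβ hρ hρ10 (c.encode m) p k (τ m k) (hτ m k) (hne k)
      have h1 := (sum_exponent_le_simoInfo hT hβ ρsr (c.encode m) (τ m) p).trans_lt hp.2
      exact ((ENNReal.ofReal_lt_ofReal_iff').1 h1).1.le
  · have hm : ∀ m, Measurable fun r => ∫⁻ y in {y | c.decode (out r y) = m}, Q y := fun m => by
      simp_rw [← lintegral_indicator (hDr _ m)]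
      exact Measurable.lintegral_prod_right' (f := fun a : ((Fin 2 → Fin n → ℂ) × Signal n T) ×
        (Fin 2 → Signal n T) => Set.indicator {y | c.decode (out a.1 y) = m} Q a.2)
        ((hQ.comp measurable_snd).indicator (hD m))
    rw [← lintegral_finsetSum _ fun m _ => hm m]
    calc _ ≤ ∫⁻ _ : (Fin 2 → Fin n → ℂ) × Signal n T, mass ^ n ∂rdLaw n T ρrd := by
          refine lintegral_mono fun r => ?_
          exact (sum_setLIntegral_fiber_le volume (fun y => c.decode (out r y)) (hDr r) Q hQ).trans_eq
            (lintegral_simoTail β)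
      _ = mass ^ n := by simp
      _ ≤ ENNReal.ofReal (Real.exp mass.toReal) ^ n := by
          gcongr; exact le_ofReal_exp_toReal hmassfin
      _ = _ := by rw [← ENNReal.ofReal_pow (by positivity), ← Real.exp_nat_mul]

end SourceCutRate

/-! ### Codes of large Hamming distance -/

section GilbertVarshamov

variable {L : ℕ} {A : Type*} [Fintype A] [DecidableEq A]

/-- A word in the ball is determined by the set where it differs from `c`, one of at most `2 ^ L`,
and by its values on that set of size at most `r`. -/
lemma card_hammingBall_le (hA : 0 < Fintype.card A) (c : Fin L → A) (r : ℕ) :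
    (Finset.univ.filter fun w => hammingDist c w ≤ r).card ≤ 2 ^ L * Fintype.card A ^ r := by
  classical
  let F : Finset (Fin L) → Finset (Fin L → A) := fun S =>
    Fintype.piFinset fun i => if i ∈ S then Finset.univ else {c i}
  have hF : ∀ S, (F S).card = Fintype.card A ^ S.card := fun S => by
    simp only [F, Fintype.card_piFinset, apply_ite Finset.card, Finset.card_univ,
      Finset.card_singleton]
    rw [Finset.prod_ite]
    simp
  have hsub : (Finset.univ.filter fun w => hammingDist c w ≤ r)
      ⊆ (Finset.univ.filter fun S : Finset (Fin L) => S.card ≤ r).biUnion F := by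
    intro w hw
    rw [Finset.mem_filter] at hw
    refine Finset.mem_biUnion.2 ⟨Finset.univ.filter fun i => c i ≠ w i, ?_, ?_⟩
    · exact Finset.mem_filter.2 ⟨Finset.mem_univ _, hw.2⟩
    · refine Fintype.mem_piFinset.2 fun i => ?_
      by_cases h : c i = w i <;> simp [h]
  calc _ ≤ _ := Finset.card_le_card hsub
    _ ≤ (Finset.univ.filter fun S : Finset (Fin L) => S.card ≤ r).card * Fintype.card A ^ r := by
      refine Finset.card_biUnion_le_card_mul _ _ _ fun S hS => ?_
      rw [hF]
      exact Nat.pow_le_pow_right hA (Finset.mem_filter.1 hS).2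
    _ ≤ 2 ^ L * Fintype.card A ^ r := by
      gcongr
      exact (Finset.card_filter_le _ _).trans (by simp)

/-- The Gilbert–Varshamov bound, with a crude estimate for the volume of a Hamming ball. -/
lemma exists_code_hammingDist (hA : 0 < Fintype.card A) (L r : ℕ) :
    ∃ (M : ℕ) (c : Fin M → Fin L → A), (∀ m m', m ≠ m' → r < hammingDist (c m) (c m')) ∧
      Fintype.card A ^ L ≤ M * (2 ^ L * Fintype.card A ^ r) := by
  classical
  let good : Finset (Finset (Fin L → A)) := Finset.univ.filter fun C =>
    ∀ c ∈ C, ∀ c' ∈ C, c ≠ c' → r < hammingDist c c'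
  have hne : good.Nonempty := ⟨∅, by simp [good]⟩
  obtain ⟨C, hC, hmax⟩ := Finset.exists_max_image good Finset.card hne
  have hC' := (Finset.mem_filter.1 hC).2
  -- A word far from all of `C` could be added to `C`, against maximality; so the balls around `C`
  -- cover the space.
  have hcover : ∀ w, ∃ c ∈ C, hammingDist c w ≤ r := by
    intro w
    by_contra hcon
    push Not at hcon
    have hw : w ∉ C := fun h => by simpa using hcon w h
    have hins : insert w C ∈ good := by
      refine Finset.mem_filter.2 ⟨Finset.mem_univ _, fun c hc c' hc' hcc => ?_⟩
      rcases Finset.mem_insert.1 hc with h1 | h1 <;> rcases Finset.mem_insert.1 hc' with h2 | h2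
      · exact absurd (h1.trans h2.symm) hcc
      · rw [h1, hammingDist_comm]; exact hcon _ h2
      · rw [h2]; exact hcon _ h1
      · exact hC' _ h1 _ h2 hcc
    have := hmax _ hins
    rw [Finset.card_insert_of_notMem hw] at this
    omega
  let e := C.equivFin
  refine ⟨C.card, fun m => (e.symm m : Fin L → A), fun m m' hm => ?_, ?_⟩
  · refine hC' _ (e.symm m).2 _ (e.symm m').2 fun h => hm ?_
    exact e.symm.injective (Subtype.ext h)
  · calc Fintype.card A ^ L = (Finset.univ : Finset (Fin L → A)).card := by simp
      _ ≤ (C.biUnion fun c => Finset.univ.filter fun w => hammingDist c w ≤ r).card := by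
        refine Finset.card_le_card fun w _ => ?_
        obtain ⟨c, hc, hcw⟩ := hcover w
        exact Finset.mem_biUnion.2 ⟨c, hc, Finset.mem_filter.2 ⟨Finset.mem_univ _, hcw⟩⟩
      _ ≤ _ := Finset.card_biUnion_le_card_mul _ _ _ fun c _ => card_hammingBall_le hA c r

end GilbertVarshamov

/-! ### A pilot-based code for a point-to-point link -/

section LinkCode

variable {T : ℕ}

/-- The received block `y` is consistent with the input block `x`, whose first symbol is a pilot. -/
def Consistent (Δ : ℝ) (x y : Fin (T + 1) → ℂ) : Prop :=
  ∀ t, 2 * ‖y t - x t * y 0‖ < Δ * ‖y 0‖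

lemma measurableSet_consistent (Δ : ℝ) (x : Fin (T + 1) → ℂ) :
    MeasurableSet {y | Consistent Δ x y} := by
  simp only [Consistent, Set.ofPred_forall]
  exact MeasurableSet.iInter fun t => measurableSet_lt (by fun_prop) (by fun_prop)

/-- Consistency places `y t` within `Δ * ‖y 0‖ / 2` of `x t * y 0`, and the candidates are at least
`Δ * ‖y 0‖` apart. Strictness in `Consistent` rules out `y 0 = 0`. -/
lemma not_consistent_of_consistent {Δ : ℝ} {x x' y : Fin (T + 1) → ℂ}
    (hx : ∃ t, Δ ≤ ‖x t - x' t‖) (h : Consistent Δ x y) : ¬ Consistent Δ x' y := by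
  intro h'
  obtain ⟨t, ht⟩ := hx
  have h1 := h t
  have h2 := h' t
  have h3 : ‖x t - x' t‖ * ‖y 0‖ ≤ ‖y t - x' t * y 0‖ + ‖y t - x t * y 0‖ := by
    rw [← norm_mul]
    calc ‖(x t - x' t) * y 0‖ = ‖(y t - x' t * y 0) - (y t - x t * y 0)‖ := by congr 1; ring
      _ ≤ _ := norm_sub_le _ _
  have h4 := mul_le_mul_of_nonneg_right ht (norm_nonneg (y 0))
  linarith

/-- The residual is at most `2 * ‖w‖` and is doubled in `Consistent`; the pilot loses at most one
further `‖w‖`. This accounts for the constant `5`. -/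
lemma consistent_of_noise_lt {Δ : ℝ} (hΔ0 : 0 ≤ Δ) (hΔ : Δ ≤ 1) {x w : Fin (T + 1) → ℂ} {g : ℂ}
    (hx0 : x 0 = 1) (hx : ∀ t, ‖x t‖ ≤ 1) (h : 5 * ‖w‖ < Δ * ‖g‖) :
    Consistent Δ x fun t => g * x t + w t := by
  intro t
  have h1 : g * x t + w t - x t * (g * x 0 + w 0) = w t - x t * w 0 := by rw [hx0]; ring
  have hw := norm_le_pi_norm w
  have h2 : ‖w t - x t * w 0‖ ≤ ‖w‖ + ‖w‖ := by
    refine (norm_sub_le _ _).trans (add_le_add (hw t) ?_)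
    rw [norm_mul]
    exact (mul_le_of_le_one_left (norm_nonneg _) (hx t)).trans (hw 0)
  have h3 : ‖g‖ - ‖w‖ ≤ ‖g * x 0 + w 0‖ := by
    rw [hx0, mul_one]
    have := norm_sub_le (g + w 0) (w 0)
    rw [add_sub_cancel_right] at this
    linarith [hw 0]
  have h4 := mul_le_mul_of_nonneg_left h3 hΔ0
  have h5 : Δ * ‖w‖ ≤ ‖w‖ := mul_le_of_le_one_left (norm_nonneg _) hΔ
  simp only [h1]
  nlinarith

/-- The regions need not cover the space: everything outside them is sent to message `0`, which
keeps the fibres measurable. -/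
lemma exists_measurable_decoder {α : Type*} [MeasurableSpace α] {M : ℕ} (hM : 0 < M)
    (G : Fin M → Set α) (hG : ∀ m, MeasurableSet (G m))
    (hdis : ∀ m m', m ≠ m' → ∀ y, y ∈ G m → y ∉ G m') :
    ∃ dec : α → Fin M, Measurable dec ∧ ∀ m, ∀ y ∈ G m, dec y = m := by
  classical
  let dec : α → Fin M := fun y => if h : ∃ m, y ∈ G m then h.choose else ⟨0, hM⟩
  have hdec : ∀ m, ∀ y ∈ G m, dec y = m := fun m y hy => by
    have h : ∃ m, y ∈ G m := ⟨m, hy⟩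
    simp only [dec, dif_pos h]
    by_contra hne
    exact hdis _ _ hne y h.choose_spec hy
  refine ⟨dec, measurable_to_countable' fun m => ?_, hdec⟩
  by_cases hm : m = ⟨0, hM⟩
  · have : dec ⁻¹' {m} = G m ∪ (⋃ m, G m)ᶜ := by
      ext y
      simp only [Set.mem_preimage, Set.mem_singleton_iff, Set.mem_union, Set.mem_compl_iff,
        Set.mem_iUnion]
      constructor
      · intro h
        by_cases hy : ∃ m, y ∈ G m
        · obtain ⟨m', hm'⟩ := hy
          rw [hdec m' y hm'] at h
          exact Or.inl (h ▸ hm')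
        · exact Or.inr hy
      · rintro (h | h)
        · exact hdec m y h
        · simp only [dec, dif_neg h, hm]
    rw [this]
    exact (hG m).union (MeasurableSet.iUnion hG).compl
  · have : dec ⁻¹' {m} = G m := by
      ext y
      simp only [Set.mem_preimage, Set.mem_singleton_iff]
      refine ⟨fun h => ?_, hdec m y⟩
      by_cases hy : ∃ m, y ∈ G m
      · obtain ⟨m', hm'⟩ := hy
        rw [hdec m' y hm'] at h
        exact h ▸ hm'
      · exact absurd (by simp only [← h, dec, dif_neg hy]) hm
    rw [this]
    exact hG m

/-- A pilot followed by points of a `K × K` grid. -/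
noncomputable def gridBlock (K : ℕ) (a : Fin T → Fin K × Fin K) : Fin (T + 1) → ℂ :=
  -- The scale `1 / (2 * K)` keeps real and imaginary parts below `1 / 2`, hence moduli at most `1`,
  -- and is also the grid spacing.
  Fin.cons 1 fun j => (⟨(a j).1 / (2 * K), (a j).2 / (2 * K)⟩ : ℂ)

lemma norm_gridBlock_le {K : ℕ} (a : Fin T → Fin K × Fin K) (t : Fin (T + 1)) :
    ‖gridBlock K a t‖ ≤ 1 := by
  refine Fin.cases (by simp [gridBlock]) (fun j => ?_) t
  have hK : (0 : ℝ) < K := by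
    have := (a j).1.pos
    exact_mod_cast this
  have h : ∀ i : Fin K, |(i : ℝ) / (2 * K)| ≤ 1 / 2 := fun i => by
    rw [abs_of_nonneg (by positivity), div_le_div_iff₀ (by positivity) (by norm_num)]
    have : (i : ℝ) ≤ K := by exact_mod_cast i.isLt.le
    linarith
  simp only [gridBlock, Fin.cons_succ]
  refine (Complex.norm_le_abs_re_add_abs_im _).trans ?_
  linarith [h (a j).1, h (a j).2]

lemma le_norm_gridBlock_sub {K : ℕ} {a a' : Fin T → Fin K × Fin K} (h : a ≠ a') :
    ∃ t, (1 : ℝ) / (2 * K) ≤ ‖gridBlock K a t - gridBlock K a' t‖ := by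
  obtain ⟨j, hj⟩ := Function.ne_iff.1 h
  refine ⟨j.succ, ?_⟩
  have hK : (0 : ℝ) < K := by
    have := (a j).1.pos
    exact_mod_cast this
  have hsep : ∀ i i' : Fin K, i ≠ i' →
      (1 : ℝ) / (2 * K) ≤ |(i : ℝ) / (2 * K) - (i' : ℝ) / (2 * K)| := fun i i' hi => by
    rw [← sub_div, abs_div, abs_of_pos (by positivity : (0 : ℝ) < 2 * K)]
    gcongr
    have h1 : (i : ℤ) - i' ≠ 0 := by
      intro h0
      exact hi (Fin.ext (by omega))
    have h2 := Int.one_le_abs h1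
    exact_mod_cast h2
  simp only [gridBlock, Fin.cons_succ]
  set z : ℂ := (⟨(a j).1 / (2 * K), (a j).2 / (2 * K)⟩ : ℂ)
    - ⟨(a' j).1 / (2 * K), (a' j).2 / (2 * K)⟩
  by_cases h1 : (a j).1 = (a' j).1
  · have h2 : (a j).2 ≠ (a' j).2 := fun h2 => hj (Prod.ext h1 h2)
    exact (hsep _ _ h2).trans (Complex.abs_im_le_norm z)
  · exact (hsep _ _ h1).trans (Complex.abs_re_le_norm z)

/-- All but at most `e` of the blocks are received with a noise that is small compared with the
fading coefficient. -/
def FewBadBlocks {L : ℕ} (Δ : ℝ) (e : ℕ) (g : Fin L → ℂ) (w : Signal L (T + 1)) : Prop :=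
  ∃ S : Finset (Fin L), S.card ≤ e ∧ ∀ j ∉ S, 5 * ‖w j‖ < Δ * ‖g j‖

/-- A whole block serves as one letter of an alphabet of size `K ^ (2 * T)`. Two codewords differ in
more than `2 * e` blocks, so no output can be consistent with both outside `e` blocks each. The
guarantee is deterministic; probability enters only through `FewBadBlocks`. -/
lemma exists_link_code {K : ℕ} (hK : 1 ≤ K) (L e : ℕ) :
    ∃ (M : ℕ) (x : Fin M → Signal L (T + 1)) (dec : Signal L (T + 1) → Fin M),
      Measurable dec ∧ (∀ m k t, ‖x m k t‖ ≤ 1) ∧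
      (K ^ (2 * T)) ^ L ≤ M * (2 ^ L * (K ^ (2 * T)) ^ (2 * e)) ∧
      ∀ m g w, FewBadBlocks (1 / (2 * K)) e g w →
        dec (fun j t => g j * x m j t + w j t) = m := by
  classical
  have hcard : Fintype.card (Fin T → Fin K × Fin K) = K ^ (2 * T) := by
    simp [pow_mul, sq]
  have hpos : 0 < Fintype.card (Fin T → Fin K × Fin K) := by rw [hcard]; positivity
  obtain ⟨M, c, hdist, hM⟩ := exists_code_hammingDist hpos L (2 * e)
  rw [hcard] at hM
  have hM0 : 0 < M := by
    rcases Nat.eq_zero_or_pos M with h | h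
    · have : 0 < (K ^ (2 * T)) ^ L := by positivity
      rw [h, zero_mul] at hM
      omega
    · exact h
  let Δ : ℝ := 1 / (2 * K)
  have hK' : (1 : ℝ) ≤ K := by exact_mod_cast hK
  have hΔ0 : 0 ≤ Δ := by positivity
  have hΔ1 : Δ ≤ 1 := by
    simp only [Δ]
    rw [div_le_one (by positivity)]; linarith
  let x : Fin M → Signal L (T + 1) := fun m j => gridBlock K (c m j)
  let G : Fin M → Set (Signal L (T + 1)) := fun m =>
    {y | ∃ S : Finset (Fin L), S.card ≤ e ∧ ∀ j ∉ S, Consistent Δ (x m j) (y j)}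
  have hG : ∀ m, MeasurableSet (G m) := fun m => by
    have : G m = ⋃ S : Finset (Fin L), ⋃ _ : S.card ≤ e, ⋂ j, ⋂ _ : j ∉ S,
        (fun y : Signal L (T + 1) => y j) ⁻¹' {y | Consistent Δ (x m j) y} := by
      ext y; simp [G]
    rw [this]
    exact MeasurableSet.iUnion fun S => MeasurableSet.iUnion fun _ => MeasurableSet.iInter fun j =>
      MeasurableSet.iInter fun _ => measurable_pi_apply j (measurableSet_consistent Δ _)
  have hdis : ∀ m m', m ≠ m' → ∀ y, y ∈ G m → y ∉ G m' := by
    rintro m m' hm y ⟨S, hS, hSc⟩ ⟨S', hS', hSc'⟩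
    have h1 := hdist m m' hm
    have h2 : (S ∪ S').card < (Finset.univ.filter fun j => c m j ≠ c m' j).card := by
      have h3 : (S ∪ S').card ≤ 2 * e := (Finset.card_union_le _ _).trans (by omega)
      exact h3.trans_lt h1
    obtain ⟨j, hj, hjS⟩ := Finset.exists_mem_notMem_of_card_lt_card h2
    rw [Finset.mem_union, not_or] at hjS
    exact not_consistent_of_consistent (le_norm_gridBlock_sub (Finset.mem_filter.1 hj).2)
      (hSc j hjS.1) (hSc' j hjS.2)
  obtain ⟨dec, hdec, hdecG⟩ := exists_measurable_decoder hM0 G hG hdis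
  refine ⟨M, x, dec, hdec, fun m k t => norm_gridBlock_le _ t, hM, fun m g w hgw => hdecG m _ ?_⟩
  obtain ⟨S, hS, hSg⟩ := hgw
  exact ⟨S, hS, fun j hj => consistent_of_noise_lt hΔ0 hΔ1 (by simp [x, gridBlock])
    (fun t => norm_gridBlock_le _ t) (hSg j hj)⟩

/-! ### The probability of many bad blocks -/

/-- The probability that the noise in a block is not small compared with the fading coefficient. -/
noncomputable def badProb (T : ℕ) (ρ : ℝ≥0) (Δ : ℝ) : ℝ≥0∞ :=
  ∫⁻ g, ∫⁻ w : Fin (T + 1) → ℂ, Set.indicator {p : ℂ × (Fin (T + 1) → ℂ) | Δ * ‖p.1‖ ≤ 5 * ‖p.2‖}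
    1 (g, w) ∂(Measure.pi fun _ => complexGaussian 1) ∂complexGaussian ρ

lemma measurableSet_badBlock (Δ : ℝ) :
    MeasurableSet {p : ℂ × (Fin (T + 1) → ℂ) | Δ * ‖p.1‖ ≤ 5 * ‖p.2‖} :=
  measurableSet_le (by fun_prop) (by fun_prop)

lemma linkLaw_forall_bad {n : ℕ} (ρ : ℝ≥0) (Δ : ℝ) (U : Finset (Fin n)) :
    linkLaw n (T + 1) ρ {p | ∀ k ∈ U, Δ * ‖p.1 k‖ ≤ 5 * ‖p.2 k‖} = badProb T ρ Δ ^ U.card := by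
  classical
  let bad : Set (ℂ × (Fin (T + 1) → ℂ)) := {p | Δ * ‖p.1‖ ≤ 5 * ‖p.2‖}
  have hbad : MeasurableSet bad := measurableSet_badBlock Δ
  let F : Fin n → ℂ → (Fin (T + 1) → ℂ) → ℝ≥0∞ := fun k g w =>
    if k ∈ U then bad.indicator 1 (g, w) else 1
  have hF : ∀ k, Measurable (Function.uncurry (F k)) := fun k => by
    by_cases h : k ∈ U
    · simpa only [F, h, if_true, Function.uncurry_def] using measurable_one.indicator hbad
    · simpa only [F, h, if_false, Function.uncurry_def] using measurable_const
  have hset : {p : (Fin n → ℂ) × Signal n (T + 1) | ∀ k ∈ U, Δ * ‖p.1 k‖ ≤ 5 * ‖p.2 k‖}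
      = ⋂ k ∈ U, (fun p : (Fin n → ℂ) × Signal n (T + 1) => (p.1 k, p.2 k)) ⁻¹' bad := by
    ext p; simp [bad]
  have hmeas : MeasurableSet
      {p : (Fin n → ℂ) × Signal n (T + 1) | ∀ k ∈ U, Δ * ‖p.1 k‖ ≤ 5 * ‖p.2 k‖} := by
    rw [hset]
    refine MeasurableSet.biInter (Finset.countable_toSet U) fun k _ => ?_
    exact (by fun_prop : Measurable
      fun p : (Fin n → ℂ) × Signal n (T + 1) => (p.1 k, p.2 k)) hbad
  have hind : ∀ g w, Set.indicator
      {p : (Fin n → ℂ) × Signal n (T + 1) | ∀ k ∈ U, Δ * ‖p.1 k‖ ≤ 5 * ‖p.2 k‖} 1 (g, w)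
      = ∏ k, F k (g k) (w k) := fun g w => by
    by_cases h : ∀ k ∈ U, Δ * ‖g k‖ ≤ 5 * ‖w k‖
    · rw [Set.indicator_of_mem (by exact h), Finset.prod_eq_one]
      · rfl
      · intro k _
        by_cases hk : k ∈ U
        · simp only [F, hk, if_true]
          exact Set.indicator_of_mem (show (g k, w k) ∈ bad from h k hk) _
        · simp [F, hk]
    · rw [Set.indicator_of_notMem (by exact h)]
      push Not at h
      obtain ⟨k, hk, hkb⟩ := h
      refine (Finset.prod_eq_zero (Finset.mem_univ k) ?_).symm
      simp only [F, hk, if_true]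
      exact Set.indicator_of_notMem (show (g k, w k) ∉ bad from not_le.2 hkb) _
  rw [← lintegral_indicator_one hmeas, linkLaw,
    lintegral_prod _ (measurable_one.indicator hmeas).aemeasurable]
  simp_rw [hind]
  refine (lintegral_lintegral_pi_prod (fun _ : Fin n => complexGaussian ρ)
    (fun _ : Fin n => Measure.pi fun _ : Fin (T + 1) => complexGaussian 1) F hF).trans ?_
  have hk : ∀ k, ∫⁻ g, ∫⁻ w, F k g w ∂(Measure.pi fun _ => complexGaussian 1) ∂complexGaussian ρ
      = if k ∈ U then badProb T ρ Δ else 1 := fun k => by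
    by_cases h : k ∈ U
    · simp only [F, h, if_true, badProb, bad]
    · simp [F, h]
  simp_rw [hk]
  simp [Finset.prod_ite_mem]

/-- Failure forces some `e + 1` blocks to be bad, which are independent events; the number of such
sets is crudely at most `2 ^ L`. -/
lemma linkLaw_not_fewBadBlocks_le {n L : ℕ} (ρ : ℝ≥0) (Δ : ℝ) (e : ℕ) (ι : Fin L ↪ Fin n) :
    linkLaw n (T + 1) ρ {p | ¬ FewBadBlocks Δ e (fun j => p.1 (ι j)) (fun j => p.2 (ι j))}
      ≤ 2 ^ L * badProb T ρ Δ ^ (e + 1) := by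
  classical
  have hsub : {p : (Fin n → ℂ) × Signal n (T + 1) |
      ¬ FewBadBlocks Δ e (fun j => p.1 (ι j)) (fun j => p.2 (ι j))}
      ⊆ ⋃ U ∈ Finset.univ.powersetCard (e + 1),
        {p : (Fin n → ℂ) × Signal n (T + 1) | ∀ k ∈ U.map ι, Δ * ‖p.1 k‖ ≤ 5 * ‖p.2 k‖} := by
    intro p hp
    let S : Finset (Fin L) := Finset.univ.filter fun j => Δ * ‖p.1 (ι j)‖ ≤ 5 * ‖p.2 (ι j)‖
    have hS : e + 1 ≤ S.card := by
      by_contra hlt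
      refine hp ⟨S, by omega, fun j hj => ?_⟩
      simpa [S] using hj
    obtain ⟨U, hUS, hU⟩ := Finset.exists_subset_card_eq hS
    refine Set.mem_biUnion (Finset.mem_coe.2 (Finset.mem_powersetCard.2
      ⟨Finset.subset_univ U, hU⟩)) fun k hk => ?_
    obtain ⟨j, hj, rfl⟩ := Finset.mem_map.1 hk
    exact (Finset.mem_filter.1 (hUS hj)).2
  refine (measure_mono hsub).trans ((measure_biUnion_finset_le _ _).trans ?_)
  calc _ = ∑ U ∈ (Finset.univ : Finset (Fin L)).powersetCard (e + 1),
        badProb T ρ Δ ^ (e + 1) := by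
        refine Finset.sum_congr rfl fun U hU => ?_
        rw [linkLaw_forall_bad, Finset.card_map, (Finset.mem_powersetCard.1 hU).2]
    _ ≤ 2 ^ L * badProb T ρ Δ ^ (e + 1) := by
        rw [Finset.sum_const, nsmul_eq_mul]
        gcongr
        have h : ((Finset.univ : Finset (Fin L)).powersetCard (e + 1)).card ≤ 2 ^ L := by
          rw [Finset.card_powersetCard, Finset.card_univ, Fintype.card_fin]
          exact Nat.choose_le_two_pow L (e + 1)
        exact_mod_cast h

/-- In a bad block either the noise exceeds `a`, or the fading coefficient lies in a disc of radius
`5 * a / Δ`. Markov's inequality bounds the first probability by `θ / 2` through the choice of `a`.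
After normalization the disc has area `25 * a ^ 2 * π / (Δ ^ 2 * ρ)`, which is at most `θ / 2`
through the choice of `c`. -/
lemma exists_badProb_le (T : ℕ) {θ : ℝ} (hθ : 0 < θ) :
    ∃ c : ℝ, 0 < c ∧ ∀ (ρ : ℝ≥0) (Δ : ℝ), 0 < ρ → 0 < Δ → c ≤ Δ ^ 2 * ρ →
      badProb T ρ Δ ≤ ENNReal.ofReal θ := by
  set a : ℝ := 2 * ((T + 1) * absMoment.toReal + 1) / θ with ha
  have hm0 : 0 ≤ absMoment.toReal := ENNReal.toReal_nonneg
  have ha0 : 0 < a := by positivity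
  refine ⟨50 * a ^ 2 * Real.pi / θ, by positivity, fun ρ Δ hρ hΔ hc => ?_⟩
  have hρ' : (0 : ℝ) < ρ := hρ
  set r : ℝ := 5 * a / Δ with hr
  let f : ℂ → ℝ≥0∞ := (Metric.closedBall (0 : ℂ) r).indicator 1
  have hf : Measurable f := measurable_one.indicator Metric.isClosed_closedBall.measurableSet
  let h : ℂ → ℝ≥0∞ := fun z => ENNReal.ofReal (‖z‖ / a)
  have hh : Measurable h := by fun_prop
  have hpt : ∀ (g : ℂ) (w : Fin (T + 1) → ℂ),
      Set.indicator {p : ℂ × (Fin (T + 1) → ℂ) | Δ * ‖p.1‖ ≤ 5 * ‖p.2‖} 1 (g, w)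
        ≤ f g + ∑ t, h (w t) := by
    intro g w
    by_cases hb : Δ * ‖g‖ ≤ 5 * ‖w‖
    · rw [Set.indicator_of_mem (by exact hb)]
      rcases le_or_gt (‖w‖) a with hw | hw
      · refine le_trans ?_ le_self_add
        have hg : g ∈ Metric.closedBall (0 : ℂ) r := by
          rw [mem_closedBall_zero_iff, hr, le_div_iff₀ hΔ]
          nlinarith
        simp only [f, Set.indicator_of_mem hg]
        rfl
      · refine le_trans ?_ le_add_self
        obtain ⟨t, ht⟩ := exists_norm_eq_pi_norm (by omega) w
        refine le_trans ?_ (Finset.single_le_sum (f := fun t => h (w t)) (fun _ _ => zero_le)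
          (Finset.mem_univ t))
        simp only [h, Pi.one_apply]
        rw [ENNReal.one_le_ofReal, one_le_div ha0, ht]
        exact hw.le
    · rw [Set.indicator_of_notMem (by exact hb)]
      exact zero_le
  have hgint : ∫⁻ g, f g ∂complexGaussian ρ ≤ ENNReal.ofReal (θ / 2) := by
    rw [lintegral_complexGaussian _ _ hf]
    have hs : 0 < √(ρ : ℝ) := Real.sqrt_pos.2 hρ'
    have h1 : ∀ z : ℂ, f (((√ρ : ℝ) : ℂ) * z)
        = (Metric.closedBall (0 : ℂ) (r / √ρ)).indicator 1 z := fun z => by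
      simp only [f, Set.indicator, mem_closedBall_zero_iff, norm_mul, Complex.norm_real,
        Real.norm_of_nonneg hs.le, le_div_iff₀ hs, mul_comm, Pi.one_apply]
    simp_rw [h1]
    rw [lintegral_indicator_one Metric.isClosed_closedBall.measurableSet]
    refine (complexGaussian_one_le_volume _).trans ?_
    rw [Complex.volume_closedBall, ← ENNReal.ofReal_pow (by positivity),
      ← ENNReal.ofReal_coe_nnreal, ← ENNReal.ofReal_mul (by positivity)]
    apply ENNReal.ofReal_le_ofReal
    rw [div_pow, Real.sq_sqrt hρ'.le, hr, NNReal.coe_real_pi]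
    rw [div_le_iff₀ hθ] at hc
    have h2 : (5 * a / Δ) ^ 2 / ρ * Real.pi = 25 * a ^ 2 * Real.pi / (Δ ^ 2 * ρ) := by
      field_simp; ring
    rw [h2, div_le_iff₀ (by positivity)]
    linarith
  have hwint : ∀ t : Fin (T + 1), ∫⁻ w : Fin (T + 1) → ℂ, h (w t)
      ∂(Measure.pi fun _ => complexGaussian 1) = ENNReal.ofReal (absMoment.toReal / a) := by
    intro t
    rw [(measurePreserving_eval (fun _ : Fin (T + 1) => complexGaussian 1) t).lintegral_comp hh]
    simp only [h, div_eq_inv_mul]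
    simp_rw [ENNReal.ofReal_mul (inv_nonneg.2 ha0.le)]
    rw [lintegral_const_mul _ (by fun_prop), ENNReal.ofReal_toReal absMoment_lt_top.ne, absMoment]
    simp
  calc badProb T ρ Δ ≤ ∫⁻ g, ∫⁻ w : Fin (T + 1) → ℂ, (f g + ∑ t, h (w t))
        ∂(Measure.pi fun _ => complexGaussian 1) ∂complexGaussian ρ :=
        lintegral_mono fun g => lintegral_mono fun w => hpt g w
    _ = ∫⁻ g, f g ∂complexGaussian ρ + (T + 1) * ENNReal.ofReal (absMoment.toReal / a) := by
        have h1 : ∀ g, ∫⁻ w : Fin (T + 1) → ℂ, (f g + ∑ t, h (w t))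
            ∂(Measure.pi fun _ => complexGaussian 1)
            = f g + (T + 1) * ENNReal.ofReal (absMoment.toReal / a) := fun g => by
          rw [lintegral_add_left measurable_const,
            lintegral_finsetSum _ (fun t _ => by fun_prop)]
          simp [hwint]
        simp_rw [h1]
        rw [lintegral_add_left hf]
        simp
    _ ≤ ENNReal.ofReal (θ / 2) + ENNReal.ofReal (θ / 2) := by
        gcongr
        have h1 : ((T : ℝ≥0∞) + 1) = ENNReal.ofReal (T + 1) := by
          rw [ENNReal.ofReal_add (by positivity) (by norm_num)]; simp
        rw [h1, ← ENNReal.ofReal_mul (by positivity)]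
        apply ENNReal.ofReal_le_ofReal
        rw [mul_div_assoc', div_le_iff₀ ha0, ha]
        field_simp
        linarith
    _ = ENNReal.ofReal θ := by
        rw [← ENNReal.ofReal_add (by positivity) (by positivity), add_halves]

end LinkCode

/-! ### Decode-and-forward -/

section DecodeAndForward

variable {n L B M T : ℕ}

/-- The fading blocks that form group `b`. -/
def groupIndex (hn : (B + 1) * L ≤ n) (b : ℕ) (hb : b ≤ B) : Fin L ↪ Fin n where
  toFun j := ⟨b * L + j, by
    have h1 : (b + 1) * L ≤ (B + 1) * L := Nat.mul_le_mul_right L (by omega)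
    have h2 := j.isLt
    rw [Nat.succ_mul] at h1
    omega⟩
  inj' i j h := by
    simp only [Fin.mk.injEq] at h
    exact Fin.ext (by omega)

lemma group_apply (hn : (B + 1) * L ≤ n) {b : ℕ} (hb : b ≤ B) (y : Signal n T) (j : Fin L)
    (t : Fin T) : group L y b j t = y (groupIndex hn b hb j) t := by
  have h : b * L + j < n := (groupIndex hn b hb j).isLt
  rw [group, dif_pos h]
  rfl

lemma groupIndex_div (hn : (B + 1) * L ≤ n) (hL : 0 < L) {b : ℕ} (hb : b ≤ B) (j : Fin L) :
    (groupIndex hn b hb j).val / L = b := by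
  change (b * L + j) / L = b
  rw [mul_comm, Nat.mul_add_div hL, Nat.div_eq_of_lt j.isLt, add_zero]

lemma groupIndex_mod (hn : (B + 1) * L ≤ n) {b : ℕ} (hb : b ≤ B) (j : Fin L) :
    (groupIndex hn b hb j).val % L = j := by
  change (b * L + j) % L = j
  rw [mul_comm, Nat.mul_add_mod, Nat.mod_eq_of_lt j.isLt]

lemma group_relayReceives (d : DecodeForward L T M) (hL : 0 < L) (hn : (B + 1) * L ≤ n)
    (ω : Channel n T) (m : Fin B → Fin M) (b : Fin B) :
    group L (relayReceives ω ((d.toCode n B hL).encode m) 0) b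
      = fun j t => ω.1 0 (groupIndex hn b b.isLt.le j) * d.sourceEnc (m b) j t
        + ω.2.2.1 0 (groupIndex hn b b.isLt.le j) t := by
  funext j t
  have hd := groupIndex_div hn hL b.isLt.le j
  have hm := groupIndex_mod hn b.isLt.le j
  rw [group_apply hn b.isLt.le, relayReceives]
  simp only [DecodeForward.toCode, hd, hm, b.isLt, dif_pos, Fin.eta]

/-- Sub-message `b` reaches the destination one group late. With a correct relay estimate, and the
other relay silent, that group is the output of a plain point-to-point link. -/
lemma group_destSignal (d : DecodeForward L T M) (hL : 0 < L) (hn : (B + 1) * L ≤ n)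
    (ω : Channel n T) (m : Fin B → Fin M) (b : Fin B)
    (hr : d.relayDec (group L (relayReceives ω ((d.toCode n B hL).encode m) 0) b) = m b) :
    group L ((d.toCode n B hL).destSignal ω m) (b + 1)
      = fun j t => ω.2.1 0 (groupIndex hn (b + 1) b.isLt j) * d.relayEnc (m b) j t
        + ω.2.2.2 (groupIndex hn (b + 1) b.isLt j) t := by
  funext j t
  have hb : (b : ℕ) + 1 ≤ B := b.isLt
  have hd := groupIndex_div hn hL hb j
  have hm := groupIndex_mod hn hb j
  rw [group_apply hn hb, Code.destSignal, destReceives, Fin.sum_univ_two]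
  have h0 : (d.toCode n B hL).relaySignal ω m 0 (groupIndex hn (b + 1) hb j) t
      = d.relayEnc (m b) j t := by
    rw [Code.relaySignal]
    change (if (0 : Fin 2) = 0 ∧ 1 ≤ (groupIndex hn (b + 1) hb j).val / L
      ∧ (groupIndex hn (b + 1) hb j).val / L ≤ B then _ else _) = _
    rw [if_pos ⟨rfl, by omega, by omega⟩]
    simp only [hd, hm, Nat.add_sub_cancel, hr, Fin.eta]
  have h1 : (d.toCode n B hL).relaySignal ω m 1 (groupIndex hn (b + 1) hb j) t = 0 := by
    simp [Code.relaySignal, DecodeForward.toCode]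
  rw [h0, h1, mul_zero, add_zero]

lemma powerConstraint_toCode (d : DecodeForward L T M) (hL : 0 < L)
    (hs : ∀ m k t, ‖d.sourceEnc m k t‖ ≤ 1) (hr : ∀ m k t, ‖d.relayEnc m k t‖ ≤ 1)
    (ρsr ρrd : Fin 2 → ℝ≥0) : (d.toCode n B hL).PowerConstraint ρsr ρrd := by
  have hsq : ∀ z : ℂ, ‖z‖ ≤ 1 → ‖z‖ₑ ^ 2 ≤ 1 := fun z hz => by
    refine pow_le_one' ?_ 2
    rw [← ofReal_norm]
    exact ENNReal.ofReal_le_one.2 hz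
  have henc : ∀ m k t, ‖(d.toCode n B hL).encode m k t‖ₑ ^ 2 ≤ 1 := fun m k t => by
    refine hsq _ ?_
    simp only [DecodeForward.toCode]
    split_ifs
    · exact hs _ _ _
    · simp
  have hrel : ∀ ω m i k t, ‖(d.toCode n B hL).relaySignal ω m i k t‖ₑ ^ 2 ≤ 1 :=
    fun ω m i k t => by
      refine hsq _ ?_
      simp only [Code.relaySignal, DecodeForward.toCode]
      split_ifs
      · exact hr _ _ _
      · simp
  have hsum : ∀ f : Fin n → Fin T → ℝ≥0∞, (∀ k t, f k t ≤ 1) → ∑ k, ∑ t, f k t ≤ n * T :=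
    fun f hf => by
      calc ∑ k, ∑ t, f k t ≤ ∑ _k : Fin n, ∑ _t : Fin T, 1 :=
            Finset.sum_le_sum fun k _ => Finset.sum_le_sum fun t _ => hf k t
        _ = n * T := by simp
  refine ⟨ENNReal.div_le_of_le_mul ?_, fun i => ENNReal.div_le_of_le_mul ?_⟩
  · calc _ ≤ ∑ _m : Fin B → Fin M, ((n : ℝ≥0∞) * T) :=
          Finset.sum_le_sum fun m _ => hsum _ (henc m)
      _ = _ := by rw [Finset.sum_const, nsmul_eq_mul, mul_comm, Finset.card_univ]
  · calc _ ≤ ∑ _m : Fin B → Fin M, ((n : ℝ≥0∞) * T) := by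
          refine Finset.sum_le_sum fun m _ => ?_
          calc _ ≤ ∫⁻ _, ((n : ℝ≥0∞) * T) ∂channelLaw n T ρsr ρrd :=
                lintegral_mono fun ω => hsum _ (hrel ω m i)
            _ = _ := by simp
      _ = _ := by rw [Finset.sum_const, nsmul_eq_mul, mul_comm, Finset.card_univ]

lemma sum_div_card_le {ι : Type*} [Fintype ι] (f : ι → ℝ≥0∞) {δ : ℝ≥0∞} (h : ∀ i, f i ≤ δ) :
    (∑ i, f i) / Fintype.card ι ≤ δ := by
  refine ENNReal.div_le_of_le_mul ?_
  calc ∑ i, f i ≤ ∑ _i : ι, δ := Finset.sum_le_sum fun i _ => h i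
    _ = _ := by rw [Finset.sum_const, nsmul_eq_mul, mul_comm, Finset.card_univ]

/-- The error probabilities of decode-and-forward when the two codebooks decode correctly
whenever there are few bad blocks. -/
lemma errorProb_toCode_le (d : DecodeForward L (T + 1) M) (hL : 0 < L) (hn : (B + 1) * L ≤ n)
    {Δ : ℝ} {e : ℕ} {ρsr ρrd : Fin 2 → ℝ≥0} {δ : ℝ≥0∞}
    (hs : ∀ m g w, FewBadBlocks Δ e g w →
      d.relayDec (fun j t => g j * d.sourceEnc m j t + w j t) = m)
    (hr : ∀ m g w, FewBadBlocks Δ e g w →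
      d.destDec (fun j t => g j * d.relayEnc m j t + w j t) = m)
    (hδs : 2 ^ L * badProb T (ρsr 0) Δ ^ (e + 1) ≤ δ)
    (hδr : 2 ^ L * badProb T (ρrd 0) Δ ^ (e + 1) ≤ δ) :
    d.relayErrorProb n B hL ρsr ρrd ≤ B * δ ∧
      (d.toCode n B hL).errorProb ρsr ρrd ≤ B * δ + B * δ := by
  set P := channelLaw n (T + 1) ρsr ρrd with hP
  let badS : Fin B → Set (Channel n (T + 1)) := fun b => {ω | ¬ FewBadBlocks Δ e
    (fun j => ω.1 0 (groupIndex hn b b.isLt.le j))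
    (fun j => ω.2.2.1 0 (groupIndex hn b b.isLt.le j))}
  let badR : Fin B → Set (Channel n (T + 1)) := fun b => {ω | ¬ FewBadBlocks Δ e
    (fun j => ω.2.1 0 (groupIndex hn (b + 1) b.isLt j))
    (fun j => ω.2.2.2 (groupIndex hn (b + 1) b.isLt j))}
  -- The inequality needs no measurability of `s`, so none has to be proved for the events with many
  -- bad blocks.
  have hmono : ∀ {α β : Type} [MeasurableSpace α] [MeasurableSpace β] {μ : Measure α}
      {ν : Measure β} {f : α → β}, MeasurePreserving f μ ν → ∀ s : Set β, μ (f ⁻¹' s) ≤ ν s :=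
    fun {_ _ _ _ μ ν f} hf s => by
      rw [← hf.map_eq]
      exact Measure.le_map_apply hf.measurable.aemeasurable s
  have hbadS : ∀ b, P (badS b) ≤ δ := fun b =>
    (hmono (measurePreserving_srLink ρsr ρrd 0) {p | ¬ FewBadBlocks Δ e
      (fun j => p.1 (groupIndex hn b b.isLt.le j))
      (fun j => p.2 (groupIndex hn b b.isLt.le j))}).trans
      ((linkLaw_not_fewBadBlocks_le _ _ _ _).trans hδs)
  have hbadR : ∀ b, P (badR b) ≤ δ := fun b =>
    (hmono (measurePreserving_rdLink ρsr ρrd 0) {p | ¬ FewBadBlocks Δ e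
      (fun j => p.1 (groupIndex hn (b + 1) b.isLt j))
      (fun j => p.2 (groupIndex hn (b + 1) b.isLt j))}).trans
      ((linkLaw_not_fewBadBlocks_le _ _ _ _).trans hδr)
  have hunion : ∀ bad : Fin B → Set (Channel n (T + 1)), (∀ b, P (bad b) ≤ δ) →
      P (⋃ b, bad b) ≤ B * δ := fun bad hbad => by
    refine (measure_iUnion_fintype_le P bad).trans ?_
    calc ∑ b, P (bad b) ≤ ∑ _b : Fin B, δ := Finset.sum_le_sum fun b _ => hbad b
      _ = B * δ := by simp
  have hrelay : ∀ ω m b, ω ∉ badS b →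
      d.relayDec (group L (relayReceives ω ((d.toCode n B hL).encode m) 0) b) = m b := by
    intro ω m b hω
    rw [group_relayReceives d hL hn]
    exact hs _ _ _ (not_not.1 hω)
  constructor
  · refine sum_div_card_le _ fun m => ?_
    refine (measure_mono ?_).trans (hunion badS hbadS)
    rintro ω ⟨b, hb⟩
    refine Set.mem_iUnion.2 ⟨b, ?_⟩
    by_contra hω
    exact hb (hrelay ω m b hω)
  · refine sum_div_card_le _ fun m => ?_
    refine (measure_mono ?_).trans ((measure_union_le _ _).trans
      (add_le_add (hunion badS hbadS) (hunion badR hbadR)))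
    intro ω hω
    by_contra hcon
    simp only [Set.mem_union, Set.mem_iUnion, not_or, not_exists] at hcon
    refine hω (funext fun b => ?_)
    change d.destDec (group L ((d.toCode n B hL).destSignal ω m) (b + 1)) = m b
    rw [group_destSignal d hL hn ω m b (hrelay ω m b (hcon.1 b))]
    exact hr _ _ _ (not_not.1 (hcon.2 b))

/-- A rate achieved by decode-and-forward with a `K × K` grid for each data symbol, when at most
every `N`-th block is allowed to be bad and there are `N` sub-messages. -/
theorem achievableByDecodeForwardR1_of_badProb_le {K N : ℕ} (hK : 1 ≤ K) (hN : 1 ≤ N)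
    {ρsr ρrd : Fin 2 → ℝ≥0} (hsr : badProb T (ρsr 0) (1 / (2 * K)) ≤ ENNReal.ofReal ((1 / 4) ^ N))
    (hrd : badProb T (ρrd 0) (1 / (2 * K)) ≤ ENNReal.ofReal ((1 / 4) ^ N)) {R D : ℝ}
    (hD : D = (1 - 2 / N) * (2 * T * Real.logb 2 K) - 1) (hD0 : 0 ≤ D)
    (hR : ((T + 1 : ℕ) : ℝ) * R * (N + 1) < N * D) :
    AchievableByDecodeForwardR1 (T + 1) ρsr ρrd R := by
  intro ε hε
  have hN' : (1 : ℝ) ≤ N := by exact_mod_cast hN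
  have hK' : (1 : ℝ) ≤ K := by exact_mod_cast hK
  have hLtend : Tendsto (fun n : ℕ => n / (N + 1)) atTop atTop :=
    Nat.tendsto_div_const_atTop (by omega)
  have hεlim : ∀ᶠ L : ℕ in atTop, 2 * N * (1 / 2 : ℝ) ^ L ≤ ε := by
    have h : Tendsto (fun L : ℕ => 2 * N * (1 / 2 : ℝ) ^ L) atTop (𝓝 (2 * N * 0)) :=
      (tendsto_pow_atTop_nhds_zero_of_lt_one (by norm_num) (by norm_num)).const_mul _
    rw [mul_zero] at h
    exact h.eventually_le_const (NNReal.coe_pos.2 hε)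
  -- The strict inequality `hR` leaves room for the blocks wasted when `n` is rounded down to a
  -- multiple of `N + 1`.
  set gap : ℝ := N * D - ((T + 1 : ℕ) : ℝ) * R * (N + 1) with hgap
  have hgap0 : 0 < gap := by linarith
  have hlarge : ∀ᶠ n : ℕ in atTop, N * D * (N + 1) ≤ n * gap := by
    filter_upwards [(tendsto_natCast_atTop_atTop (R := ℝ)).eventually_ge_atTop
      (N * D * (N + 1) / gap)] with n hn
    rwa [div_le_iff₀ hgap0] at hn
  filter_upwards [hLtend.eventually hεlim, hLtend.eventually_gt_atTop 0, hlarge] with n hεn hL hnl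
  -- The `N` sub-messages occupy `N + 1` groups because the relay lags by one group.
  set L := n / (N + 1) with hLdef
  set e := L / N with he
  obtain ⟨M, x, dec, hdec, hx, hM, hcorr⟩ := exists_link_code (T := T) hK L e
  let d : DecodeForward L (T + 1) M := ⟨x, dec, x, dec, hdec, hdec⟩
  have hn : (N + 1) * L ≤ n := Nat.mul_div_le n (N + 1)
  have hpow : ∀ p : ℝ≥0∞, p ≤ ENNReal.ofReal ((1 / 4) ^ N) →
      2 ^ L * p ^ (e + 1) ≤ ENNReal.ofReal ((1 / 2) ^ L) := fun p hp => by
    -- With more than `L / N` bad blocks, each of probability at most `4 ^ (-N)`, the factor `4 ^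
    -- (-L)` beats the `2 ^ L` of the union bound.
    have hLe : L ≤ N * (e + 1) := (Nat.lt_mul_div_succ L (by omega)).le
    calc 2 ^ L * p ^ (e + 1) ≤ 2 ^ L * (ENNReal.ofReal ((1 / 4) ^ N)) ^ (e + 1) := by gcongr
      _ = ENNReal.ofReal (2 ^ L * (1 / 4) ^ (N * (e + 1))) := by
        rw [ENNReal.ofReal_mul (by positivity), ENNReal.ofReal_pow (by norm_num) L, pow_mul,
          ENNReal.ofReal_pow (by positivity) (e + 1)]
        simp
      _ ≤ ENNReal.ofReal (2 ^ L * (1 / 4) ^ L) := by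
        apply ENNReal.ofReal_le_ofReal
        gcongr 2 ^ L * ?_
        exact pow_le_pow_of_le_one (by norm_num) (by norm_num) hLe
      _ = _ := by rw [← mul_pow]; norm_num
  have herr := errorProb_toCode_le (n := n) (B := N) d hL hn (ρsr := ρsr) (ρrd := ρrd)
    hcorr hcorr (hpow _ hsr) (hpow _ hrd)
  have hε' : (N : ℝ≥0∞) * ENNReal.ofReal ((1 / 2) ^ L) + N * ENNReal.ofReal ((1 / 2) ^ L) ≤ ε := by
    rw [← ENNReal.ofReal_natCast, ← ENNReal.ofReal_mul (by positivity),
      ← ENNReal.ofReal_add (by positivity) (by positivity), ← ENNReal.ofReal_coe_nnreal]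
    apply ENNReal.ofReal_le_ofReal
    linarith
  refine ⟨L, N, M, hL, d, hn, ?_, powerConstraint_toCode d hL hx hx ρsr ρrd,
    herr.1.trans (le_self_add.trans hε'), herr.2.trans hε'⟩
  set lq : ℝ := 2 * T * Real.logb 2 K with hlq
  have hlK : 0 ≤ Real.logb 2 K := Real.logb_nonneg (by norm_num) hK'
  have hlq0 : 0 ≤ lq := by positivity
  have hq : ((K : ℝ) ^ (2 * T)) = 2 ^ lq := by
    rw [hlq, mul_comm _ (Real.logb 2 K), Real.rpow_mul (by norm_num), Real.rpow_logb (by norm_num) (by norm_num)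
      (by positivity)]
    exact_mod_cast (Real.rpow_natCast (K : ℝ) (2 * T)).symm
  have hMlow : (2 : ℝ) ^ (L * D) ≤ M := by
    have h1 : ((K : ℝ) ^ (2 * T)) ^ L ≤ M * (2 ^ L * ((K : ℝ) ^ (2 * T)) ^ (2 * e)) := by
      exact_mod_cast hM
    rw [hq, ← Real.rpow_natCast, ← Real.rpow_natCast, ← Real.rpow_natCast,
      ← Real.rpow_mul (by norm_num), ← Real.rpow_mul (by norm_num),
      ← Real.rpow_add (by norm_num), ← div_le_iff₀ (by positivity),
      ← Real.rpow_sub (by norm_num)] at h1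
    refine le_trans (Real.rpow_le_rpow_of_exponent_le (by norm_num) ?_) h1
    have h2 : ((2 * e : ℕ) : ℝ) ≤ 2 / N * L := by
      have h3 : (e : ℝ) ≤ L / N := Nat.cast_div_le
      push_cast
      calc 2 * (e : ℝ) ≤ 2 * (L / N) := by linarith
        _ = _ := by ring
    have h4 := mul_le_mul_of_nonneg_left h2 hlq0
    rw [hD]
    linarith
  have hnL : (n : ℝ) ≤ (N + 1) * (L + 1) := by
    have := (Nat.lt_mul_div_succ n (show 0 < N + 1 by omega)).le
    exact_mod_cast this
  calc (2 : ℝ) ^ ((n : ℝ) * ((T + 1 : ℕ) : ℝ) * R) ≤ 2 ^ (L * D * N) := by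
        refine Real.rpow_le_rpow_of_exponent_le (by norm_num) ?_
        have h1 : (0 : ℝ) < N + 1 := by positivity
        have h2 : (n : ℝ) * (N * D) ≤ (N + 1) * (L + 1) * (N * D) :=
          mul_le_mul_of_nonneg_right hnL (by positivity)
        have h3 : ((N : ℝ) + 1) * ((n : ℝ) * ((T + 1 : ℕ) : ℝ) * R) ≤ (N + 1) * (L * D * N) := by
          rw [hgap] at hnl
          nlinarith
        exact le_of_mul_le_mul_left h3 h1
    _ = ((2 : ℝ) ^ (L * D)) ^ N := by rw [Real.rpow_mul (by norm_num), Real.rpow_natCast]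
    _ ≤ (M : ℝ) ^ N := by gcongr

/-- Nonpositive rates are achieved by a code with a single message. -/
lemma achievableByDecodeForwardR1_of_nonpos (ρsr ρrd : Fin 2 → ℝ≥0) {R : ℝ} (hR : R ≤ 0) :
    AchievableByDecodeForwardR1 T ρsr ρrd R := by
  intro ε _
  filter_upwards [eventually_ge_atTop 1] with n hn
  let d : DecodeForward 1 T 1 :=
    ⟨fun _ => 0, fun _ => 0, fun _ => 0, fun _ => 0, measurable_const, measurable_const⟩
  refine ⟨1, 0, 1, one_pos, d, by simpa using hn, ?_,
    powerConstraint_toCode d one_pos (by simp [d]) (by simp [d]) ρsr ρrd, ?_, ?_⟩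
  · rw [pow_zero]
    exact Real.rpow_le_one_of_one_le_of_nonpos (by norm_num)
      (mul_nonpos_of_nonneg_of_nonpos (by positivity) hR)
  · simp [DecodeForward.relayErrorProb]
  · refine sum_div_card_le _ fun m => ?_
    rw [show {ω | (d.toCode n 0 one_pos).decode ((d.toCode n 0 one_pos).destSignal ω m) ≠ m} = ∅
      from Set.eq_empty_of_forall_notMem fun ω hω => hω (Subsingleton.elim _ _)]
    simp

/-- Decode-and-forward codes are relaying codes. -/
lemma AchievableByDecodeForwardR1.achievable {ρsr ρrd : Fin 2 → ℝ≥0} {R : ℝ}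
    (h : AchievableByDecodeForwardR1 T ρsr ρrd R) : Achievable T ρsr ρrd R := by
  intro ε hε
  filter_upwards [h ε hε] with n ⟨L, B, M, hL, d, hn, hM, hpow, _, herr⟩
  let f : (Fin B → Fin M) ≃ Fin (M ^ B) := finFunctionFinEquiv
  let c₀ := d.toCode n B hL
  let c : Code n T (Fin (M ^ B)) :=
    { encode := fun m => c₀.encode (f.symm m)
      relay := c₀.relay
      decode := fun y => f (c₀.decode y)
      measurable_relay := c₀.measurable_relay
      causal := c₀.causal
      measurable_decode := fun m => by
        have : {y | f (c₀.decode y) = m} = {y | c₀.decode y = f.symm m} := by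
          ext y; exact f.eq_symm_apply.symm
        rw [this]
        exact c₀.measurable_decode _ }
  have hcard : Fintype.card (Fin (M ^ B)) = Fintype.card (Fin B → Fin M) := by simp
  refine ⟨M ^ B, c, by exact_mod_cast hM, ⟨?_, fun i => ?_⟩, ?_⟩
  · have h1 := hpow.1
    rw [← hcard, ← f.symm.sum_comp] at h1
    exact h1
  · have h1 := hpow.2 i
    rw [← hcard, ← f.symm.sum_comp] at h1
    exact h1
  · have h1 := herr
    unfold Code.errorProb at h1 ⊢
    rw [← hcard, ← f.symm.sum_comp] at h1
    refine le_trans (le_of_eq ?_) h1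
    congr 1
    refine Finset.sum_congr rfl fun m _ => ?_
    congr 1
    ext ω
    exact not_congr f.eq_symm_apply.symm

end DecodeAndForward

/-! ### Generalized degrees of freedom -/

lemma tendsto_logb_nnreal : Tendsto (fun snr : ℝ≥0 => Real.logb 2 snr) atTop atTop :=
  (Real.tendsto_logb_atTop (by norm_num)).comp (NNReal.tendsto_coe_atTop.2 tendsto_id)

lemma logb_pos_of_one_lt {snr : ℝ≥0} (h : 1 < snr) : 0 < Real.logb 2 snr :=
  Real.logb_pos (by norm_num) (by exact_mod_cast h)

/-- The upper bound is required at every `snr > 1`, since it also provides the existence of the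
supremum; additive constants vanish after division by `logb 2 snr`. -/
lemma hasPrelog_of_bounds {rates : (Fin 2 → ℝ≥0) → (Fin 2 → ℝ≥0) → Set ℝ} {γsr γrd : Fin 2 → ℝ}
    {g : ℝ}
    (hne : ∀ snr : ℝ≥0, 1 < snr → (rates (fun i => snr ^ γsr i) (fun i => snr ^ γrd i)).Nonempty)
    (hU : ∀ η > 0, ∃ K : ℝ, ∀ snr : ℝ≥0, 1 < snr →
      ∀ R ∈ rates (fun i => snr ^ γsr i) (fun i => snr ^ γrd i), R ≤ (g + η) * Real.logb 2 snr + K)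
    (hL : ∀ η > 0, ∀ᶠ snr : ℝ≥0 in atTop,
      (g - η) * Real.logb 2 snr ∈ rates (fun i => snr ^ γsr i) (fun i => snr ^ γrd i)) :
    HasPrelog rates γsr γrd g := by
  have hlub : ∀ snr : ℝ≥0, 1 < snr → IsLUB (rates (fun i => snr ^ γsr i) (fun i => snr ^ γrd i))
      (sSup (rates (fun i => snr ^ γsr i) (fun i => snr ^ γrd i))) := fun snr hs => by
    obtain ⟨K, hK⟩ := hU 1 one_pos
    exact isLUB_csSup (hne snr hs) ⟨_, fun R hR => hK snr hs R hR⟩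
  refine ⟨_, hlub, tendsto_order.2 ⟨fun a ha => ?_, fun b hb => ?_⟩⟩
  · filter_upwards [hL ((g - a) / 2) (by linarith), eventually_gt_atTop 1] with snr hs h1
    have hl := logb_pos_of_one_lt h1
    rw [lt_div_iff₀ hl]
    have := (hlub snr h1).1 hs
    nlinarith
  · obtain ⟨K, hK⟩ := hU ((b - g) / 2) (by linarith)
    filter_upwards [tendsto_logb_nnreal.eventually_gt_atTop (2 * K / (b - g)),
      eventually_gt_atTop 1] with snr hs h1
    have hl := logb_pos_of_one_lt h1
    rw [div_lt_iff₀ hl]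
    rw [div_lt_iff₀ (by linarith)] at hs
    have h2 := (hlub snr h1).2 fun R hR => hK snr h1 R hR
    nlinarith

lemma exists_rate_bound {T : ℕ} (hT : 1 ≤ T) {γ η : ℝ} (hγ : 0 ≤ γ) (hη : 0 < η)
    {S : ℝ≥0 → Set ℝ}
    (h : ∀ a : ℝ, (T : ℝ) - 1 < a → ∃ K : ℝ, ∀ snr : ℝ≥0, 1 < snr → ∀ R ∈ S snr,
      T * R * Real.log 2 ≤ a * Real.log (1 + ((snr ^ γ : ℝ≥0) : ℝ)) + K) :
    ∃ K : ℝ, ∀ snr : ℝ≥0, 1 < snr → ∀ R ∈ S snr,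
      R ≤ ((1 - 1 / (T : ℝ)) * γ + η) * Real.logb 2 snr + K := by
  have hT' : (1 : ℝ) ≤ T := by exact_mod_cast hT
  have hT0 : (0 : ℝ) < T := by linarith
  have hlog2 : 0 < Real.log 2 := Real.log_pos (by norm_num)
  -- Chosen so that `a * γ ≤ (T - 1) * γ + T * η`; the denominator `γ + 1` covers `γ = 0`.
  set a : ℝ := T - 1 + T * η / (γ + 1) with ha
  have ha1 : (T : ℝ) - 1 < a := by
    have : 0 < T * η / (γ + 1) := by positivity
    linarith
  have ha0 : 0 ≤ a := by linarith
  obtain ⟨K, hK⟩ := h a ha1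
  refine ⟨(a * Real.log 2 + K) / (T * Real.log 2), fun snr hs R hR => ?_⟩
  have hs' : (1 : ℝ) < snr := by exact_mod_cast hs
  have hls : 0 < Real.log snr := Real.log_pos hs'
  have h1 := hK snr hs R hR
  have h2 : Real.log (1 + ((snr ^ γ : ℝ≥0) : ℝ)) ≤ Real.log 2 + γ * Real.log snr := by
    rw [NNReal.coe_rpow]
    have h3 : 1 ≤ (snr : ℝ) ^ γ := Real.one_le_rpow hs'.le hγ
    calc _ ≤ Real.log (2 * (snr : ℝ) ^ γ) := Real.log_le_log (by positivity) (by linarith)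
      _ = _ := by
        rw [Real.log_mul (by norm_num) (by positivity), Real.log_rpow (by linarith)]
  have h4 := mul_le_mul_of_nonneg_left h2 ha0
  have h5 : a * γ ≤ T * ((1 - 1 / (T : ℝ)) * γ + η) := by
    have e1 : T * ((1 - 1 / (T : ℝ)) * γ + η) = (T - 1) * γ + T * η := by field_simp
    have e2 : T * η / (γ + 1) * γ ≤ T * η := by
      rw [div_mul_eq_mul_div, div_le_iff₀ (by linarith)]
      nlinarith [mul_pos hT0 hη]
    rw [e1, ha]
    linarith
  have h6 := mul_le_mul_of_nonneg_right h5 hls.le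
  have h7 : T * Real.log 2 * (((1 - 1 / (T : ℝ)) * γ + η) * Real.logb 2 snr
      + (a * Real.log 2 + K) / (T * Real.log 2))
      = T * ((1 - 1 / (T : ℝ)) * γ + η) * Real.log snr + (a * Real.log 2 + K) := by
    rw [mul_add, mul_div_cancel₀ _ (by positivity), Real.logb]
    field_simp
  refine le_of_mul_le_mul_left ?_ (by positivity : 0 < T * Real.log 2)
  rw [h7]
  linarith

/-- The grid side `snr ^ (γ * (1 - 1 / N) / 2)` stops short of the full exponent. The spare factor
`snr ^ (γ / N)` drives the bad-block probability below `4 ^ (-N)`, and the rate losses of relative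
order `1 / N` are absorbed by `η` for large `N`. -/
lemma eventually_decodeForward {T : ℕ} (hT : 1 ≤ T) {γ : ℝ} (hγ : 0 ≤ γ) {γsr γrd : Fin 2 → ℝ}
    (hsr : γ ≤ γsr 0) (hrd : γ ≤ γrd 0) {η : ℝ} (hη : 0 < η) :
    ∀ᶠ snr : ℝ≥0 in atTop, AchievableByDecodeForwardR1 T (fun i => snr ^ γsr i)
      (fun i => snr ^ γrd i) (((1 - 1 / (T : ℝ)) * γ - η) * Real.logb 2 snr) := by
  obtain ⟨T, rfl⟩ : ∃ T', T = T' + 1 := ⟨T - 1, by omega⟩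
  by_cases hzero : T = 0 ∨ γ = 0
  · have hg : (1 - 1 / ((T + 1 : ℕ) : ℝ)) * γ = 0 := by
      rcases hzero with h | h <;> simp [h]
    filter_upwards [eventually_gt_atTop 1] with snr hs
    refine achievableByDecodeForwardR1_of_nonpos _ _ ?_
    rw [hg]
    nlinarith [logb_pos_of_one_lt hs]
  push Not at hzero
  have hT1 : (1 : ℝ) ≤ T := by exact_mod_cast Nat.one_le_iff_ne_zero.2 hzero.1
  have hγ0 : 0 < γ := lt_of_le_of_ne hγ (Ne.symm hzero.2)
  obtain ⟨N₀, hN₀⟩ := exists_nat_gt (4 * T * γ / ((T + 1) * η))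
  set N : ℕ := N₀ + 3 with hN
  have hN3 : (3 : ℝ) ≤ N := by rw [hN]; push_cast; linarith [Nat.cast_nonneg (α := ℝ) N₀]
  have hNη : 4 * T * γ < (N + 1) * ((T + 1) * η) := by
    rw [div_lt_iff₀ (by positivity)] at hN₀
    refine hN₀.trans_le ?_
    gcongr
    rw [hN]; push_cast; linarith
  obtain ⟨c, hc0, hc⟩ := exists_badProb_le T (θ := (1 / 4) ^ N) (by positivity)
  set s : ℝ := γ * (1 - 1 / N) / 2 with hs
  have hN1 : (1 : ℝ) / N ≤ 1 / 3 := one_div_le_one_div_of_le (by norm_num) hN3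
  have hs0 : 0 < s := by
    have : 0 < 1 - 1 / (N : ℝ) := by linarith
    positivity
  -- The coefficient of `logb 2 snr` in the rate margin. Expanded, it is `(N + 1) * (T + 1) * η - 4
  -- * T * γ + 2 / N * (T * γ)`, which is the origin of the choice of `N₀`.
  set A : ℝ := (N - 2) * (1 - 1 / N) * (T * γ) - (N + 1) * (T * γ - (T + 1) * η) with hA
  have hA0 : 0 < A := by
    have e1 : ((N : ℝ) - 2) * (1 - 1 / N) = N - 3 + 2 / N := by field_simp; ring
    have h2 : 0 < 2 / (N : ℝ) * (T * γ) := by positivity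
    rw [hA, e1]
    nlinarith
  have hpowlim : Tendsto (fun snr : ℝ≥0 => (snr : ℝ) ^ (γ / N)) atTop atTop :=
    (tendsto_rpow_atTop (by positivity)).comp (NNReal.tendsto_coe_atTop.2 tendsto_id)
  filter_upwards [eventually_gt_atTop 1, hpowlim.eventually_ge_atTop (4 * c),
    -- This makes `logb 2 K ≥ 2`, enough for `D ≥ 0` despite the factor `2 ^ L` lost in the
    -- Gilbert–Varshamov bound.
    tendsto_logb_nnreal.eventually_ge_atTop (3 / s),
    tendsto_logb_nnreal.eventually_gt_atTop ((2 * T * (N - 2) + N) / A)] with snr h1 hpow hl3 hlA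
  have h1' : (1 : ℝ) < snr := by exact_mod_cast h1
  have hsnr0 : (0 : ℝ) < snr := by linarith
  set l := Real.logb 2 snr with hl
  set z : ℝ := (snr : ℝ) ^ s with hz
  have hz1 : 1 ≤ z := Real.one_le_rpow h1'.le hs0.le
  set K : ℕ := ⌊z⌋₊ with hK
  have hK1 : 1 ≤ K := Nat.le_floor (by simpa using hz1)
  have hK1' : (1 : ℝ) ≤ K := by exact_mod_cast hK1
  have hKz : (K : ℝ) ≤ z := Nat.floor_le (by linarith)
  have hzK : z / 2 ≤ K := by
    have := Nat.lt_floor_add_one z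
    rw [← hK] at this
    linarith
  have hlogK : s * l - 1 ≤ Real.logb 2 K := by
    have e1 : s * l - 1 = Real.logb 2 (z / 2) := by
      rw [Real.logb_div (by linarith) (by norm_num), hz, Real.logb_rpow_eq_mul_logb_of_pos hsnr0,
        Real.logb_self_eq_one (by norm_num)]
    rw [e1]
    exact Real.logb_le_logb_of_le (by norm_num) (by linarith) hzK
  have hbad : ∀ γ' : ℝ, γ ≤ γ' →
      badProb T (snr ^ γ') (1 / (2 * K)) ≤ ENNReal.ofReal ((1 / 4) ^ N) := by
    intro γ' hγ'
    refine hc _ _ (NNReal.rpow_pos (by exact_mod_cast hsnr0)) (by positivity) ?_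
    rw [NNReal.coe_rpow]
    have h2 : (snr : ℝ) ^ γ ≤ (snr : ℝ) ^ γ' := Real.rpow_le_rpow_of_exponent_le h1'.le hγ'
    have h3 : (snr : ℝ) ^ γ = z ^ 2 * (snr : ℝ) ^ (γ / N) := by
      rw [hz, ← Real.rpow_natCast, ← Real.rpow_mul hsnr0.le, ← Real.rpow_add hsnr0]
      congr 1
      rw [hs]; push_cast; field_simp; ring
    have h4 : (K : ℝ) ^ 2 ≤ z ^ 2 := by gcongr
    have h5 : (K : ℝ) ^ 2 * (4 * c) ≤ (snr : ℝ) ^ γ' := by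
      refine le_trans ?_ h2
      rw [h3]
      exact mul_le_mul h4 hpow (by positivity) (by positivity)
    have h6 : (1 / (2 * (K : ℝ))) ^ 2 * (snr : ℝ) ^ γ' = (snr : ℝ) ^ γ' / (4 * K ^ 2) := by
      field_simp; ring
    rw [h6, le_div_iff₀ (by positivity)]
    linarith
  have hN2 : 0 ≤ 1 - 2 / (N : ℝ) := by
    have : 2 / (N : ℝ) = 2 * (1 / N) := by ring
    linarith
  refine achievableByDecodeForwardR1_of_badProb_le hK1 (by omega) (hbad _ hsr) (hbad _ hrd)
    (D := (1 - 2 / N) * (2 * T * Real.logb 2 K) - 1) rfl ?_ ?_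
  · rw [div_le_iff₀ hs0] at hl3
    have h2 : 2 ≤ Real.logb 2 K := by linarith
    have h3 : 4 ≤ 2 * T * Real.logb 2 K := by nlinarith
    have h4 : (1 : ℝ) / 3 ≤ 1 - 2 / (N : ℝ) := by
      have : 2 / (N : ℝ) = 2 * (1 / N) := by ring
      linarith
    nlinarith
  · rw [div_lt_iff₀ hA0] at hlA
    have e1 : ((T + 1 : ℕ) : ℝ) * (((1 - 1 / ((T + 1 : ℕ) : ℝ)) * γ - η) * l) * (N + 1)
        = (N + 1) * (T * γ - (T + 1) * η) * l := by
      push_cast; field_simp; ring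
    have h2 : (N : ℝ) * ((1 - 2 / N) * (2 * T * (s * l - 1)) - 1)
        ≤ N * ((1 - 2 / N) * (2 * T * Real.logb 2 K) - 1) := by gcongr
    have e2 : (N : ℝ) * ((1 - 2 / N) * (2 * T * (s * l - 1)) - 1)
        = (N - 2) * (1 - 1 / N) * (T * γ) * l - (2 * T * (N - 2) + N) := by
      rw [hs]; field_simp; ring
    rw [e1]
    refine lt_of_lt_of_le ?_ h2
    rw [e2]
    rw [hA] at hlA
    linarith

/-- One converse and one scheme serve both claims: decode-and-forward inherits the upper bound as a
subclass of codes and supplies the lower bound for the capacity. -/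
lemma hasGDoF_of_rate_bound {T : ℕ} (hT : 1 ≤ T) {γ : ℝ} (hγ : 0 ≤ γ) {γsr γrd : Fin 2 → ℝ}
    (hsr : γ ≤ γsr 0) (hrd : γ ≤ γrd 0)
    (h : ∀ a : ℝ, (T : ℝ) - 1 < a → ∃ K : ℝ, ∀ snr : ℝ≥0, 1 < snr → ∀ R,
      Achievable T (fun i => snr ^ γsr i) (fun i => snr ^ γrd i) R →
      T * R * Real.log 2 ≤ a * Real.log (1 + ((snr ^ γ : ℝ≥0) : ℝ)) + K) :
    HasGDoF T γsr γrd ((1 - 1 / (T : ℝ)) * γ) ∧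
      DecodeForwardR1HasGDoF T γsr γrd ((1 - 1 / (T : ℝ)) * γ) := by
  have hU : ∀ η > 0, ∃ K : ℝ, ∀ snr : ℝ≥0, 1 < snr → ∀ R,
      Achievable T (fun i => snr ^ γsr i) (fun i => snr ^ γrd i) R →
      R ≤ ((1 - 1 / (T : ℝ)) * γ + η) * Real.logb 2 snr + K := fun η hη =>
    exists_rate_bound hT hγ hη
      (S := fun snr => {R | Achievable T (fun i => snr ^ γsr i) (fun i => snr ^ γrd i) R}) h
  have h0 : ∀ snr : ℝ≥0,
      AchievableByDecodeForwardR1 T (fun i => snr ^ γsr i) (fun i => snr ^ γrd i) 0 :=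
    fun snr => achievableByDecodeForwardR1_of_nonpos _ _ le_rfl
  constructor
  · exact hasPrelog_of_bounds (fun snr _ => ⟨0, (h0 snr).achievable⟩) hU fun η hη =>
      (eventually_decodeForward hT hγ hsr hrd hη).mono fun _ hs => hs.achievable
  · refine hasPrelog_of_bounds (fun snr _ => ⟨0, h0 snr⟩) (fun η hη => ?_) fun η hη =>
      eventually_decodeForward hT hγ hsr hrd hη
    obtain ⟨K, hK⟩ := hU η hη
    exact ⟨K, fun snr hs R hR => hK snr hs R (AchievableByDecodeForwardR1.achievable hR)⟩

end Diamond

theorem mainTheorem4 (T : ℕ) (hT : 1 ≤ T) (γsr1 γsr2 γrd1 γrd2 : ℝ) :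
    (0 ≤ γsr1 → γrd1 ≥ γsr1 → γsr1 ≥ γsr2 →
      Diamond.HasGDoF T ![γsr1, γsr2] ![γrd1, γrd2] ((1 - 1 / (T : ℝ)) * γsr1) ∧
      Diamond.DecodeForwardR1HasGDoF T ![γsr1, γsr2] ![γrd1, γrd2]
        ((1 - 1 / (T : ℝ)) * γsr1)) ∧
    (0 ≤ γrd1 → γsr1 ≥ γrd1 → γrd1 ≥ γrd2 →
      Diamond.HasGDoF T ![γsr1, γsr2] ![γrd1, γrd2] ((1 - 1 / (T : ℝ)) * γrd1) ∧
      Diamond.DecodeForwardR1HasGDoF T ![γsr1, γsr2] ![γrd1, γrd2]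
        ((1 - 1 / (T : ℝ)) * γrd1)) := by
  have hT' : (1 : ℝ) ≤ T := by exact_mod_cast hT
  refine ⟨fun hγ hrd hsr => ?_, fun hγ hsr hrd => ?_⟩
  · refine Diamond.hasGDoF_of_rate_bound hT hγ le_rfl hrd fun a ha => ?_
    -- Solves `β / 2 * (T + 1) - 2 = a`; the requirement `2 < β` is then exactly `T - 1 < a`.
    obtain ⟨K, hK⟩ := Diamond.rate_le_of_source_cut hT (β := 2 * (a + 2) / (T + 1))
      (by rw [lt_div_iff₀ (by linarith)]; linarith)
    refine ⟨K, fun snr hs R hR => ?_⟩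
    have h := hK _ _ R (fun i => NNReal.rpow_pos (zero_lt_one.trans hs))
      (NNReal.rpow_le_rpow_of_exponent_le hs.le hsr) hR
    rwa [show 2 * (a + 2) / ((T : ℝ) + 1) / 2 * (T + 1) - 2 = a by field_simp; ring] at h
  · refine Diamond.hasGDoF_of_rate_bound hT hγ hsr le_rfl fun a ha => ?_
    -- Solves `β / 2 * T - 1 = a`, and again `2 < β` means `T - 1 < a`.
    obtain ⟨K, hK⟩ := Diamond.rate_le_of_destination_cut hT (β := 2 * (a + 1) / T)
      (by rw [lt_div_iff₀ (by linarith)]; linarith)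
    refine ⟨K, fun snr hs R hR => ?_⟩
    have h := hK _ _ R (fun i => NNReal.rpow_pos (zero_lt_one.trans hs))
      (NNReal.rpow_le_rpow_of_exponent_le hs.le hrd) hR
    rwa [show 2 * (a + 1) / (T : ℝ) / 2 * T - 1 = a by field_simp; ring] at h
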